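/- Let $L>0$ and let $P\in H^2(0,L)$ be real-valued (identified with its continuous representative on $[0,L]$) with $P(x)\ge P^0>0$ on $[0,L]$ for some constant $P^0$. Let $H^n(0,L)$ denote the complex Sobolev space of functions whose weak derivatives up to order $n$ lie in $L^2(0,L)$, and let $$\mathcal H=\{z=(w,v,\xi,\psi): w\in H^2(0,L),\ v\in H^1(0,L),\ \xi=v(L),\ \psi=v(0)\}\subset H^2(0,L)\times H^1(0,L)\times\mathbb C\times\mathbb C,$$ with the inner product inherited from the product space. For real $\theta_1,\dots,\theta_4$ put $F[w,v]=\theta_1v(0)+\theta_2v'(0)+\theta_3w(0)+\theta_4w'(0)$ and let $A:D(A)\subset\mathcal H\to\mathcal H$ be the operator $$A(w,v,\xi,\psi)=\big(v,\ (Pw')',\ -w'(L),\ F[w,v]\big),$$ $$D(A)=\{(w,v,\xi,\psi)\in\mathcal H: w\in H^3(0,L),\ v\in H^2(0,L),\ (Pw')'(L)=-w'(L),\ (Pw')'(0)=F[w,v]\}.$$ **Theorem.** Suppose that there are constants $a,b>0$ with $(a+b-1)^2<4ab$ such that $\theta_1=\frac{\theta_3}{b}-a$ and $\theta_2=\frac{\theta_4}{b}$,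 and that $\theta_1,\theta_3<0$ and $\theta_2,\theta_4>0$. Then $A$ is the infinitesimal generator of a $C_0$-semigroup $\{T(t)\}_{t\ge0}$ of uniformly bounded operators on $\mathcal H$. Moreover, set $\alpha_1=\frac{\theta_2}{2P(0)}$ and $\alpha_2=-\frac{\theta_2\theta_3}{2\theta_4}$. Then for all sufficiently small $\gamma>0$ the form $$\begin{aligned}\langle z_1,z_2\rangle_{\mathcal H}={}&\alpha_1\int_0^L\big[\gamma(Pw_1')'(P\bar w_2')'+Pw_1'\bar w_2'\big]\,dx+\alpha_1\gamma P(L)w_1'(L)\bar w_2'(L)+\alpha_2w_1(0)\bar w_2(0)\\&+\alpha_1\int_0^L\big(\gamma Pv_1'\bar v_2'+v_1\bar v_2\big)\,dx+\alpha_1P(L)\xi_1\bar\xi_2+\alpha_2\gamma\psi_1\bar\psi_2\\&+\tfrac12\big(\psi_1-2\alpha_1P(0)w_1'(0)+2\alpha_2w_1(0)\big)\big(\bar\psi_2-2\alpha_1P(0)\bar w_2'(0)+2\alpha_2\bar w_2(0)\big)\end{aligned}$$ is an inner product on $\mathcal H$ whose norm $\|\cdot\|_{\mathcal H}$ is equivalent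 to the original one, and $\|T(t)z\|_{\mathcal H}\le\|z\|_{\mathcal H}$ for all $t\ge0$ and $z\in\mathcal H$. -/

import Mathlib

open MeasureTheory Set Filter Topology
open scoped NNReal ENNReal ContDiff

namespace Crane

/-! ### Sobolev spaces on the interval `(0, L)` through weak derivatives -/

/-- The complex Hilbert space `L²(0, L)`. -/
abbrev L2 (L : ℝ) : Type := Lp ℂ 2 ((volume : Measure ℝ).restrict (Ioo 0 L))

/-- Test functions on `(0, L)`: smooth with compact support inside the open interval. -/
structure IsTestFunction (L : ℝ) (φ : ℝ → ℝ) : Prop where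
  contDiff : ContDiff ℝ ∞ φ
  hasCompactSupport : HasCompactSupport φ
  tsupport_subset : tsupport φ ⊆ Ioo 0 L

/-- `g` is the weak derivative of `f` on `(0, L)`. It is only used for functions `f`, `g` that are
square integrable on `(0, L)`. -/
def IsWeakDeriv (L : ℝ) (f g : ℝ → ℂ) : Prop :=
  ∀ φ : ℝ → ℝ, IsTestFunction L φ →
    ∫ x in Ioo 0 L, deriv φ x • f x = -∫ x in Ioo 0 L, φ x • g x

theorem IsTestFunction.deriv {L : ℝ} {φ : ℝ → ℝ} (h : IsTestFunction L φ) :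
    IsTestFunction L (deriv φ) where
  contDiff := by
    have := h.contDiff
    rw [contDiff_infty_iff_deriv] at this
    exact this.2
  hasCompactSupport := h.hasCompactSupport.deriv
  tsupport_subset := tsupport_deriv_subset.trans h.tsupport_subset

theorem integrable_smul_testFunction {L : ℝ} {φ : ℝ → ℝ} (h : IsTestFunction L φ) {f : ℝ → ℂ}
    (hf : IntegrableOn f (Ioo 0 L)) : IntegrableOn (fun x => φ x • f x) (Ioo 0 L) := by
  obtain ⟨C, hC⟩ := h.hasCompactSupport.exists_bound_of_continuous h.contDiff.continuous
  exact hf.bdd_smul C h.contDiff.continuous.aestronglyMeasurable (ae_of_all _ hC)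

theorem L2.integrableOn {L : ℝ} (f : L2 L) : IntegrableOn f (Ioo 0 L) :=
  (Lp.memLp f).integrable (by norm_num)

theorem IsWeakDeriv.add {L : ℝ} {f₁ f₂ g₁ g₂ : ℝ → ℂ} (h₁ : IsWeakDeriv L f₁ g₁)
    (h₂ : IsWeakDeriv L f₂ g₂) (if₁ : IntegrableOn f₁ (Ioo 0 L)) (if₂ : IntegrableOn f₂ (Ioo 0 L))
    (ig₁ : IntegrableOn g₁ (Ioo 0 L)) (ig₂ : IntegrableOn g₂ (Ioo 0 L)) :
    IsWeakDeriv L (f₁ + f₂) (g₁ + g₂) := by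
  intro φ hφ
  simp only [Pi.add_apply, smul_add]
  rw [integral_add (integrable_smul_testFunction hφ.deriv if₁)
      (integrable_smul_testFunction hφ.deriv if₂),
    integral_add (integrable_smul_testFunction hφ ig₁) (integrable_smul_testFunction hφ ig₂),
    h₁ φ hφ, h₂ φ hφ]
  ring

theorem IsWeakDeriv.smul {L : ℝ} {f g : ℝ → ℂ} (h : IsWeakDeriv L f g) (c : ℂ) :
    IsWeakDeriv L (c • f) (c • g) := by
  intro φ hφ
  simp only [Pi.smul_apply]
  simp_rw [smul_comm _ c]
  rw [integral_smul, integral_smul, h φ hφ, smul_neg]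

theorem IsWeakDeriv.congr {L : ℝ} {f f' g g' : ℝ → ℂ} (h : IsWeakDeriv L f g)
    (hf : f =ᵐ[volume.restrict (Ioo 0 L)] f') (hg : g =ᵐ[volume.restrict (Ioo 0 L)] g') :
    IsWeakDeriv L f' g' := by
  intro φ hφ
  have e₁ : ∫ x in Ioo 0 L, _root_.deriv φ x • f' x = ∫ x in Ioo 0 L, _root_.deriv φ x • f x :=
    integral_congr_ae (by filter_upwards [hf] with x hx; rw [hx])
  have e₂ : ∫ x in Ioo 0 L, φ x • g' x = ∫ x in Ioo 0 L, φ x • g x :=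
    integral_congr_ae (by filter_upwards [hg] with x hx; rw [hx])
  rw [e₁, e₂, h φ hφ]

theorem IsWeakDeriv.unique {L : ℝ} {f : ℝ → ℂ} {g₁ g₂ : L2 L} (h₁ : IsWeakDeriv L f g₁)
    (h₂ : IsWeakDeriv L f g₂) : g₁ = g₂ := by
  have hint : IntegrableOn (fun x => g₁ x - g₂ x) (Ioo 0 L) :=
    (L2.integrableOn g₁).sub (L2.integrableOn g₂)
  have key := isOpen_Ioo.ae_eq_zero_of_integral_contDiff_smul_eq_zero (μ := volume)
    (U := Ioo (0 : ℝ) L) hint.locallyIntegrableOn (by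
      intro φ hφ₁ hφ₂ hφ₃
      have hφ : IsTestFunction L φ := ⟨hφ₁, hφ₂, hφ₃⟩
      rw [← setIntegral_eq_integral_of_forall_compl_eq_zero (s := Ioo 0 L)]
      · simp only [smul_sub]
        rw [integral_sub (integrable_smul_testFunction hφ (L2.integrableOn g₁))
          (integrable_smul_testFunction hφ (L2.integrableOn g₂))]
        have := (h₁ φ hφ).symm.trans (h₂ φ hφ)
        rw [neg_inj.mp this, sub_self]
      · intro x hx
        rw [image_eq_zero_of_notMem_tsupport (fun h => hx (hφ₃ h)), zero_smul])
  refine Lp.ext ?_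
  rw [Filter.EventuallyEq, ae_restrict_iff' measurableSet_Ioo]
  filter_upwards [key] with x hx hxL using sub_eq_zero.mp (hx hxL)

/-- The tuples `(f, f', …, f⁽ⁿ⁾)` of a function and its weak derivatives up to order `n`, all of
them in `L²(0, L)`. -/
def sobolevSubmodule (n : ℕ) (L : ℝ) : Submodule ℂ (PiLp 2 (fun _ : Fin (n + 1) => L2 L)) where
  carrier := {u | ∀ k : Fin n, IsWeakDeriv L (u k.castSucc) (u k.succ)}
  zero_mem' := fun k φ _ => by
    have h0 : ((0 : L2 L) : ℝ → ℂ) =ᵐ[volume.restrict (Ioo 0 L)] 0 := Lp.coeFn_zero _ _ _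
    have hz : IsWeakDeriv L (0 : ℝ → ℂ) 0 := fun φ _ => by simp
    exact (hz.congr h0.symm h0.symm) φ ‹_›
  add_mem' := fun {u v} hu hv k =>
    ((hu k).add (hv k) (L2.integrableOn _) (L2.integrableOn _) (L2.integrableOn _)
      (L2.integrableOn _)).congr (Lp.coeFn_add _ _).symm (Lp.coeFn_add _ _).symm
  smul_mem' := fun c u hu k =>
    ((hu k).smul c).congr (Lp.coeFn_smul _ _).symm (Lp.coeFn_smul _ _).symm

/-- The Sobolev space `Hⁿ(0, L)`. A function `f` is represented by the tuple `(f, f', …, f⁽ⁿ⁾)` of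
its weak derivatives, which is determined by `f`. The inner product inherited from the
`ℓ²`-product is the standard one, `⟨f, g⟩ = ∑ₖ ⟨f⁽ᵏ⁾, g⁽ᵏ⁾⟩_{L²}`. -/
def Sobolev (n : ℕ) (L : ℝ) : Type := sobolevSubmodule n L

noncomputable instance (n : ℕ) (L : ℝ) : NormedAddCommGroup (Sobolev n L) :=
  inferInstanceAs (NormedAddCommGroup (sobolevSubmodule n L))

noncomputable instance (n : ℕ) (L : ℝ) : InnerProductSpace ℂ (Sobolev n L) :=
  inferInstanceAs (InnerProductSpace ℂ (sobolevSubmodule n L))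

/-- The `k`-th weak derivative of `u ∈ Hⁿ(0, L)`, for `k ≤ n`; `D 0 u` is `u` itself. -/
noncomputable def D {n : ℕ} {L : ℝ} (k : Fin (n + 1)) : Sobolev n L →ₗ[ℂ] L2 L :=
  (PiLp.projₗ 2 (fun _ : Fin (n + 1) => L2 L) k).comp (sobolevSubmodule n L).subtype

theorem isWeakDeriv_D {n : ℕ} {L : ℝ} (u : Sobolev n L) (k : Fin n) :
    IsWeakDeriv L (D k.castSucc u) (D k.succ u) := u.2 k

/-- A complex function on `(0, L)` belongs to `Hⁿ(0, L)`. -/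
def MemSobolev (n : ℕ) (L : ℝ) (f : ℝ → ℂ) : Prop :=
  ∃ u : Sobolev n L, f =ᵐ[volume.restrict (Ioo 0 L)] D 0 u

/-! ### Point values -/

/-- `f ∈ L²(0, L)` has a representative that is continuous on `[0, L]`. -/
def HasContRep {L : ℝ} (f : L2 L) : Prop :=
  ∃ g : ℝ → ℂ, ContinuousOn g (Icc 0 L) ∧ f =ᵐ[volume.restrict (Ioo 0 L)] g

open Classical in
/-- The value at `x ∈ [0, L]` of the continuous representative of `f` (zero if there is none). -/
noncomputable def pt {L : ℝ} (f : L2 L) (x : ℝ) : ℂ :=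
  if h : HasContRep f then h.choose x else 0

theorem pt_eq {L : ℝ} (hL : 0 < L) {f : L2 L} {g : ℝ → ℂ} (hg : ContinuousOn g (Icc 0 L))
    (hfg : f =ᵐ[volume.restrict (Ioo 0 L)] g) {x : ℝ} (hx : x ∈ Icc 0 L) : pt f x = g x := by
  have h : HasContRep f := ⟨g, hg, hfg⟩
  have e : h.choose =ᵐ[volume.restrict (Icc 0 L)] g := by
    rw [← Measure.restrict_congr_set (Ioo_ae_eq_Icc (μ := volume) (a := (0 : ℝ)) (b := L))]
    exact h.choose_spec.2.symm.trans hfg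
  rw [pt, dif_pos h]
  exact Measure.eqOn_Icc_of_ae_eq volume hL.ne e h.choose_spec.1 hg hx

theorem pt_add {L : ℝ} (hL : 0 < L) {f g : L2 L} (hf : HasContRep f) (hg : HasContRep g)
    {x : ℝ} (hx : x ∈ Icc 0 L) : pt (f + g) x = pt f x + pt g x := by
  obtain ⟨f', hf', ef⟩ := hf
  obtain ⟨g', hg', eg⟩ := hg
  rw [pt_eq hL hf' ef hx, pt_eq hL hg' eg hx,
    pt_eq hL (hf'.add hg') ((Lp.coeFn_add f g).trans (ef.add eg)) hx, Pi.add_apply]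

theorem pt_smul {L : ℝ} (hL : 0 < L) {f : L2 L} (hf : HasContRep f) (c : ℂ)
    {x : ℝ} (hx : x ∈ Icc 0 L) : pt (c • f) x = c * pt f x := by
  obtain ⟨f', hf', ef⟩ := hf
  rw [pt_eq hL hf' ef hx,
    pt_eq hL (hf'.const_smul c) ((Lp.coeFn_smul c f).trans (ef.const_smul c)) hx, Pi.smul_apply,
    smul_eq_mul]

theorem pt_zero {L : ℝ} (hL : 0 < L) {x : ℝ} (hx : x ∈ Icc 0 L) : pt (0 : L2 L) x = 0 := by
  rw [pt_eq hL (g := 0) continuousOn_const (Lp.coeFn_zero _ _ _) hx, Pi.zero_apply]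

/-- A test function of integral zero is the derivative of a test function. -/
theorem exists_primitive {L : ℝ} (hL : 0 < L) {χ : ℝ → ℝ} (hχ : IsTestFunction L χ)
    (h0 : ∫ x in (0)..L, χ x = 0) : ∃ Φ, IsTestFunction L Φ ∧ deriv Φ = χ := by
  obtain ⟨a, b, ha, hab, hb, hK⟩ : ∃ a b, 0 < a ∧ a ≤ b ∧ b < L ∧ tsupport χ ⊆ Icc a b := by
    rcases (tsupport χ).eq_empty_or_nonempty with h | h
    · exact ⟨L / 2, L / 2, by linarith, le_rfl, by linarith, by simp [h]⟩
    · have hc : IsCompact (tsupport χ) := hχ.hasCompactSupport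
      have h1 := hχ.tsupport_subset (hc.sInf_mem h)
      have h2 := hχ.tsupport_subset (hc.sSup_mem h)
      refine ⟨_, _, h1.1, ?_, h2.2, fun x hx =>
        ⟨csInf_le hc.bddBelow hx, le_csSup hc.bddAbove hx⟩⟩
      exact csInf_le hc.bddBelow (hc.sSup_mem h)
  have hz : ∀ x, x ∉ Icc a b → χ x = 0 := fun x hx =>
    image_eq_zero_of_notMem_tsupport (fun h => hx (hK h))
  have hcont := hχ.contDiff.continuous
  have hd : ∀ x, HasDerivAt (fun y => ∫ t in (0)..y, χ t) (χ x) x := fun x =>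
    intervalIntegral.integral_hasDerivAt_right (hcont.intervalIntegrable _ _)
      (hcont.stronglyMeasurableAtFilter _ _) hcont.continuousAt
  have hder : deriv (fun y => ∫ t in (0)..y, χ t) = χ := funext fun x => (hd x).deriv
  have hsup : ∀ x, x ∉ Icc a b → ∫ t in (0)..x, χ t = 0 := by
    intro x hx
    rcases lt_or_ge x a with h | h
    · apply intervalIntegral.integral_zero_ae
      refine ae_of_all _ fun t ht => hz t fun h' => ?_
      have := ht.2
      have : t ≤ max 0 x := ht.2
      have : max 0 x < a := max_lt ha h
      linarith [h'.1]
    · have hxb : b < x := by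
        by_contra hc
        exact hx ⟨h, not_lt.mp hc⟩
      have e : ∫ t in x..L, χ t = 0 := by
        apply intervalIntegral.integral_zero_ae
        refine ae_of_all _ fun t ht => hz t fun h' => ?_
        have h3 : min x L < t := ht.1
        have : b < min x L := lt_min hxb hb
        linarith [h'.2]
      have := intervalIntegral.integral_add_adjacent_intervals
        (hcont.intervalIntegrable 0 x (μ := volume)) (hcont.intervalIntegrable x L)
      rw [e, h0, add_zero] at this
      exact this
  have hts : tsupport (fun y => ∫ t in (0)..y, χ t) ⊆ Icc a b :=
    closure_minimal (fun x hx => by_contra fun h => hx (hsup x h)) isClosed_Icc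
  refine ⟨_, ⟨?_, ?_, hts.trans fun x hx => ⟨ha.trans_le hx.1, hx.2.trans_lt hb⟩⟩, hder⟩
  · rw [contDiff_infty_iff_deriv]
    refine ⟨fun x => (hd x).differentiableAt, ?_⟩
    rw [hder]
    exact hχ.contDiff
  · exact isCompact_Icc.of_isClosed_subset (isClosed_tsupport _) hts

theorem integral_deriv_mul_primitive {L : ℝ} {φ : ℝ → ℝ} (hφ : IsTestFunction L φ)
    {g : ℝ → ℝ} (hg : IntervalIntegrable g volume 0 L) :
    ∫ x in (0)..L, deriv φ x * ∫ t in (0)..x, g t = -∫ x in (0)..L, φ x * g x := by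
  have hac : AbsolutelyContinuousOnInterval φ 0 L :=
    (hφ.contDiff.of_le (by simp)).contDiffOn.absolutelyContinuousOnInterval
  have h := hac.integral_mul_deriv_eq_deriv_mul
    (hg.absolutelyContinuousOnInterval_intervalIntegral (c := 0) left_mem_uIcc)
  have h0 : φ 0 = 0 := image_eq_zero_of_notMem_tsupport fun h => (hφ.tsupport_subset h).1.false
  have h1 : φ L = 0 := image_eq_zero_of_notMem_tsupport fun h => (hφ.tsupport_subset h).2.false
  rw [h0, h1] at h
  have e : ∫ x in (0)..L, φ x * deriv (fun x => ∫ t in (0)..x, g t) x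
      = ∫ x in (0)..L, φ x * g x := by
    apply intervalIntegral.integral_congr_ae
    filter_upwards [hg.ae_hasDerivAt_integral] with x hx hx'
    rw [(hx (uIoc_subset_uIcc hx') 0 left_mem_uIcc).deriv]
  rw [e] at h
  linarith

theorem isWeakDeriv_primitive {L : ℝ} (hL : 0 < L) {g : ℝ → ℂ}
    (hg : IntervalIntegrable g volume 0 L) :
    IsWeakDeriv L (fun x => ∫ t in (0)..x, g t) g := by
  intro φ hφ
  have hgx : ∀ x ∈ Icc 0 L, IntervalIntegrable g volume 0 x := fun x hx =>
    hg.mono_set (by rw [uIcc_of_le hx.1, uIcc_of_le hL.le]; exact Icc_subset_Icc_right hx.2)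
  have hG : ContinuousOn (fun x => ∫ t in (0)..x, g t) (Icc 0 L) := by
    have := intervalIntegral.continuousOn_primitive_interval' hg (left_mem_uIcc)
    rwa [uIcc_of_le hL.le] at this
  have i₁ : IntegrableOn (fun x => deriv φ x • ∫ t in (0)..x, g t) (Ioo 0 L) :=
    integrable_smul_testFunction hφ.deriv
      ((hG.integrableOn_compact isCompact_Icc).mono_set Ioo_subset_Icc_self)
  have i₂ : IntegrableOn (fun x => φ x • g x) (Ioo 0 L) :=
    integrable_smul_testFunction hφ
      (((intervalIntegrable_iff_integrableOn_Ioo_of_le hL.le).mp hg))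
  have hre : IntervalIntegrable (fun t => (g t).re) volume 0 L :=
    ⟨hg.1.re, hg.2.re⟩
  have him : IntervalIntegrable (fun t => (g t).im) volume 0 L :=
    ⟨hg.1.im, hg.2.im⟩
  have r := integral_deriv_mul_primitive hφ hre
  have s := integral_deriv_mul_primitive hφ him
  simp only [intervalIntegral.integral_of_le hL.le, integral_Ioc_eq_integral_Ioo] at r s
  have ere : ∀ x ∈ Ioo 0 L, (∫ t in (0)..x, g t).re = ∫ t in (0)..x, (g t).re := fun x hx => by
    have := (Complex.reCLM.intervalIntegral_comp_comm (hgx x (Ioo_subset_Icc_self hx)))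
    simpa using this.symm
  have eim : ∀ x ∈ Ioo 0 L, (∫ t in (0)..x, g t).im = ∫ t in (0)..x, (g t).im := fun x hx => by
    have := (Complex.imCLM.intervalIntegral_comp_comm (hgx x (Ioo_subset_Icc_self hx)))
    simpa using this.symm
  apply Complex.ext
  · have a := Complex.reCLM.integral_comp_comm i₁
    have b := Complex.reCLM.integral_comp_comm i₂
    simp only [Complex.reCLM_apply, Complex.smul_re, smul_eq_mul] at a b
    rw [Complex.neg_re, ← a, ← b, ← r]
    exact setIntegral_congr_fun measurableSet_Ioo fun x hx => by simp only [ere x hx]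
  · have a := Complex.imCLM.integral_comp_comm i₁
    have b := Complex.imCLM.integral_comp_comm i₂
    simp only [Complex.imCLM_apply, Complex.smul_im, smul_eq_mul] at a b
    rw [Complex.neg_im, ← a, ← b, ← s]
    exact setIntegral_congr_fun measurableSet_Ioo fun x hx => by simp only [eim x hx]

theorem ae_eq_const_of_isWeakDeriv_zero {L : ℝ} (hL : 0 < L) {h : ℝ → ℂ}
    (hi : IntegrableOn h (Ioo 0 L)) (h0 : IsWeakDeriv L h 0) :
    ∃ c : ℂ, h =ᵐ[volume.restrict (Ioo 0 L)] fun _ => c := by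
  let B : ContDiffBump (L / 2) := ⟨L / 8, L / 4, by linarith, by linarith⟩
  have hρ : IsTestFunction L (B.normed volume) := by
    refine ⟨B.contDiff_normed, B.hasCompactSupport_normed, ?_⟩
    rw [B.tsupport_normed_eq, Real.closedBall_eq_Icc]
    exact fun x hx => ⟨by have := hx.1; simp only [B] at this; linarith,
      by have := hx.2; simp only [B] at this; linarith⟩
  have hρ1 : ∫ x in (0)..L, B.normed volume x = 1 := by
    rw [intervalIntegral.integral_of_le hL.le, integral_Ioc_eq_integral_Ioo,
      setIntegral_eq_integral_of_forall_compl_eq_zero, B.integral_normed]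
    exact fun x hx => image_eq_zero_of_notMem_tsupport fun h => hx (hρ.tsupport_subset h)
  set ρ := B.normed volume with hρdef
  set c : ℂ := ∫ x in Ioo 0 L, ρ x • h x with hc
  have hconst : IntegrableOn (fun _ : ℝ => c) (Ioo 0 L) := by simp
  refine ⟨c, ?_⟩
  have key := isOpen_Ioo.ae_eq_zero_of_integral_contDiff_smul_eq_zero (μ := volume)
    (U := Ioo (0 : ℝ) L) (f := fun x => h x - c) (hi.sub hconst).locallyIntegrableOn (by
      intro ψ h₁ h₂ h₃
      have hψ : IsTestFunction L ψ := ⟨h₁, h₂, h₃⟩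
      set m : ℝ := ∫ x in (0)..L, ψ x with hm
      have hχ : IsTestFunction L (fun x => ψ x - m * ρ x) := by
        refine ⟨h₁.sub (contDiff_const.mul hρ.contDiff),
          h₂.sub (hρ.hasCompactSupport.mul_left (f := fun _ => m)), ?_⟩
        refine (tsupport_sub _ _).trans (union_subset h₃ ?_)
        exact (tsupport_mul_subset_right (f := fun _ => m)).trans hρ.tsupport_subset
      obtain ⟨Φ, hΦ, hd⟩ := exists_primitive hL hχ (by
        have hi₂ : IntervalIntegrable (fun x => m * ρ x) volume 0 L :=
          (continuous_const.mul hρ.contDiff.continuous).intervalIntegrable _ _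
        rw [intervalIntegral.integral_sub (h₁.continuous.intervalIntegrable _ _) hi₂,
          intervalIntegral.integral_const_mul, hρ1]
        simp [hm])
      have e := h0 Φ hΦ
      rw [hd] at e
      simp only [sub_smul, mul_smul, Pi.zero_apply, smul_zero, integral_zero, neg_zero] at e
      have hi₂ : IntegrableOn (fun x => m • ρ x • h x) (Ioo 0 L) :=
        (integrable_smul_testFunction hρ hi).smul m
      rw [integral_sub (integrable_smul_testFunction hψ hi) hi₂, integral_smul, ← hc] at e
      rw [← setIntegral_eq_integral_of_forall_compl_eq_zero (s := Ioo 0 L)]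
      · simp only [smul_sub]
        rw [integral_sub (integrable_smul_testFunction hψ hi)
          (integrable_smul_testFunction hψ hconst), integral_smul_const]
        rw [← integral_Ioc_eq_integral_Ioo (f := ψ), ← intervalIntegral.integral_of_le hL.le]
        exact e
      · intro x hx
        rw [image_eq_zero_of_notMem_tsupport (fun h => hx (h₃ h)), zero_smul])
  rw [Filter.EventuallyEq, ae_restrict_iff' measurableSet_Ioo]
  filter_upwards [key] with x hx hxL using sub_eq_zero.mp (hx hxL)

/-- A function in `H¹(0, L)` has a continuous representative. -/
theorem IsWeakDeriv.hasContRep {L : ℝ} (hL : 0 < L) {f g : L2 L} (h : IsWeakDeriv L f g) :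
    HasContRep f := by
  have hg : IntervalIntegrable g volume 0 L :=
    (intervalIntegrable_iff_integrableOn_Ioo_of_le hL.le).mpr (L2.integrableOn g)
  have hG : ContinuousOn (fun x => ∫ t in (0)..x, g t) (Icc 0 L) := by
    have := intervalIntegral.continuousOn_primitive_interval' hg (left_mem_uIcc)
    rwa [uIcc_of_le hL.le] at this
  have hGi : IntegrableOn (fun x => ∫ t in (0)..x, g t) (Ioo 0 L) :=
    (hG.integrableOn_compact isCompact_Icc).mono_set Ioo_subset_Icc_self
  have hw := h.add ((isWeakDeriv_primitive hL hg).smul (-1)) (L2.integrableOn f)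
    (hGi.smul (-1 : ℂ)) (L2.integrableOn g) ((L2.integrableOn g).smul (-1 : ℂ))
  obtain ⟨c, hc⟩ := ae_eq_const_of_isWeakDeriv_zero hL
    ((L2.integrableOn f).add (hGi.smul (-1 : ℂ)))
    (hw.congr (ae_eq_refl _) (ae_of_all _ fun x => by simp))
  refine ⟨fun x => c + ∫ t in (0)..x, g t, continuousOn_const.add hG, ?_⟩
  filter_upwards [hc] with x hx
  rw [← hx]
  simp

theorem hasContRep_D {n : ℕ} {L : ℝ} (hL : 0 < L) (u : Sobolev n L) (k : Fin n) :
    HasContRep (D k.castSucc u) := (isWeakDeriv_D u k).hasContRep hL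

theorem D_zero_injective {n : ℕ} {L : ℝ} : Function.Injective (D (n := n) (L := L) 0) := by
  intro u v h
  have : ∀ k : Fin (n + 1), D k u = D k v := by
    intro k
    induction k using Fin.induction with
    | zero => exact h
    | succ i ih =>
      have hu := isWeakDeriv_D u i
      rw [ih] at hu
      exact hu.unique (isWeakDeriv_D v i)
  exact Subtype.ext (PiLp.ext this)

/-! ### The state space -/

/-- `H²(0, L) × H¹(0, L) × ℂ × ℂ` with the Hilbert space structure of the product. -/
def Ambient (L : ℝ) : Type :=
  WithLp 2 (Sobolev 2 L × WithLp 2 (Sobolev 1 L × WithLp 2 (ℂ × ℂ)))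

noncomputable instance (L : ℝ) : NormedAddCommGroup (Ambient L) :=
  inferInstanceAs
    (NormedAddCommGroup (WithLp 2 (Sobolev 2 L × WithLp 2 (Sobolev 1 L × WithLp 2 (ℂ × ℂ)))))

noncomputable instance (L : ℝ) : InnerProductSpace ℂ (Ambient L) :=
  inferInstanceAs
    (InnerProductSpace ℂ (WithLp 2 (Sobolev 2 L × WithLp 2 (Sobolev 1 L × WithLp 2 (ℂ × ℂ)))))

/-- The element `(w, v, ξ, ψ)`. -/
def mk {L : ℝ} (w : Sobolev 2 L) (v : Sobolev 1 L) (ξ ψ : ℂ) : Ambient L :=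
  WithLp.toLp 2 (w, WithLp.toLp 2 (v, WithLp.toLp 2 (ξ, ψ)))

theorem mk_add {L : ℝ} (w w' : Sobolev 2 L) (v v' : Sobolev 1 L) (ξ ξ' ψ ψ' : ℂ) :
    mk (w + w') (v + v') (ξ + ξ') (ψ + ψ') = mk w v ξ ψ + mk w' v' ξ' ψ' := rfl

theorem mk_smul {L : ℝ} (c : ℂ) (w : Sobolev 2 L) (v : Sobolev 1 L) (ξ ψ : ℂ) :
    mk (c • w) (c • v) (c * ξ) (c * ψ) = c • mk w v ξ ψ := rfl

namespace Ambient

variable {L : ℝ}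

/-- The component `w` of `(w, v, ξ, ψ)`. -/
def w (z : Ambient L) : Sobolev 2 L := WithLp.fst z

/-- The component `v` of `(w, v, ξ, ψ)`. -/
def v (z : Ambient L) : Sobolev 1 L := (WithLp.snd z).fst

/-- The component `ξ` of `(w, v, ξ, ψ)`. -/
def ξ (z : Ambient L) : ℂ := (WithLp.snd z).snd.fst

/-- The component `ψ` of `(w, v, ξ, ψ)`. -/
def ψ (z : Ambient L) : ℂ := (WithLp.snd z).snd.snd

end Ambient

theorem zero_mem_Icc {L : ℝ} (hL : 0 < L) : (0 : ℝ) ∈ Icc 0 L := left_mem_Icc.mpr hL.le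

theorem self_mem_Icc {L : ℝ} (hL : 0 < L) : L ∈ Icc 0 L := right_mem_Icc.mpr hL.le

/-- The subspace `{(w, v, ξ, ψ) : w ∈ H²(0, L), v ∈ H¹(0, L), ξ = v(L), ψ = v(0)}`. -/
def stateSubmodule (L : ℝ) [hL : Fact (0 < L)] : Submodule ℂ (Ambient L) where
  carrier := {z | z.ξ = pt (D 0 z.v) L ∧ z.ψ = pt (D 0 z.v) 0}
  zero_mem' := by
    have h : D 0 (0 : Ambient L).v = 0 := map_zero _
    refine ⟨?_, ?_⟩
    · rw [h, pt_zero hL.out (self_mem_Icc hL.out)]; rfl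
    · rw [h, pt_zero hL.out (zero_mem_Icc hL.out)]; rfl
  add_mem' := fun {y z} hy hz => by
    have h : D 0 (y + z).v = D 0 y.v + D 0 z.v := map_add _ _ _
    have cy : HasContRep (D 0 y.v) := hasContRep_D hL.out y.v 0
    have cz : HasContRep (D 0 z.v) := hasContRep_D hL.out z.v 0
    refine ⟨?_, ?_⟩
    · rw [h, pt_add hL.out cy cz (self_mem_Icc hL.out), ← hy.1, ← hz.1]; rfl
    · rw [h, pt_add hL.out cy cz (zero_mem_Icc hL.out), ← hy.2, ← hz.2]; rfl
  smul_mem' := fun c z hz => by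
    have h : D 0 (c • z).v = c • D 0 z.v := map_smul _ _ _
    have cz : HasContRep (D 0 z.v) := hasContRep_D hL.out z.v 0
    refine ⟨?_, ?_⟩
    · rw [h, pt_smul hL.out cz c (self_mem_Icc hL.out), ← hz.1]; rfl
    · rw [h, pt_smul hL.out cz c (zero_mem_Icc hL.out), ← hz.2]; rfl

/-- The state space `{(w, v, ξ, ψ) : w ∈ H²(0, L), v ∈ H¹(0, L), ξ = v(L), ψ = v(0)}` with the
inner product inherited from `H² × H¹ × ℂ × ℂ`. -/
def StateSpace (L : ℝ) [Fact (0 < L)] : Type := stateSubmodule L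

noncomputable instance (L : ℝ) [Fact (0 < L)] : NormedAddCommGroup (StateSpace L) :=
  inferInstanceAs (NormedAddCommGroup (stateSubmodule L))

noncomputable instance (L : ℝ) [Fact (0 < L)] : InnerProductSpace ℂ (StateSpace L) :=
  inferInstanceAs (InnerProductSpace ℂ (stateSubmodule L))

/-- The tuple `(w, v, ξ, ψ)` of a state. -/
noncomputable def toTuple {L : ℝ} [Fact (0 < L)] : StateSpace L →ₗ[ℂ] Ambient L :=
  (stateSubmodule L).subtype

theorem toTuple_injective {L : ℝ} [Fact (0 < L)] :
    Function.Injective (toTuple : StateSpace L →ₗ[ℂ] Ambient L) := Subtype.val_injective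

/-! ### The closed-loop operator -/

/-- The feedback `F[w, v] = θ₁ v(0) + θ₂ v'(0) + θ₃ w(0) + θ₄ w'(0)`, with `θ i` standing for
`θ_{i+1}`. -/
noncomputable def feedback {L : ℝ} (θ : Fin 4 → ℝ) (w v : Sobolev 2 L) : ℂ :=
  θ 0 * pt (D 0 v) 0 + θ 1 * pt (D 1 v) 0 + θ 2 * pt (D 0 w) 0 + θ 3 * pt (D 1 w) 0

theorem feedback_add {L : ℝ} (hL : 0 < L) (θ : Fin 4 → ℝ) (w v w' v' : Sobolev 2 L) :
    feedback θ (w + w') (v + v') = feedback θ w v + feedback θ w' v' := by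
  have c0 : ∀ u : Sobolev 2 L, HasContRep (D 0 u) := fun u => hasContRep_D hL u 0
  have c1 : ∀ u : Sobolev 2 L, HasContRep (D 1 u) := fun u => hasContRep_D hL u 1
  have h0 := zero_mem_Icc hL
  simp only [feedback, map_add, pt_add hL (c0 _) (c0 _) h0, pt_add hL (c1 _) (c1 _) h0]
  ring

theorem feedback_smul {L : ℝ} (hL : 0 < L) (θ : Fin 4 → ℝ) (c : ℂ) (w v : Sobolev 2 L) :
    feedback θ (c • w) (c • v) = c * feedback θ w v := by
  have c0 : ∀ u : Sobolev 2 L, HasContRep (D 0 u) := fun u => hasContRep_D hL u 0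
  have c1 : ∀ u : Sobolev 2 L, HasContRep (D 1 u) := fun u => hasContRep_D hL u 1
  have h0 := zero_mem_Icc hL
  simp only [feedback, map_smul, pt_smul hL (c0 _) _ h0, pt_smul hL (c1 _) _ h0]
  ring

theorem slope_add {L : ℝ} (hL : 0 < L) (w w' : Sobolev 2 L) :
    pt (D 1 (w + w')) L = pt (D 1 w) L + pt (D 1 w') L := by
  have c1 : ∀ u : Sobolev 2 L, HasContRep (D 1 u) := fun u => hasContRep_D hL u 1
  rw [map_add, pt_add hL (c1 _) (c1 _) (self_mem_Icc hL)]

theorem slope_smul {L : ℝ} (hL : 0 < L) (c : ℂ) (w : Sobolev 2 L) :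
    pt (D 1 (c • w)) L = c * pt (D 1 w) L := by
  have c1 : ∀ u : Sobolev 2 L, HasContRep (D 1 u) := fun u => hasContRep_D hL u 1
  rw [map_smul, pt_smul hL (c1 _) c (self_mem_Icc hL)]

/-- `q` is the weak derivative `(P w')'`. -/
def IsFluxDeriv {L : ℝ} (P : ℝ → ℝ) (w : Sobolev 2 L) (q : L2 L) : Prop :=
  IsWeakDeriv L (fun x => (P x : ℂ) * D 1 w x) q

theorem integrableOn_flux {L : ℝ} {P : ℝ → ℝ} (hP : ContinuousOn P (Icc 0 L)) (f : L2 L) :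
    IntegrableOn (fun x => (P x : ℂ) * f x) (Ioo 0 L) := by
  obtain ⟨C, hC⟩ := isCompact_Icc.exists_bound_of_continuousOn hP
  have hPc : ContinuousOn (fun x => (P x : ℂ)) (Ioo 0 L) :=
    (Complex.continuous_ofReal.comp_continuousOn hP).mono Ioo_subset_Icc_self
  refine (L2.integrableOn f).bdd_mul (c := C) (hPc.aestronglyMeasurable measurableSet_Ioo) ?_
  rw [ae_restrict_iff' measurableSet_Ioo]
  exact ae_of_all _ fun x hx => by simpa using hC x (Ioo_subset_Icc_self hx)

theorem IsFluxDeriv.add {L : ℝ} {P : ℝ → ℝ} (hP : ContinuousOn P (Icc 0 L))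
    {w₁ w₂ : Sobolev 2 L} {q₁ q₂ : L2 L} (h₁ : IsFluxDeriv P w₁ q₁) (h₂ : IsFluxDeriv P w₂ q₂) :
    IsFluxDeriv P (w₁ + w₂) (q₁ + q₂) := by
  refine (IsWeakDeriv.add h₁ h₂ (integrableOn_flux hP _) (integrableOn_flux hP _)
    (L2.integrableOn _) (L2.integrableOn _)).congr ?_ (Lp.coeFn_add _ _).symm
  rw [map_add]
  filter_upwards [Lp.coeFn_add (D 1 w₁) (D 1 w₂)] with x hx
  rw [hx]
  simp [mul_add]

theorem IsFluxDeriv.smul {L : ℝ} {P : ℝ → ℝ} {w : Sobolev 2 L} {q : L2 L}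
    (h : IsFluxDeriv P w q) (c : ℂ) : IsFluxDeriv P (c • w) (c • q) := by
  refine (IsWeakDeriv.smul h c).congr ?_ (Lp.coeFn_smul _ _).symm
  rw [map_smul]
  filter_upwards [Lp.coeFn_smul c (D 1 w)] with x hx
  rw [hx]
  simp [mul_left_comm]

/-- The part of the domain conditions on `z = (w, v, ξ, ψ)` that concerns `v` and the boundary:
`v` lies in `H²(0, L)` (as `v₂`), `(P w')'` lies in `H¹(0, L)` (as `q`), and
`(P w')'(L) = -w'(L)`, `(P w')'(0) = F[w, v]`. -/
structure BoundaryConditions {L : ℝ} (P : ℝ → ℝ) (θ : Fin 4 → ℝ) (z : Ambient L)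
    (v₂ : Sobolev 2 L) (q : Sobolev 1 L) : Prop where
  v_eq : D 0 v₂ = D 0 z.v
  flux : IsFluxDeriv P z.w (D 0 q)
  right : pt (D 0 q) L = -pt (D 1 z.w) L
  left : pt (D 0 q) 0 = feedback θ z.w v₂

theorem BoundaryConditions.add {L : ℝ} (hL : 0 < L) {P : ℝ → ℝ} (hP : ContinuousOn P (Icc 0 L))
    {θ : Fin 4 → ℝ} {z z' : Ambient L} {v₂ v₂' : Sobolev 2 L} {q q' : Sobolev 1 L}
    (h : BoundaryConditions P θ z v₂ q) (h' : BoundaryConditions P θ z' v₂' q') :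
    BoundaryConditions P θ (z + z') (v₂ + v₂') (q + q') := by
  have ev : (z + z').v = z.v + z'.v := rfl
  have ew : (z + z').w = z.w + z'.w := rfl
  have cq : ∀ u : Sobolev 1 L, HasContRep (D 0 u) := fun u => hasContRep_D hL u 0
  have cw : ∀ u : Sobolev 2 L, HasContRep (D 1 u) := fun u => hasContRep_D hL u 1
  refine ⟨?_, ?_, ?_, ?_⟩
  · rw [ev, map_add, map_add, h.v_eq, h'.v_eq]
  · rw [ew, map_add]
    exact h.flux.add hP h'.flux
  · rw [ew, map_add, map_add, pt_add hL (cq _) (cq _) (self_mem_Icc hL),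
      pt_add hL (cw _) (cw _) (self_mem_Icc hL), h.right, h'.right]
    ring
  · rw [ew, map_add, pt_add hL (cq _) (cq _) (zero_mem_Icc hL), feedback_add hL, h.left, h'.left]

theorem BoundaryConditions.smul {L : ℝ} (hL : 0 < L) {P : ℝ → ℝ}
    {θ : Fin 4 → ℝ} {z : Ambient L} {v₂ : Sobolev 2 L} {q : Sobolev 1 L}
    (h : BoundaryConditions P θ z v₂ q) (c : ℂ) :
    BoundaryConditions P θ (c • z) (c • v₂) (c • q) := by
  have ev : (c • z).v = c • z.v := rfl
  have ew : (c • z).w = c • z.w := rfl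
  have cq : ∀ u : Sobolev 1 L, HasContRep (D 0 u) := fun u => hasContRep_D hL u 0
  have cw : ∀ u : Sobolev 2 L, HasContRep (D 1 u) := fun u => hasContRep_D hL u 1
  refine ⟨?_, ?_, ?_, ?_⟩
  · rw [ev, map_smul, map_smul, h.v_eq]
  · rw [ew, map_smul]
    exact h.flux.smul c
  · rw [ew, map_smul, map_smul, pt_smul hL (cq _) c (self_mem_Icc hL),
      pt_smul hL (cw _) c (self_mem_Icc hL), h.right]
    ring
  · rw [ew, map_smul, pt_smul hL (cq _) c (zero_mem_Icc hL), feedback_smul hL, h.left]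

theorem BoundaryConditions.unique {L : ℝ} {P : ℝ → ℝ} {θ : Fin 4 → ℝ} {z : Ambient L}
    {v₂ v₂' : Sobolev 2 L} {q q' : Sobolev 1 L} (h : BoundaryConditions P θ z v₂ q)
    (h' : BoundaryConditions P θ z v₂' q') : v₂ = v₂' ∧ q = q' :=
  ⟨D_zero_injective (h.v_eq.trans h'.v_eq.symm), D_zero_injective (h.flux.unique h'.flux)⟩

theorem BoundaryConditions.zero {L : ℝ} (hL : 0 < L) {P : ℝ → ℝ} {θ : Fin 4 → ℝ} :
    BoundaryConditions P θ (0 : Ambient L) 0 0 := by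
  have ew : (0 : Ambient L).w = 0 := rfl
  refine ⟨?_, ?_, ?_, ?_⟩
  · rw [map_zero]; exact (map_zero _).symm
  · have hz : IsWeakDeriv L (0 : ℝ → ℂ) 0 := fun φ _ => by simp
    rw [ew, map_zero]
    refine hz.congr ?_ (Lp.coeFn_zero _ _ _).symm
    rw [map_zero]
    filter_upwards [Lp.coeFn_zero ℂ 2 (volume.restrict (Ioo 0 L))] with x hx
    rw [hx]
    simp
  · rw [ew, map_zero, map_zero, pt_zero hL (self_mem_Icc hL), neg_zero]
  · rw [ew, map_zero, pt_zero hL (zero_mem_Icc hL)]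
    simp [feedback, pt_zero hL (zero_mem_Icc hL)]

/-- The domain `D(A)`: all `(w, v, ξ, ψ)` in the state space with `w ∈ H³(0, L)`, `v ∈ H²(0, L)`,
`(P w')'(L) = -w'(L)` and `(P w')'(0) = F[w, v]`. -/
def craneDomain (L : ℝ) [hL : Fact (0 < L)] (P : ℝ → ℝ) (hP : ContinuousOn P (Icc 0 L))
    (θ : Fin 4 → ℝ) : Submodule ℂ (StateSpace L) where
  carrier := {z | (∃ w₃ : Sobolev 3 L, D 0 w₃ = D 0 (toTuple z).w) ∧
    ∃ v₂ q, BoundaryConditions P θ (toTuple z) v₂ q}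
  zero_mem' := ⟨⟨0, by rw [map_zero]; exact (map_zero _).symm⟩, 0, 0, .zero hL.out⟩
  add_mem' := by
    rintro y z ⟨⟨w, hw⟩, v, q, h⟩ ⟨⟨w', hw'⟩, v', q', h'⟩
    exact ⟨⟨w + w', by rw [map_add, hw, hw']; exact (map_add _ _ _).symm⟩, _, _,
      h.add hL.out hP h'⟩
  smul_mem' := by
    rintro c z ⟨⟨w, hw⟩, v, q, h⟩
    exact ⟨⟨c • w, by rw [map_smul, hw]; exact (map_smul _ _ _).symm⟩, _, _, h.smul hL.out c⟩

/-- `v`, as an element of `H²(0, L)`, for `(w, v, ξ, ψ) ∈ D(A)`. -/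
noncomputable def velocity {L : ℝ} [Fact (0 < L)] {P : ℝ → ℝ} {hP : ContinuousOn P (Icc 0 L)}
    {θ : Fin 4 → ℝ} (z : craneDomain L P hP θ) : Sobolev 2 L := z.2.2.choose

/-- `(P w')'`, as an element of `H¹(0, L)`, for `(w, v, ξ, ψ) ∈ D(A)`. -/
noncomputable def fluxDeriv {L : ℝ} [Fact (0 < L)] {P : ℝ → ℝ} {hP : ContinuousOn P (Icc 0 L)}
    {θ : Fin 4 → ℝ} (z : craneDomain L P hP θ) : Sobolev 1 L := z.2.2.choose_spec.choose

theorem boundaryConditions {L : ℝ} [Fact (0 < L)] {P : ℝ → ℝ} {hP : ContinuousOn P (Icc 0 L)}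
    {θ : Fin 4 → ℝ} (z : craneDomain L P hP θ) :
    BoundaryConditions P θ (toTuple z.1) (velocity z) (fluxDeriv z) := z.2.2.choose_spec.choose_spec

/-- The value `(v, (P w')', -w'(L), θ₁ v(0) + θ₂ v'(0) + θ₃ w(0) + θ₄ w'(0))` of the closed-loop
operator at `(w, v, ξ, ψ) ∈ D(A)`. -/
noncomputable def craneValue {L : ℝ} [Fact (0 < L)] {P : ℝ → ℝ}
    {hP : ContinuousOn P (Icc 0 L)} {θ : Fin 4 → ℝ} (z : craneDomain L P hP θ) : StateSpace L :=
  ⟨mk (velocity z) (fluxDeriv z) (-pt (D 1 (toTuple z.1).w) L) (feedback θ (toTuple z.1).w (velocity z)),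
    (boundaryConditions z).right.symm, (boundaryConditions z).left.symm⟩

theorem toTuple_craneValue {L : ℝ} [Fact (0 < L)] {P : ℝ → ℝ}
    {hP : ContinuousOn P (Icc 0 L)} {θ : Fin 4 → ℝ} (z : craneDomain L P hP θ) :
    toTuple (craneValue z) = mk (velocity z) (fluxDeriv z) (-pt (D 1 (toTuple z.1).w) L)
      (feedback θ (toTuple z.1).w (velocity z)) := rfl

theorem craneValue_add {L : ℝ} [hL : Fact (0 < L)] {P : ℝ → ℝ}
    {hP : ContinuousOn P (Icc 0 L)} {θ : Fin 4 → ℝ} (y z : craneDomain L P hP θ) :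
    craneValue (y + z) = craneValue y + craneValue z := by
  obtain ⟨hv, hq⟩ := (boundaryConditions (y + z)).unique
    ((boundaryConditions y).add hL.out hP (boundaryConditions z))
  have ew : (toTuple (y + z).1).w = (toTuple y.1).w + (toTuple z.1).w := rfl
  have h₃ : -pt (D 1 (toTuple (y + z).1).w) L = -pt (D 1 (toTuple y.1).w) L + -pt (D 1 (toTuple z.1).w) L := by
    rw [← neg_add, ← slope_add hL.out, ew]
  have h₄ : feedback θ (toTuple (y + z).1).w (velocity (y + z)) =
      feedback θ (toTuple y.1).w (velocity y) + feedback θ (toTuple z.1).w (velocity z) := by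
    rw [hv, ← feedback_add hL.out, ew]
  apply toTuple_injective
  rw [map_add, toTuple_craneValue, toTuple_craneValue, toTuple_craneValue, h₄, h₃, hv, hq, mk_add]

theorem craneValue_smul {L : ℝ} [hL : Fact (0 < L)] {P : ℝ → ℝ}
    {hP : ContinuousOn P (Icc 0 L)} {θ : Fin 4 → ℝ} (c : ℂ) (z : craneDomain L P hP θ) :
    craneValue (c • z) = c • craneValue z := by
  obtain ⟨hv, hq⟩ := (boundaryConditions (c • z)).unique ((boundaryConditions z).smul hL.out c)
  have ew : (toTuple (c • z).1).w = c • (toTuple z.1).w := rfl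
  have h₃ : -pt (D 1 (toTuple (c • z).1).w) L = c * -pt (D 1 (toTuple z.1).w) L := by
    rw [mul_neg, ← slope_smul hL.out, ew]
  have h₄ : feedback θ (toTuple (c • z).1).w (velocity (c • z)) =
      c * feedback θ (toTuple z.1).w (velocity z) := by
    rw [hv, ← feedback_smul hL.out, ew]
  apply toTuple_injective
  rw [map_smul, toTuple_craneValue, toTuple_craneValue, h₄, h₃, hv, hq, mk_smul]

/-- The closed-loop operator `A` with domain `D(A) = craneDomain L P hP θ`, as an unbounded
operator in the state space. -/
noncomputable def craneOperator (L : ℝ) [Fact (0 < L)] (P : ℝ → ℝ)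
    (hP : ContinuousOn P (Icc 0 L)) (θ : Fin 4 → ℝ) : StateSpace L →ₗ.[ℂ] StateSpace L where
  domain := craneDomain L P hP θ
  toFun :=
    { toFun := craneValue
      map_add' := craneValue_add
      map_smul' := craneValue_smul }

/-! ### The modified inner product -/

open Classical in
/-- The weak derivative `(P w')'` in `L²(0, L)` (zero if there is none, which does not happen for
`P`, `w` in `H²(0, L)`). -/
noncomputable def flux' {L : ℝ} (P : ℝ → ℝ) (w : Sobolev 2 L) : L2 L :=
  if h : ∃ q : L2 L, IsFluxDeriv P w q then h.choose else 0

/-- The functional `ψ - 2 α₁ P(0) w'(0) + 2 α₂ w(0)`. -/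
noncomputable def cartTerm {L : ℝ} (P : ℝ → ℝ) (α₁ α₂ : ℝ) (z : Ambient L) : ℂ :=
  z.ψ - 2 * α₁ * P 0 * pt (D 1 z.w) 0 + 2 * α₂ * pt (D 0 z.w) 0

open scoped ComplexConjugate in
/-- The sesquilinear form, linear in the first argument,
`α₁ ∫ (γ (P w₁')' conj (P w₂')' + P w₁' conj w₂') + α₁ γ P(L) w₁'(L) conj w₂'(L)`
`+ α₂ w₁(0) conj w₂(0) + α₁ ∫ (γ P v₁' conj v₂' + v₁ conj v₂) + α₁ P(L) ξ₁ conj ξ₂`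
`+ α₂ γ ψ₁ conj ψ₂`
`+ 1/2 (ψ₁ - 2 α₁ P(0) w₁'(0) + 2 α₂ w₁(0)) conj (ψ₂ - 2 α₁ P(0) w₂'(0) + 2 α₂ w₂(0))`. -/
noncomputable def energyForm {L : ℝ} (P : ℝ → ℝ) (α₁ α₂ γ : ℝ) (z₁ z₂ : Ambient L) : ℂ :=
  α₁ * (∫ x in Ioo 0 L, (γ * (flux' P z₁.w x * conj (flux' P z₂.w x))
      + P x * (D 1 z₁.w x * conj (D 1 z₂.w x))))
    + α₁ * γ * P L * (pt (D 1 z₁.w) L * conj (pt (D 1 z₂.w) L))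
    + α₂ * (pt (D 0 z₁.w) 0 * conj (pt (D 0 z₂.w) 0))
    + α₁ * (∫ x in Ioo 0 L, (γ * P x * (D 1 z₁.v x * conj (D 1 z₂.v x))
      + D 0 z₁.v x * conj (D 0 z₂.v x)))
    + α₁ * P L * (z₁.ξ * conj z₂.ξ)
    + α₂ * γ * (z₁.ψ * conj z₂.ψ)
    + 1 / 2 * (cartTerm P α₁ α₂ z₁ * conj (cartTerm P α₁ α₂ z₂))

/-- `B` (linear in the first argument) is an inner product on `X` whose norm is equivalent to the
given norm. -/
def IsEquivalentInnerProduct {X : Type*} [NormedAddCommGroup X] [NormedSpace ℂ X]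
    (B : X → X → ℂ) : Prop :=
  (∃ c : InnerProductSpace.Core ℂ X, ∀ x y, c.inner x y = B y x) ∧
    ∃ c₁ c₂ : ℝ, 0 < c₁ ∧ 0 < c₂ ∧ ∀ x, c₁ * ‖x‖ ≤ √(B x x).re ∧ √(B x x).re ≤ c₂ * ‖x‖

/-! ### Semigroups of operators -/

/-- A `C₀`-semigroup of bounded operators `T(t)`, `t ≥ 0`, on `X`. -/
structure C0Semigroup (X : Type*) [NormedAddCommGroup X] [NormedSpace ℂ X] where
  T : ℝ≥0 → X →L[ℂ] X
  map_zero : T 0 = ContinuousLinearMap.id ℂ X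
  map_add : ∀ s t, T (s + t) = (T s).comp (T t)
  tendsto_zero : ∀ x, Tendsto (fun t => T t x) (𝓝[>] 0) (𝓝 x)

/-- `A` is the infinitesimal generator of `S`: `D(A)` consists of all `x` for which
`lim_{t ↓ 0} (T(t) x - x) / t` exists, and `A x` is this limit. -/
def IsGenerator {X : Type*} [NormedAddCommGroup X] [NormedSpace ℂ X] (A : X →ₗ.[ℂ] X)
    (S : C0Semigroup X) : Prop :=
  ∀ x y, (x, y) ∈ A.graph ↔
    Tendsto (fun t : ℝ≥0 => ((t : ℝ) : ℂ)⁻¹ • (S.T t x - x)) (𝓝[>] 0) (𝓝 y)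

end Crane

/-! The closed-loop operator `A` is inverted rather than its resolvent. The equation `A z = y` is a
two-point problem for `w`, solved by two integrations: `(P w')' = v_y` together with the condition
at `L` determines `P w'`, and the feedback condition at `0` determines `w(0)` because `θ₃ ≠ 0`. This
gives a bounded `K` whose graph, with the two coordinates exchanged, is the graph of `A`
(`exists_inverse`, `graph_injective`). So "`A` is dissipative" becomes a statement about the bounded
operator `K`: `Re ⟨y, K y⟩ ≤ 0`.

The modified inner product is written as the pullback of a Hilbert inner product along a bounded map
`e` into a product of copies of `L²` and `ℂ`. The equivalence of norms says exactly that `e` is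
bounded below (`exists_energyL`). Working with `e` allows several inner products on the same space
without changing its instance.

Dissipativity (`re_energyForm_nonpos`) is integration by parts. The integrals cancel and so do the
boundary terms at `L`. At `0` the choice of the gains enters: if `x` is the cart functional of `z`
and `p = v(0)`, then the cart functional of `A z` is `(b - a) p - b x`. With `k = b - a`, half of
the quadratic form `-p² + (k + 1) p x - b x²` remains, plus a perturbation of size `γ`. The form is
negative definite iff `(k + 1)² < 4 b`, which is `(a + b - 1)² < 4 a b` rearranged, and so it
absorbs the perturbation for small `γ`.

Generation (`exists_C0Semigroup`) is the Hille–Yosida argument in terms of `K`. The operators `(K -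
ε)⁻¹` are bounded, commuting and dissipative; their exponentials are contractions and converge on
the dense range of `K²`, hence everywhere. The limit does not involve `e`, so a single semigroup is
contractive for all admissible `γ` at once. -/

namespace Crane

/-! ### Dissipative operators with bounded inverse generate semigroups -/

section Semigroup

variable {X H : Type*} [NormedAddCommGroup X] [NormedSpace ℂ X]
  [NormedAddCommGroup H] [InnerProductSpace ℂ H]

/-- `K` is dissipative for the semi-inner product pulled back along `e`. -/
def IsDissipativeFor (e : X →L[ℂ] H) (K : X →L[ℂ] X) : Prop :=
  ∀ x, (inner ℂ (e (K x)) (e x)).re ≤ 0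

/-- `e` maps the closed subspace onto a complete subspace of `H`, so orthogonal projection onto the
image exists although neither `X` nor `H` is assumed to be a Hilbert space. -/
theorem exists_orthogonal [CompleteSpace X] {e : X →L[ℂ] H} {c : ℝ≥0} (hc : AntilipschitzWith c e)
    {M : Submodule ℂ X} (hM : IsClosed (M : Set X)) (hne : M ≠ ⊤) :
    ∃ z ≠ 0, ∀ m ∈ M, inner ℂ (e m) (e z) = 0 := by
  obtain ⟨x, hx⟩ : ∃ x, x ∉ M := by
    by_contra! h
    exact hne (Submodule.eq_top_iff'.mpr h)
  have hcomp : IsComplete ((M.map (e : X →ₗ[ℂ] H) : Submodule ℂ H) : Set H) := by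
    have := (hc.isUniformInducing e.uniformContinuous).isComplete_iff.mpr hM.isComplete
    simpa using this
  have : CompleteSpace (M.map (e : X →ₗ[ℂ] H)) := hcomp.completeSpace_coe
  obtain ⟨n, hn, ho⟩ :=
    Submodule.HasOrthogonalProjection.exists_orthogonal (K := M.map (e : X →ₗ[ℂ] H)) (e x)
  obtain ⟨m, hm, rfl⟩ := hn
  refine ⟨x - m, fun h => hx (by rwa [sub_eq_zero.mp h]), fun y hy => ?_⟩
  have := (Submodule.mem_orthogonal _ _).mp ho (e y) ⟨y, hy, rfl⟩
  rw [map_sub]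
  exact this

/-- Cauchy–Schwarz applied to `Re ⟨(K - ε) x, x⟩ ≤ -ε ‖x‖²`. -/
theorem IsDissipativeFor.le_norm {e : X →L[ℂ] H} {K : X →L[ℂ] X} (h : IsDissipativeFor e K)
    {ε : ℝ} (x : X) : ε * ‖e x‖ ≤ ‖e ((K - (ε : ℂ) • (1 : X →L[ℂ] X)) x)‖ := by
  have h1 : (inner ℂ (e ((K - (ε : ℂ) • (1 : X →L[ℂ] X)) x)) (e x)).re ≤ -(ε * ‖e x‖ ^ 2) := by
    have h2 := h x
    have : e ((K - (ε : ℂ) • (1 : X →L[ℂ] X)) x) = e (K x) - (ε : ℂ) • e x := by simp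
    rw [this, inner_sub_left, inner_smul_left, inner_self_eq_norm_sq_to_K, Complex.sub_re]
    have : ((starRingEnd ℂ) (ε : ℂ) * ((‖e x‖ : ℂ)) ^ 2).re = ε * ‖e x‖ ^ 2 := by
      rw [Complex.conj_ofReal]; norm_cast
    simp only [Complex.coe_algebraMap] at *
    rw [this]; linarith
  have h3 := norm_inner_le_norm (𝕜 := ℂ) (e ((K - (ε : ℂ) • (1 : X →L[ℂ] X)) x)) (e x)
  have h4 := (abs_le.mp ((Complex.abs_re_le_norm _).trans h3)).1
  rcases (norm_nonneg (e x)).eq_or_lt with h0 | h0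
  · rw [← h0, mul_zero]; positivity
  · nlinarith

theorem eq_zero_of_antilipschitz {e : X →L[ℂ] H} {c : ℝ≥0} (hc : AntilipschitzWith c e) {x : X}
    (h : e x = 0) : x = 0 := hc.injective (h.trans (map_zero e).symm)

/-- `K - ε` is bounded below, hence injective with closed range. A vector `z ≠ 0` orthogonal to the
range would give `Re ⟨K z, z⟩ = ε ‖z‖² > 0`. -/
theorem IsDissipativeFor.isUnit [CompleteSpace X] {e : X →L[ℂ] H} {c : ℝ≥0}
    (hc : AntilipschitzWith c e) {K : X →L[ℂ] X} (h : IsDissipativeFor e K) {ε : ℝ} (hε : 0 < ε) :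
    IsUnit (K - (ε : ℂ) • (1 : X →L[ℂ] X)) := by
  have hlow := fun x => h.le_norm (ε := ε) x
  set R := K - (ε : ℂ) • (1 : X →L[ℂ] X) with hR
  have hanti : AntilipschitzWith (c * (ε.toNNReal⁻¹ * ‖e‖₊)) R := by
    refine R.antilipschitz_of_bound fun x => ?_
    have h1 := hlow x
    have h2 := e.le_opNorm (R x)
    have h3 : ‖x‖ ≤ c * ‖e x‖ := hc.le_mul_norm (map_zero e) x
    calc ‖x‖ ≤ c * ‖e x‖ := h3
      _ ≤ c * (ε⁻¹ * (‖e‖ * ‖R x‖)) := by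
        gcongr
        rw [inv_mul_eq_div, le_div_iff₀ hε]
        linarith
      _ = _ := by push_cast; rw [Real.coe_toNNReal _ hε.le]; ring
  have hcl : IsClosed ((R : X →ₗ[ℂ] X).range : Set X) := by
    rw [LinearMap.coe_range]
    exact hanti.isClosed_range R.uniformContinuous
  have htop : (R : X →ₗ[ℂ] X).range = ⊤ := by
    by_contra hne
    obtain ⟨z, hz, hz'⟩ := exists_orthogonal hc hcl hne
    have h1 := hz' (R z) ⟨z, rfl⟩
    have h2 : e (R z) = e (K z) - (ε : ℂ) • e z := by simp [hR]
    rw [h2, inner_sub_left, inner_smul_left, inner_self_eq_norm_sq_to_K, Complex.conj_ofReal] at h1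
    have h3 : (inner ℂ (e (K z)) (e z)).re = ε * ‖e z‖ ^ 2 := by
      rw [sub_eq_zero.mp h1]
      simp only [Complex.coe_algebraMap]
      norm_cast
    have h4 : 0 < ‖e z‖ := norm_pos_iff.mpr fun h0 => hz (eq_zero_of_antilipschitz hc h0)
    have h5 := h z
    have : 0 < ε * ‖e z‖ ^ 2 := by positivity
    linarith
  exact ContinuousLinearMap.isUnit_iff_bijective.mpr
    ⟨hanti.injective, LinearMap.range_eq_top.mp htop⟩

/-- If `z` is orthogonal to the range, then dissipativity at `z + t u` reads `t Re ⟨K z, u⟩ + t² Re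
⟨K u, u⟩ ≤ 0`. For small `t > 0` this forces `Re ⟨K z, u⟩ ≤ 0` for every `u`, and `u = K z` gives `K
z = 0`. In terms of `A = K⁻¹` this is density of the domain. -/
theorem IsDissipativeFor.denseRange [CompleteSpace X] {e : X →L[ℂ] H} {c : ℝ≥0}
    (hc : AntilipschitzWith c e) {K : X →L[ℂ] X} (h : IsDissipativeFor e K)
    (hK : Function.Injective K) : DenseRange K := by
  by_contra hne
  have : (K : X →ₗ[ℂ] X).range.topologicalClosure ≠ ⊤ := fun h0 =>
    hne (by
      have := Submodule.dense_iff_topologicalClosure_eq_top.mpr h0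
      rwa [LinearMap.coe_range] at this)
  obtain ⟨z, hz, hz'⟩ := exists_orthogonal hc (Submodule.isClosed_topologicalClosure _) this
  have ho : ∀ u, inner ℂ (e (K u)) (e z) = 0 := fun u =>
    hz' _ (Submodule.le_topologicalClosure _ ⟨u, rfl⟩)
  have key : ∀ u, (inner ℂ (e (K z)) (e u)).re ≤ 0 := by
    intro u
    by_contra! hpos
    set p := (inner ℂ (e (K z)) (e u)).re
    set q := (inner ℂ (e (K u)) (e u)).re with hq
    have hexp : ∀ t : ℝ, t * p + t ^ 2 * q ≤ 0 := by
      intro t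
      have h1 := h (z + (t : ℂ) • u)
      have h2 : inner ℂ (e (K (z + (t : ℂ) • u))) (e (z + (t : ℂ) • u)) =
          (t : ℂ) * inner ℂ (e (K z)) (e u) + ((t ^ 2 : ℝ) : ℂ) * inner ℂ (e (K u)) (e u) := by
        simp only [map_add, map_smul, inner_add_left, inner_add_right, inner_smul_left,
          inner_smul_right, ho, Complex.conj_ofReal]
        push_cast
        ring
      rw [h2, Complex.add_re, Complex.re_ofReal_mul, Complex.re_ofReal_mul] at h1
      exact h1
    have hq0 : q ≤ 0 := h u
    -- The linear term must beat the quadratic one; `1 - q` instead of `-q` keeps the denominator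
    -- positive when `q = 0`.
    have h3 := hexp (p / (1 - q) / 2)
    have h4 : 0 < 1 - q := by linarith
    set s := p / (1 - q) with hs
    have hs' : p = s * (1 - q) := by rw [hs]; field_simp
    have hs0 : 0 < s := by positivity
    have h5 : 0 < s / 2 * (p + s / 2 * q) := by
      apply mul_pos (by positivity)
      rw [hs']
      nlinarith
    nlinarith
  have h0 := key (K z)
  rw [inner_self_eq_norm_sq_to_K] at h0
  have h1 : ‖e (K z)‖ ^ 2 ≤ 0 := by
    simp only [Complex.coe_algebraMap] at h0
    exact_mod_cast h0
  have h2 : e (K z) = 0 := by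
    rw [← norm_eq_zero]; exact pow_eq_zero_iff two_ne_zero |>.mp (le_antisymm h1 (sq_nonneg _))
  exact hz (hK ((eq_zero_of_antilipschitz hc h2).trans (map_zero K).symm))

open NormedSpace in
theorem hasDerivAt_exp_apply [CompleteSpace X] (A : X →L[ℂ] X) (x : X) (t : ℝ) :
    HasDerivAt (fun t : ℝ => exp (t • A) x) (A (exp (t • A) x)) t := by
  have h := hasDerivAt_exp_smul_const' (𝕂 := ℝ) A t
  exact ((ContinuousLinearMap.apply ℂ X x).restrictScalars ℝ).hasFDerivAt.comp_hasDerivAt t h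

open NormedSpace in
theorem commute_exp_apply [CompleteSpace X] {A B : X →L[ℂ] X} (h : Commute A B) (t : ℝ) (x : X) :
    exp (t • A) (B x) = B (exp (t • A) x) :=
  congrArg (fun T : X →L[ℂ] X => T x) ((h.smul_left t).exp_left).eq

open NormedSpace in
-- The derivative of `‖e (exp (s A) x)‖²` is twice the dissipation form, hence nonpositive.
theorem IsDissipativeFor.norm_exp_le [CompleteSpace X] {e : X →L[ℂ] H} {A : X →L[ℂ] X}
    (h : IsDissipativeFor e A) {t : ℝ} (ht : 0 ≤ t) (x : X) : ‖e (exp (t • A) x)‖ ≤ ‖e x‖ := by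
  have hd : ∀ s : ℝ, HasDerivAt (fun s : ℝ => (inner ℂ (e (exp (s • A) x)) (e (exp (s • A) x))).re)
      (2 * (inner ℂ (e (A (exp (s • A) x))) (e (exp (s • A) x))).re) s := by
    intro s
    have h1 := (e.restrictScalars ℝ).hasFDerivAt.comp_hasDerivAt s (hasDerivAt_exp_apply A x s)
    have h2 := Complex.reCLM.hasFDerivAt.comp_hasDerivAt s (HasDerivAt.inner ℂ h1 h1)
    refine h2.congr_deriv ?_
    simp only [ContinuousLinearMap.coe_restrictScalars', Complex.reCLM_apply, Complex.add_re,
      Function.comp_apply]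
    rw [← inner_conj_symm (e (exp (s • A) x)) (e (A (exp (s • A) x))), Complex.conj_re]
    ring
  have ha := antitone_of_deriv_nonpos (fun s => (hd s).differentiableAt) fun s => by
    rw [(hd s).deriv]
    have := h (exp (s • A) x)
    linarith
  have h1 := ha ht
  simp only [inner_self_eq_norm_sq_to_K, zero_smul, exp_zero, Complex.coe_algebraMap] at h1
  norm_cast at h1
  exact le_of_sq_le_sq h1 (norm_nonneg _)

open NormedSpace in
-- Interpolate by `exp (s A) exp ((t - s) B) x`. Since `A` and `B` commute, its derivative in `s` is
-- the same product of contractions applied to `(A - B) x`.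
theorem IsDissipativeFor.norm_exp_sub_le [CompleteSpace X] {e : X →L[ℂ] H} {A B : X →L[ℂ] X}
    (hA : IsDissipativeFor e A) (hB : IsDissipativeFor e B) (hAB : Commute A B) {t : ℝ}
    (ht : 0 ≤ t) (x : X) :
    ‖e (exp (t • A) x - exp (t • B) x)‖ ≤ t * ‖e ((A - B) x)‖ := by
  have hd : ∀ s : ℝ, HasDerivAt (fun s : ℝ => e (exp (s • A) (exp ((t - s) • B) x)))
      (e (exp (s • A) (exp ((t - s) • B) ((A - B) x)))) s := by
    intro s
    have h1 := hasDerivAt_exp_smul_const (𝕂 := ℝ) A s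
    have h2 := (hasDerivAt_exp_apply B x (t - s)).scomp s ((hasDerivAt_id s).const_sub t)
    have h3 : HasDerivAt (fun s : ℝ => exp (s • A) (exp ((t - s) • B) x))
        ((exp (s • A) * A) (exp ((t - s) • B) x)
          + exp (s • A) (-(1 : ℝ) • B (exp ((t - s) • B) x))) s :=
      (((ContinuousLinearMap.restrictScalarsL ℂ X X ℝ ℝ).hasFDerivAt.comp_hasDerivAt s h1)
        ).clm_apply h2
    refine ((e.restrictScalars ℝ).hasFDerivAt.comp_hasDerivAt s h3).congr_deriv ?_
    simp only [ContinuousLinearMap.coe_restrictScalars', mul_apply_eq_comp]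
    rw [← map_add, commute_exp_apply (hAB.symm.sub_right (Commute.refl B))]
    simp [sub_eq_add_neg]
  have hb := norm_image_sub_le_of_norm_deriv_le_segment' (a := 0) (b := t)
    (C := ‖e ((A - B) x)‖) (fun s _ => (hd s).hasDerivWithinAt) (fun s hs =>
      (hA.norm_exp_le hs.1 _).trans (hB.norm_exp_le (by linarith [hs.2]) _)) t ⟨ht, le_rfl⟩
  simp only [sub_self, zero_smul, sub_zero, exp_zero] at hb
  rw [map_sub, mul_comm]
  exact hb

theorem isDissipativeFor_zero (e : X →L[ℂ] H) : IsDissipativeFor e 0 := fun x => by simp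

open NormedSpace in
theorem IsDissipativeFor.norm_exp_sub_self_le [CompleteSpace X] {e : X →L[ℂ] H} {A : X →L[ℂ] X}
    (hA : IsDissipativeFor e A) {t : ℝ} (ht : 0 ≤ t) (x : X) :
    ‖e (exp (t • A) x - x)‖ ≤ t * ‖e (A x)‖ := by
  simpa using hA.norm_exp_sub_le (isDissipativeFor_zero e) (Commute.zero_right A) ht x

open NormedSpace in
-- Second-order Taylor estimate. The constant is not sharp: on `[0, t]` the derivative is simply
-- bounded by `t ‖e (A (A x))‖`.
theorem IsDissipativeFor.norm_exp_sub_sub_le [CompleteSpace X] {e : X →L[ℂ] H} {A : X →L[ℂ] X}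
    (hA : IsDissipativeFor e A) {t : ℝ} (ht : 0 ≤ t) (x : X) :
    ‖e (exp (t • A) x - x - t • A x)‖ ≤ t ^ 2 * ‖e (A (A x))‖ := by
  have hd : ∀ s : ℝ, HasDerivAt (fun s : ℝ => e (exp (s • A) x - x - s • A x))
      (e (exp (s • A) (A x) - A x)) s := by
    intro s
    have h1 := ((hasDerivAt_exp_apply A x s).sub_const x).sub
      ((hasDerivAt_id s).smul_const (A x))
    refine ((e.restrictScalars ℝ).hasFDerivAt.comp_hasDerivAt s h1).congr_deriv ?_
    rw [commute_exp_apply (Commute.refl A)]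
    simp
  have hb := norm_image_sub_le_of_norm_deriv_le_segment' (a := 0) (b := t)
    (C := t * ‖e (A (A x))‖) (fun s _ => (hd s).hasDerivWithinAt) (fun s hs =>
      (hA.norm_exp_sub_self_le hs.1 _).trans (by gcongr; exact hs.2.le)) t ⟨ht, le_rfl⟩
  simp only [zero_smul, sub_zero, exp_zero] at hb
  calc _ ≤ _ := by simpa using hb
    _ = _ := by ring

end Semigroup

/-! ### Yosida approximations and the limit semigroup. -/

section Yosida

variable {X H : Type*} [NormedAddCommGroup X] [NormedSpace ℂ X]
  [NormedAddCommGroup H] [InnerProductSpace ℂ H]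

/-- The Yosida approximation `(K - ε)⁻¹` of `K⁻¹`. -/
noncomputable def yosida (K : X →L[ℂ] X) (ε : ℝ) : X →L[ℂ] X :=
  Ring.inverse (K - (ε : ℂ) • (1 : X →L[ℂ] X))

theorem yosida_commute (K : X →L[ℂ] X) (ε δ : ℝ) : Commute (yosida K ε) (yosida K δ) := by
  apply Commute.ringInverse_ringInverse
  have h : ∀ c : ℂ, Commute K (c • (1 : X →L[ℂ] X)) := fun c => (Commute.one_right K).smul_right c
  have h' : ∀ c d : ℂ, Commute (c • (1 : X →L[ℂ] X)) (d • (1 : X →L[ℂ] X)) := fun c d =>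
    ((Commute.one_right _).smul_right d)
  exact ((Commute.refl K).sub_right (h _)).sub_left ((h _).symm.sub_right (h' _ _))

/-- Every `K - ε`, `ε > 0`, is invertible. -/
def HasYosida (K : X →L[ℂ] X) : Prop := ∀ ε : ℝ, 0 < ε → IsUnit (K - (ε : ℂ) • (1 : X →L[ℂ] X))

theorem HasYosida.right {K : X →L[ℂ] X} (hK : HasYosida K) {ε : ℝ} (hε : 0 < ε) (x : X) :
    (K - (ε : ℂ) • (1 : X →L[ℂ] X)) (yosida K ε x) = x :=
  congrArg (fun T : X →L[ℂ] X => T x) (Ring.mul_inverse_cancel _ (hK ε hε))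

theorem HasYosida.left {K : X →L[ℂ] X} (hK : HasYosida K) {ε : ℝ} (hε : 0 < ε) (x : X) :
    yosida K ε ((K - (ε : ℂ) • (1 : X →L[ℂ] X)) x) = x :=
  congrArg (fun T : X →L[ℂ] X => T x) (Ring.inverse_mul_cancel _ (hK ε hε))

/-- With `A = K⁻¹`, `yosida K ε` is `A (1 - ε A)⁻¹`, and its product with `K` is `(1 - ε A)⁻¹`. The
identities here and below replace the usual resolvent calculus. -/
theorem HasYosida.yosida_apply {K : X →L[ℂ] X} (hK : HasYosida K) {ε : ℝ} (hε : 0 < ε) (x : X) :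
    yosida K ε (K x) = x + (ε : ℂ) • yosida K ε x := by
  have h := hK.left hε x
  rw [sub_apply, map_sub, smul_apply, map_smul,
    one_apply_eq_self] at h
  nth_rw 2 [← h]
  simp

theorem HasYosida.apply_yosida {K : X →L[ℂ] X} (hK : HasYosida K) {ε : ℝ} (hε : 0 < ε) (x : X) :
    K (yosida K ε x) = x + (ε : ℂ) • yosida K ε x := by
  have h := hK.right hε x
  rw [sub_apply, smul_apply, one_apply_eq_self] at h
  nth_rw 2 [← h]
  simp

theorem HasYosida.commute {K : X →L[ℂ] X} (hK : HasYosida K) {ε : ℝ} (hε : 0 < ε) :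
    Commute (yosida K ε) K := by
  ext x
  exact (hK.yosida_apply hε x).trans (hK.apply_yosida hε x).symm

/-- For `u = yosida K ε x` one has `K u = x + ε u`, so `Re ⟨x, u⟩ = Re ⟨K u, u⟩ - ε ‖u‖²`. -/
theorem IsDissipativeFor.yosida {e : X →L[ℂ] H} {K : X →L[ℂ] X} (h : IsDissipativeFor e K)
    (hK : HasYosida K) {ε : ℝ} (hε : 0 < ε) : IsDissipativeFor e (yosida K ε) := by
  intro x
  have h1 := h (Crane.yosida K ε x)
  rw [hK.apply_yosida hε, map_add, map_smul, inner_add_left, inner_smul_left,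
    inner_self_eq_norm_sq_to_K, Complex.conj_ofReal, Complex.add_re] at h1
  have h2 : ((ε : ℂ) * ((‖e (Crane.yosida K ε x)‖ : ℂ)) ^ 2).re = ε * ‖e (Crane.yosida K ε x)‖ ^ 2 := by
    norm_cast
  simp only [Complex.coe_algebraMap] at h1
  rw [h2] at h1
  rw [← inner_conj_symm, Complex.conj_re]
  have : 0 ≤ ε * ‖e (Crane.yosida K ε x)‖ ^ 2 := by positivity
  linarith

theorem IsDissipativeFor.norm_yosida_le {e : X →L[ℂ] H} {K : X →L[ℂ] X} (h : IsDissipativeFor e K)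
    (hK : HasYosida K) {ε : ℝ} (hε : 0 < ε) (x : X) : ε * ‖e (Crane.yosida K ε x)‖ ≤ ‖e x‖ := by
  have := h.le_norm (ε := ε) (Crane.yosida K ε x)
  rwa [hK.right hε] at this

theorem norm_ofReal_smul {E : Type*} [NormedAddCommGroup E] [NormedSpace ℂ E] {ε : ℝ} (hε : 0 ≤ ε)
    (x : E) : ‖(ε : ℂ) • x‖ = ε * ‖x‖ := by
  rw [norm_smul, Complex.norm_real, Real.norm_of_nonneg hε]

theorem IsDissipativeFor.norm_yosida_apply_le {e : X →L[ℂ] H} {K : X →L[ℂ] X}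
    (h : IsDissipativeFor e K) (hK : HasYosida K) {ε : ℝ} (hε : 0 < ε) (x : X) :
    ‖e (Crane.yosida K ε (K x))‖ ≤ 2 * ‖e x‖ := by
  rw [hK.yosida_apply hε, map_add, map_smul]
  refine (norm_add_le _ _).trans ?_
  rw [norm_ofReal_smul hε.le]
  linarith [h.norm_yosida_le hK hε x]

/-- Rate of convergence of the Yosida approximations to `K⁻¹` on the range of `K²`, that is, on the
domain of the square of the generator. -/
theorem IsDissipativeFor.norm_yosida_apply_apply_le {e : X →L[ℂ] H} {K : X →L[ℂ] X}
    (h : IsDissipativeFor e K) (hK : HasYosida K) {ε : ℝ} (hε : 0 < ε) (x : X) :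
    ‖e (Crane.yosida K ε (K (K x)) - K x)‖ ≤ 2 * ε * ‖e x‖ := by
  rw [hK.yosida_apply hε, add_sub_cancel_left, map_smul, norm_ofReal_smul hε.le]
  linarith [mul_le_mul_of_nonneg_left (h.norm_yosida_apply_le hK hε x) hε.le]

theorem IsDissipativeFor.norm_yosida_sq_le {e : X →L[ℂ] H} {K : X →L[ℂ] X}
    (h : IsDissipativeFor e K) (hK : HasYosida K) {ε : ℝ} (hε : 0 < ε) (x : X) :
    ‖e (Crane.yosida K ε (Crane.yosida K ε (K (K x))))‖ ≤ 4 * ‖e x‖ := by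
  have hc : Crane.yosida K ε (K (K x)) = K (Crane.yosida K ε (K x)) :=
    congrArg (fun T : X →L[ℂ] X => T (K x)) (hK.commute hε).eq
  rw [hc]
  have h1 := h.norm_yosida_apply_le hK hε (Crane.yosida K ε (K x))
  have h2 := h.norm_yosida_apply_le hK hε x
  linarith

theorem IsDissipativeFor.hasYosida [CompleteSpace X] {e : X →L[ℂ] H} {c : ℝ≥0}
    (hc : AntilipschitzWith c e) {K : X →L[ℂ] X} (h : IsDissipativeFor e K) : HasYosida K :=
  fun _ hε => h.isUnit hc hε

theorem tendsto_of_dense {ι : Type*} {l : Filter ι} {F : ι → X →L[ℂ] X} {G : X →L[ℂ] X} {M : ℝ}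
    (hF : ∀ᶠ i in l, ∀ x, ‖F i x‖ ≤ M * ‖x‖) {s : Set X} (hs : Dense s)
    (h : ∀ x ∈ s, Tendsto (fun i => F i x) l (𝓝 (G x))) (x : X) :
    Tendsto (fun i => F i x) l (𝓝 (G x)) := by
  rw [Metric.tendsto_nhds]
  intro r hr
  set B : ℝ := |M| + ‖G‖ + 1 with hB
  have hB0 : 0 < B := by positivity
  obtain ⟨y, hy, hxy⟩ := Metric.dense_iff.mp hs x (r / 2 / B) (by positivity)
  have hd : dist x y < r / 2 / B := by rw [dist_comm]; exact hy
  rw [dist_eq_norm] at hd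
  filter_upwards [hF, Metric.tendsto_nhds.mp (h y hxy) (r / 2) (by positivity)] with i hi hiy
  rw [dist_eq_norm] at hiy ⊢
  have e1 : F i x - G x = F i (x - y) + (F i y - G y) - G (x - y) := by simp only [map_sub]; abel
  have h1 := hi (x - y)
  have h2 := G.le_opNorm (x - y)
  have h3 : B * ‖x - y‖ < r / 2 := by rw [mul_comm]; exact (lt_div_iff₀ hB0).mp hd
  have h4 : M * ‖x - y‖ ≤ |M| * ‖x - y‖ := by gcongr; exact le_abs_self M
  have h5 : B * ‖x - y‖ = |M| * ‖x - y‖ + ‖G‖ * ‖x - y‖ + ‖x - y‖ := by rw [hB]; ring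
  rw [e1]
  have h6 := norm_sub_le (F i (x - y) + (F i y - G y)) (G (x - y))
  have h7 := norm_add_le (F i (x - y)) (F i y - G y)
  linarith [norm_nonneg (x - y)]

theorem cauchySeq_of_dense {F : ℕ → X →L[ℂ] X} {M : ℝ}
    (hF : ∀ n x, ‖F n x‖ ≤ M * ‖x‖) {s : Set X} (hs : Dense s)
    (h : ∀ x ∈ s, CauchySeq fun n => F n x) (x : X) : CauchySeq fun n => F n x := by
  rw [Metric.cauchySeq_iff]
  intro r hr
  set B : ℝ := |M| + 1 with hB
  have hB0 : 0 < B := by positivity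
  obtain ⟨y, hy, hxy⟩ := Metric.dense_iff.mp hs x (r / 4 / B) (by positivity)
  have hd : dist x y < r / 4 / B := by rw [dist_comm]; exact hy
  rw [dist_eq_norm] at hd
  obtain ⟨N, hN⟩ := Metric.cauchySeq_iff.mp (h y hxy) (r / 2) (by positivity)
  refine ⟨N, fun m hm n hn => ?_⟩
  have hmn := hN m hm n hn
  rw [dist_eq_norm] at hmn ⊢
  have e1 : F m x - F n x = F m (x - y) + (F m y - F n y) - F n (x - y) := by
    simp only [map_sub]; abel
  have h1 := hF m (x - y)
  have h2 := hF n (x - y)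
  have h3 : B * ‖x - y‖ < r / 4 := by rw [mul_comm]; exact (lt_div_iff₀ hB0).mp hd
  have h4 : M * ‖x - y‖ ≤ |M| * ‖x - y‖ := by gcongr; exact le_abs_self M
  have h5 : B * ‖x - y‖ = |M| * ‖x - y‖ + ‖x - y‖ := by rw [hB]; ring
  rw [e1]
  have h6 := norm_sub_le (F m (x - y) + (F m y - F n y)) (F n (x - y))
  have h7 := norm_add_le (F m (x - y)) (F m y - F n y)
  linarith [norm_nonneg (x - y)]

/-- The semigroups of the Yosida approximations with `ε = 1 / (n + 1)`. -/
noncomputable def approx (K : X →L[ℂ] X) (n : ℕ) (t : ℝ) : X →L[ℂ] X :=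
  NormedSpace.exp (t • yosida K (1 / (n + 1 : ℝ)))

theorem IsDissipativeFor.norm_approx_le [CompleteSpace X] {e : X →L[ℂ] H} {K : X →L[ℂ] X}
    (h : IsDissipativeFor e K) (hK : HasYosida K) (n : ℕ) {t : ℝ} (ht : 0 ≤ t) (x : X) :
    ‖e (approx K n t x)‖ ≤ ‖e x‖ :=
  (h.yosida hK Nat.one_div_pos_of_nat).norm_exp_le ht x

theorem norm_le_of_norm_apply_le {e : X →L[ℂ] H} {c : ℝ≥0} (hc : AntilipschitzWith c e) {x : X}
    {r : ℝ} (h : ‖e x‖ ≤ r) : ‖x‖ ≤ c * r :=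
  (hc.le_mul_norm (map_zero e) x).trans (by gcongr)

theorem norm_approx_le [CompleteSpace X] {e : X →L[ℂ] H} {c : ℝ≥0} (hc : AntilipschitzWith c e)
    {K : X →L[ℂ] X} (h : IsDissipativeFor e K) (n : ℕ) {t : ℝ} (ht : 0 ≤ t) (x : X) :
    ‖approx K n t x‖ ≤ c * ‖e‖ * ‖x‖ := by
  rw [mul_assoc]
  exact norm_le_of_norm_apply_le hc
    ((h.norm_approx_le (h.hasYosida hc) n ht x).trans (e.le_opNorm x))

theorem denseRange_sq {K : X →L[ℂ] X} (h : DenseRange K) : DenseRange fun x => K (K x) :=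
  h.comp h K.continuous

/-- On the range of `K²` two approximate generators differ by `O(1 / N)`, so their contraction
semigroups differ by `O(t / N)`. The uniform bound extends this from the dense range to `X`. -/
theorem cauchySeq_approx [CompleteSpace X] {e : X →L[ℂ] H} {c : ℝ≥0} (hc : AntilipschitzWith c e)
    {K : X →L[ℂ] X} (h : IsDissipativeFor e K) (hinj : Function.Injective K) {t : ℝ} (ht : 0 ≤ t)
    (x : X) : CauchySeq fun n => approx K n t x := by
  have hK := h.hasYosida hc
  refine cauchySeq_of_dense (fun n x => norm_approx_le hc h n ht x)
    (denseRange_sq (h.denseRange hc hinj)) ?_ x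
  rintro _ ⟨u, rfl⟩
  refine cauchySeq_of_le_tendsto_0 (fun N : ℕ => c * (t * (4 * (1 / (N + 1 : ℝ)) * ‖e u‖)))
    (fun n m N hn hm => ?_) ?_
  · rw [dist_eq_norm]
    refine norm_le_of_norm_apply_le hc (((h.yosida hK Nat.one_div_pos_of_nat).norm_exp_sub_le
      (h.yosida hK Nat.one_div_pos_of_nat) (yosida_commute K _ _) ht _).trans ?_)
    gcongr
    have e1 : (yosida K (1 / (n + 1 : ℝ)) - yosida K (1 / (m + 1 : ℝ))) (K (K u)) =
        (yosida K (1 / (n + 1 : ℝ)) (K (K u)) - K u) -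
          (yosida K (1 / (m + 1 : ℝ)) (K (K u)) - K u) := by
      rw [sub_apply]; abel
    rw [e1, map_sub]
    refine (norm_sub_le _ _).trans ?_
    have h1 := h.norm_yosida_apply_apply_le hK (Nat.one_div_pos_of_nat (n := n) (α := ℝ)) u
    have h2 := h.norm_yosida_apply_apply_le hK (Nat.one_div_pos_of_nat (n := m) (α := ℝ)) u
    have h3 : 1 / (n + 1 : ℝ) ≤ 1 / (N + 1 : ℝ) := Nat.one_div_le_one_div hn
    have h4 : 1 / (m + 1 : ℝ) ≤ 1 / (N + 1 : ℝ) := Nat.one_div_le_one_div hm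
    nlinarith [norm_nonneg (e u)]
  · have := tendsto_one_div_add_atTop_nhds_zero_nat (𝕜 := ℝ)
    simpa using (((this.const_mul 4).mul_const ‖e u‖).const_mul t).const_mul (c : ℝ)

theorem exists_limit [CompleteSpace X] {e : X →L[ℂ] H} {c : ℝ≥0} (hc : AntilipschitzWith c e)
    {K : X →L[ℂ] X} (h : IsDissipativeFor e K) (hinj : Function.Injective K) :
    ∃ T : ℝ≥0 → X →L[ℂ] X, ∀ (t : ℝ≥0) (x : X), Tendsto (fun n => approx K n (t : ℝ) x) atTop (𝓝 (T t x)) := by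
  choose f hf using fun (t : ℝ≥0) x =>
    cauchySeq_tendsto_of_complete (cauchySeq_approx hc h hinj t.2 x)
  exact ⟨fun t => continuousLinearMapOfTendsto (fun n => approx K n (t : ℝ)) (f := f t)
    (tendsto_pi_nhds.mpr (hf t)), hf⟩

/-- If `K` is injective and dissipative for an equivalent inner product, then `K⁻¹` generates a
bounded `C₀`-semigroup, which is contractive for every semi-inner product for which `K` is
dissipative. -/
theorem exists_C0Semigroup [CompleteSpace X] {e : X →L[ℂ] H} {c : ℝ≥0}
    (hc : AntilipschitzWith c e) {K : X →L[ℂ] X} (h : IsDissipativeFor e K)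
    (hinj : Function.Injective K) :
    ∃ S : C0Semigroup X,
      (∀ x y, x = K y ↔
        Tendsto (fun t : ℝ≥0 => ((t : ℝ) : ℂ)⁻¹ • (S.T t x - x)) (𝓝[>] 0) (𝓝 y)) ∧
      (∃ M : ℝ, ∀ t, ‖S.T t‖ ≤ M) ∧
      ∀ e' : X →L[ℂ] H, IsDissipativeFor e' K → ∀ t x, ‖e' (S.T t x)‖ ≤ ‖e' x‖ := by
  have hK := h.hasYosida hc
  obtain ⟨T, hT⟩ := exists_limit hc h hinj
  have hcontr : ∀ e' : X →L[ℂ] H, IsDissipativeFor e' K → ∀ t x, ‖e' (T t x)‖ ≤ ‖e' x‖ :=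
    fun e' he' t x => le_of_tendsto ((e'.continuous.tendsto _).comp (hT t x)).norm
      (Eventually.of_forall fun n => he'.norm_approx_le hK n t.2 x)
  have hbound : ∀ t x, ‖T t x‖ ≤ c * ‖e‖ * ‖x‖ := fun t x =>
    le_of_tendsto (hT t x).norm (Eventually.of_forall fun n => norm_approx_le hc h n t.2 x)
  have hzero : T 0 = ContinuousLinearMap.id ℂ X := by
    ext x
    refine tendsto_nhds_unique (hT 0 x) ?_
    simp [approx]
  have hadd : ∀ s t, T (s + t) = (T s).comp (T t) := by
    intro s t
    ext x
    refine tendsto_nhds_unique (hT (s + t) x) ?_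
    have h1 : ∀ n, approx K n ((s + t : ℝ≥0) : ℝ) x = approx K n s (approx K n t x) := by
      intro n
      let _ : NormedAlgebra ℚ (X →L[ℂ] X) := NormedAlgebra.restrictScalars ℚ ℝ _
      rw [approx, NNReal.coe_add, add_smul, NormedSpace.exp_add_of_commute]
      · rfl
      · exact ((Commute.refl _).smul_left _).smul_right _
    simp only [h1]
    -- Operator and argument both vary with `n`; the uniform bound on `approx` handles the change of
    -- argument.
    have h2 : Tendsto (fun n => approx K n s (approx K n t x - T t x)) atTop (𝓝 0) := by
      refine squeeze_zero_norm (fun n => norm_approx_le hc h n s.2 _) ?_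
      have := ((hT t x).sub_const (T t x)).norm.const_mul (c * ‖e‖)
      simpa using this
    simpa using h2.add (hT s (T t x))
  have hcomm : ∀ t x, T t (K x) = K (T t x) := by
    intro t x
    refine tendsto_nhds_unique (hT t (K x)) ?_
    refine ((K.continuous.tendsto _).comp (hT t x)).congr fun n => ?_
    exact (commute_exp_apply (hK.commute Nat.one_div_pos_of_nat) t x).symm
  have hlip : ∀ t y, ‖T t (K y) - K y‖ ≤ t * (c * (2 * ‖e‖)) * ‖y‖ := by
    intro t y
    have h1 : ‖e (T t (K y) - K y)‖ ≤ t * (2 * ‖e y‖) := by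
      refine le_of_tendsto ((e.continuous.tendsto _).comp ((hT t (K y)).sub_const (K y))).norm
        (Eventually.of_forall fun n => ?_)
      refine ((h.yosida hK Nat.one_div_pos_of_nat).norm_exp_sub_self_le t.2 _).trans ?_
      exact mul_le_mul_of_nonneg_left (h.norm_yosida_apply_le hK Nat.one_div_pos_of_nat y) t.2
    refine (norm_le_of_norm_apply_le hc h1).trans ?_
    have h2 := e.le_opNorm y
    calc (c : ℝ) * (t * (2 * ‖e y‖)) ≤ c * (t * (2 * (‖e‖ * ‖y‖))) := by gcongr
      _ = _ := by ring
  have hpos : ∀ᶠ t : ℝ≥0 in 𝓝[>] 0, 0 < t := self_mem_nhdsWithin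
  have hcoe : Tendsto (fun t : ℝ≥0 => (t : ℝ)) (𝓝[>] 0) (𝓝 0) :=
    (NNReal.continuous_coe.tendsto 0).mono_left nhdsWithin_le_nhds
  have hstrong : ∀ x, Tendsto (fun t => T t x) (𝓝[>] 0) (𝓝 x) := by
    refine tendsto_of_dense (G := ContinuousLinearMap.id ℂ X)
      (Eventually.of_forall fun t x => hbound t x) (h.denseRange hc hinj) ?_
    rintro _ ⟨y, rfl⟩
    rw [ContinuousLinearMap.id_apply, tendsto_iff_norm_sub_tendsto_zero]
    refine squeeze_zero (fun _ => norm_nonneg _) (fun t => hlip t y) ?_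
    simpa using (hcoe.mul_const (c * (2 * ‖e‖))).mul_const ‖y‖
  -- Differentiability on the range of `K` without integrating orbits: the difference quotients
  -- composed with `K` are uniformly bounded by `hlip`. So it suffices to take `y = K u`, where the
  -- Taylor estimate for the approximations passes to the limit.
  have hgen : ∀ y : X, Tendsto (fun t : ℝ≥0 => ((t : ℝ) : ℂ)⁻¹ • (T t (K y) - K y)) (𝓝[>] 0) (𝓝 y) := by
    refine tendsto_of_dense (G := ContinuousLinearMap.id ℂ X) (M := c * (2 * ‖e‖))
      (F := fun t : ℝ≥0 => ((t : ℝ) : ℂ)⁻¹ • ((T t).comp K - K)) ?_ (h.denseRange hc hinj) ?_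
    · filter_upwards [hpos] with t ht x
      have ht' : (0 : ℝ) < t := ht
      have h1 := hlip t x
      simp only [smul_apply, sub_apply,
        ContinuousLinearMap.comp_apply]
      rw [norm_smul, norm_inv, Complex.norm_real, Real.norm_of_nonneg ht'.le, inv_mul_le_iff₀ ht',
        ← mul_assoc]
      exact h1
    · rintro _ ⟨u, rfl⟩
      have h1 : ∀ t : ℝ≥0, ‖T t (K (K u)) - K (K u) - (t : ℝ) • K u‖ ≤ c * ((t : ℝ) ^ 2 * (4 * ‖e u‖)) := by
        intro t
        refine norm_le_of_norm_apply_le hc ?_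
        have h2 : Tendsto (fun n : ℕ => approx K n t (K (K u)) - K (K u)
            - (t : ℝ) • yosida K (1 / (n + 1 : ℝ)) (K (K u))) atTop
            (𝓝 (T t (K (K u)) - K (K u) - (t : ℝ) • K u)) := by
          refine ((hT t _).sub_const _).sub (Tendsto.const_smul ?_ _)
          rw [tendsto_iff_norm_sub_tendsto_zero]
          refine squeeze_zero (fun _ => norm_nonneg _) (fun n => norm_le_of_norm_apply_le hc
            (h.norm_yosida_apply_apply_le hK Nat.one_div_pos_of_nat u)) ?_
          have := tendsto_one_div_add_atTop_nhds_zero_nat (𝕜 := ℝ)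
          simpa using ((this.const_mul 2).mul_const ‖e u‖).const_mul (c : ℝ)
        refine le_of_tendsto ((e.continuous.tendsto _).comp h2).norm
          (Eventually.of_forall fun n => ?_)
        refine ((h.yosida hK Nat.one_div_pos_of_nat).norm_exp_sub_sub_le t.2 _).trans ?_
        exact mul_le_mul_of_nonneg_left (h.norm_yosida_sq_le hK Nat.one_div_pos_of_nat u)
          (sq_nonneg _)
      rw [ContinuousLinearMap.id_apply, tendsto_iff_norm_sub_tendsto_zero]
      refine squeeze_zero' (Eventually.of_forall fun _ => norm_nonneg _)
        (g := fun t : ℝ≥0 => (t : ℝ) * (c * (4 * ‖e u‖))) ?_ ?_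
      · filter_upwards [hpos] with t ht
        have ht' : (0 : ℝ) < t := ht
        have h2 : (((t : ℝ) : ℂ)⁻¹ • ((T t).comp K - K)) (K u) - K u =
            ((t : ℝ) : ℂ)⁻¹ • (T t (K (K u)) - K (K u) - (t : ℝ) • K u) := by
          rw [smul_sub _ _ ((t : ℝ) • K u), ← Complex.coe_smul (t : ℝ) (K u), inv_smul_smul₀]
          · rfl
          · exact_mod_cast ht'.ne'
        rw [h2, norm_smul, norm_inv, Complex.norm_real, Real.norm_of_nonneg ht'.le,
          inv_mul_le_iff₀ ht']
        refine (h1 t).trans_eq ?_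
        ring
      · simpa using hcoe.mul_const (c * (4 * ‖e u‖))
  refine ⟨⟨T, hzero, hadd, hstrong⟩, fun x y => ⟨?_, fun hxy => ?_⟩,
    ⟨c * ‖e‖, fun t => ContinuousLinearMap.opNorm_le_bound _ (by positivity) (hbound t)⟩, hcontr⟩
  · rintro rfl
    exact hgen y
  -- `K` commutes with the semigroup, so `K` applied to the quotients of `x` gives the quotients of
  -- `K x`. The former tend to `K y`, the latter to `x`.
  · refine tendsto_nhds_unique (hgen x) (((K.continuous.tendsto _).comp hxy).congr fun t => ?_)
    simp [hcomm]

end Yosida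

/-! ### Absolutely continuous functions with square integrable derivative -/

/-- Lebesgue measure on `(0, L)`. -/
noncomputable abbrev vol (L : ℝ) : Measure ℝ := volume.restrict (Ioo 0 L)

/-- `f` is a primitive on `[0, L]` of the square integrable function `f'`. -/
structure IsPrimitive (L : ℝ) (f f' : ℝ → ℂ) : Prop where
  memLp : MemLp f' 2 (vol L)
  eq : ∀ x ∈ Icc 0 L, f x = f 0 + ∫ t in (0)..x, f' t

theorem memLp_of_continuousOn {L : ℝ} {f : ℝ → ℂ} (hf : ContinuousOn f (Icc 0 L)) :
    MemLp f 2 (vol L) := by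
  obtain ⟨C, hC⟩ := isCompact_Icc.exists_bound_of_continuousOn hf
  refine MemLp.of_bound ((hf.mono Ioo_subset_Icc_self).aestronglyMeasurable measurableSet_Ioo) C ?_
  rw [ae_restrict_iff' measurableSet_Ioo]
  exact ae_of_all _ fun x hx => hC x (Ioo_subset_Icc_self hx)

theorem memLp_continuousOn_mul {L : ℝ} {f g : ℝ → ℂ} (hf : ContinuousOn f (Icc 0 L))
    (hg : MemLp g 2 (vol L)) : MemLp (fun x => f x * g x) 2 (vol L) := by
  obtain ⟨C, hC⟩ := isCompact_Icc.exists_bound_of_continuousOn hf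
  refine MemLp.of_le_mul (c := C) hg
    (((hf.mono Ioo_subset_Icc_self).aestronglyMeasurable measurableSet_Ioo).mul hg.1) ?_
  rw [ae_restrict_iff' measurableSet_Ioo]
  refine ae_of_all _ fun x hx => ?_
  rw [norm_mul]
  gcongr
  exact hC x (Ioo_subset_Icc_self hx)

theorem intervalIntegrable_of_memLp {L : ℝ} (hL : 0 < L) {f : ℝ → ℂ} (hf : MemLp f 2 (vol L)) :
    IntervalIntegrable f volume 0 L :=
  (intervalIntegrable_iff_integrableOn_Ioo_of_le hL.le).mpr (hf.integrable (by norm_num))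

theorem intervalIntegrable_of_mem_Icc {L : ℝ} {f : ℝ → ℂ} (hf : IntervalIntegrable f volume 0 L)
    {x : ℝ} (hx : x ∈ Icc 0 L) : IntervalIntegrable f volume 0 x :=
  hf.mono_set (uIcc_subset_uIcc left_mem_uIcc (by rwa [uIcc_of_le (hx.1.trans hx.2)]))

theorem continuousOn_primitive {L : ℝ} (hL : 0 < L) {f : ℝ → ℂ}
    (hf : IntervalIntegrable f volume 0 L) :
    ContinuousOn (fun x => ∫ t in (0)..x, f t) (Icc 0 L) := by
  have := intervalIntegral.continuousOn_primitive_interval' hf left_mem_uIcc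
  rwa [uIcc_of_le hL.le] at this

theorem isPrimitive_integral {L : ℝ} {f : ℝ → ℂ} (hf : MemLp f 2 (vol L)) (c : ℂ) :
    IsPrimitive L (fun x => c + ∫ t in (0)..x, f t) f :=
  ⟨hf, fun x _ => by simp⟩

theorem absolutelyContinuousOnInterval_congr {E : Type*} [PseudoMetricSpace E] {f g : ℝ → E}
    {a b : ℝ} (hf : AbsolutelyContinuousOnInterval f a b) (h : EqOn f g (uIcc a b)) :
    AbsolutelyContinuousOnInterval g a b := by
  rw [absolutelyContinuousOnInterval_iff] at hf ⊢
  intro ε hε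
  obtain ⟨δ, hδ, H⟩ := hf ε hε
  refine ⟨δ, hδ, fun E hE hs => ?_⟩
  refine (Finset.sum_congr rfl fun i hi => ?_).trans_lt (H E hE hs)
  rw [h (hE.1 i hi).1, h (hE.1 i hi).2]

namespace IsPrimitive

variable {L : ℝ} {f f' g g' : ℝ → ℂ}

theorem intervalIntegrable (hf : IsPrimitive L f f') (hL : 0 < L) :
    IntervalIntegrable f' volume 0 L :=
  intervalIntegrable_of_memLp hL hf.memLp

theorem continuousOn (hf : IsPrimitive L f f') (hL : 0 < L) : ContinuousOn f (Icc 0 L) :=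
  (continuousOn_const.add (continuousOn_primitive hL (hf.intervalIntegrable hL))).congr hf.eq

theorem congr (hf : IsPrimitive L f f') (hL : 0 < L) (h : EqOn f g (Icc 0 L))
    (h' : f' =ᵐ[vol L] g') : IsPrimitive L g g' := by
  refine ⟨(memLp_congr_ae h').mp hf.memLp, fun x hx => ?_⟩
  rw [← h hx, ← h (left_mem_Icc.mpr hL.le), hf.eq x hx]
  congr 1
  apply intervalIntegral.integral_congr_ae
  rw [uIoc_of_le hx.1]
  have h1 := (ae_restrict_iff' measurableSet_Ioo).mp h'
  have h2 : ∀ᵐ t : ℝ, t ≠ L := Measure.ae_ne volume L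
  filter_upwards [h1, h2] with t ht htL hm
  exact ht ⟨hm.1, lt_of_le_of_ne (hm.2.trans hx.2) htL⟩

theorem add (hf : IsPrimitive L f f') (hg : IsPrimitive L g g') (hL : 0 < L) :
    IsPrimitive L (fun x => f x + g x) fun x => f' x + g' x := by
  refine ⟨hf.memLp.add hg.memLp, fun x hx => ?_⟩
  rw [intervalIntegral.integral_add
    (intervalIntegrable_of_mem_Icc (hf.intervalIntegrable hL) hx)
    (intervalIntegrable_of_mem_Icc (hg.intervalIntegrable hL) hx), hf.eq x hx, hg.eq x hx]
  ring

theorem const_mul (hf : IsPrimitive L f f') (c : ℂ) :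
    IsPrimitive L (fun x => c * f x) fun x => c * f' x := by
  refine ⟨hf.memLp.const_mul c, fun x hx => ?_⟩
  rw [intervalIntegral.integral_const_mul, hf.eq x hx]
  ring

theorem conj (hf : IsPrimitive L f f') :
    IsPrimitive L (fun x => starRingEnd ℂ (f x)) fun x => starRingEnd ℂ (f' x) := by
  refine ⟨hf.memLp.star, fun x hx => ?_⟩
  rw [hf.eq x hx, map_add]
  congr 1
  have h := fun s : Set ℝ => integral_conj (μ := volume.restrict s) (f := f')
  simp only [intervalIntegral, h, map_sub]

/-- Real and imaginary parts are treated as real primitives and recombined through the constants `1`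
and `I`. -/
theorem absolutelyContinuous (hf : IsPrimitive L f f') (hL : 0 < L) :
    AbsolutelyContinuousOnInterval f 0 L := by
  have hi := hf.intervalIntegrable hL
  have hre : IntervalIntegrable (fun t => (f' t).re) volume 0 L := ⟨hi.1.re, hi.2.re⟩
  have him : IntervalIntegrable (fun t => (f' t).im) volume 0 L := ⟨hi.1.im, hi.2.im⟩
  have hc : ∀ c : ℂ, AbsolutelyContinuousOnInterval (fun _ : ℝ => c) 0 L := fun c =>
    (contDiff_const.contDiffOn).absolutelyContinuousOnInterval
  have h1 := (hre.absolutelyContinuousOnInterval_intervalIntegral (c := 0) left_mem_uIcc).smul (hc 1)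
  have h2 := (him.absolutelyContinuousOnInterval_intervalIntegral (c := 0) left_mem_uIcc).smul
    (hc Complex.I)
  refine absolutelyContinuousOnInterval_congr ((hc (f 0)).add (h1.add h2)) fun x hx => ?_
  rw [uIcc_of_le hL.le] at hx
  have hix := intervalIntegrable_of_mem_Icc hi hx
  rw [hf.eq x hx]
  have ere := Complex.reCLM.intervalIntegral_comp_comm hix
  have eim := Complex.imCLM.intervalIntegral_comp_comm hix
  simp only [Complex.reCLM_apply, Complex.imCLM_apply] at ere eim
  simp only [Pi.add_apply, Pi.smul_apply', ere, eim, Complex.real_smul, mul_one, Complex.re_add_im]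

theorem ae_hasDerivAt (hf : IsPrimitive L f f') (hL : 0 < L) :
    ∀ᵐ x, x ∈ Ioo 0 L → HasDerivAt f (f' x) x := by
  filter_upwards [(hf.intervalIntegrable hL).ae_hasDerivAt_integral] with x hx hxL
  have h1 := (hx (by rw [uIcc_of_le hL.le]; exact Ioo_subset_Icc_self hxL) 0
    left_mem_uIcc).const_add (f 0)
  refine h1.congr_of_eventuallyEq ?_
  filter_upwards [Icc_mem_nhds hxL.1 hxL.2] with y hy using hf.eq y hy

/-- The difference from the integral of `f'` is absolutely continuous with derivative zero almost
everywhere, hence constant. This turns the pointwise product rule into a statement about primitives.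
-/
theorem of_ae_hasDerivAt (hL : 0 < L) (hf : AbsolutelyContinuousOnInterval f 0 L)
    (hf' : MemLp f' 2 (vol L)) (h : ∀ᵐ x, x ∈ Ioo 0 L → HasDerivAt f (f' x) x) :
    IsPrimitive L f f' := by
  refine ⟨hf', fun x hx => ?_⟩
  have hp := isPrimitive_integral hf' 0
  have hd : AbsolutelyContinuousOnInterval (f - fun x => 0 + ∫ t in (0)..x, f' t) 0 L :=
    hf.sub (hp.absolutelyContinuous hL)
  obtain ⟨C, hC⟩ := hd.const_of_ae_hasDerivAt_zero (by
    filter_upwards [h, hp.ae_hasDerivAt hL, Measure.ae_ne volume 0, Measure.ae_ne volume L]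
      with x h1 h2 h3 h4 hx
    rw [uIcc_of_le hL.le] at hx
    have hx' : x ∈ Ioo 0 L := ⟨lt_of_le_of_ne hx.1 h3.symm, lt_of_le_of_ne hx.2 h4⟩
    simpa using (h1 hx').sub (h2 hx'))
  rw [uIcc_of_le hL.le] at hC
  have h0 := hC 0 (left_mem_Icc.mpr hL.le)
  have h1 := hC x hx
  simp only [Pi.sub_apply, zero_add, intervalIntegral.integral_same, sub_zero] at h0 h1
  rw [h0, ← h1]
  ring

theorem mul (hf : IsPrimitive L f f') (hg : IsPrimitive L g g') (hL : 0 < L) :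
    IsPrimitive L (fun x => f x * g x) fun x => f' x * g x + f x * g' x := by
  refine of_ae_hasDerivAt hL ((hf.absolutelyContinuous hL).smul (hg.absolutelyContinuous hL)) ?_ ?_
  · refine MemLp.add ?_ (memLp_continuousOn_mul (hf.continuousOn hL) hg.memLp)
    simpa only [mul_comm] using memLp_continuousOn_mul (hg.continuousOn hL) hf.memLp
  · filter_upwards [hf.ae_hasDerivAt hL, hg.ae_hasDerivAt hL] with x h1 h2 hx
    exact (h1 hx).mul (h2 hx)

theorem integral_eq (hf : IsPrimitive L f f') (hL : 0 < L) :
    ∫ x in Ioo 0 L, f' x = f L - f 0 := by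
  rw [hf.eq L (right_mem_Icc.mpr hL.le), intervalIntegral.integral_of_le hL.le,
    integral_Ioc_eq_integral_Ioo]
  ring

theorem isWeakDeriv (hf : IsPrimitive L f f') (hL : 0 < L) : IsWeakDeriv L f f' := by
  have hi := hf.intervalIntegrable hL
  have hc : IsWeakDeriv L (fun _ => f 0) (fun _ => 0) := by
    intro φ hφ
    have h0 : ∫ x in Ioo 0 L, deriv φ x = 0 := by
      have h1 := intervalIntegral.integral_deriv_eq_sub (a := 0) (b := L)
        (fun x _ => (hφ.contDiff.differentiable (by simp)).differentiableAt)
        (hφ.deriv.contDiff.continuous.intervalIntegrable _ _)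
      rw [intervalIntegral.integral_of_le hL.le, integral_Ioc_eq_integral_Ioo,
        image_eq_zero_of_notMem_tsupport fun h => (hφ.tsupport_subset h).1.false,
        image_eq_zero_of_notMem_tsupport fun h => (hφ.tsupport_subset h).2.false, sub_zero] at h1
      exact h1
    rw [integral_smul_const, h0]
    simp
  have h := hc.add (isWeakDeriv_primitive hL hi) (by simp)
    (((continuousOn_primitive hL hi).integrableOn_compact isCompact_Icc).mono_set
      Ioo_subset_Icc_self) (by simp) ((intervalIntegrable_iff_integrableOn_Ioo_of_le hL.le).mp hi)
  refine h.congr ?_ (ae_of_all _ fun x => by simp)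
  rw [Filter.EventuallyEq, ae_restrict_iff' measurableSet_Ioo]
  exact ae_of_all _ fun x hx => (hf.eq x (Ioo_subset_Icc_self hx)).symm

theorem of_hasDerivAt (hL : 0 < L) (hf : ContinuousOn f (Icc 0 L))
    (hf' : ContinuousOn f' (Icc 0 L)) (h : ∀ x ∈ Ioo 0 L, HasDerivAt f (f' x) x) :
    IsPrimitive L f f' := by
  refine ⟨memLp_of_continuousOn hf', fun x hx => ?_⟩
  have hs : Icc 0 x ⊆ Icc 0 L := Icc_subset_Icc_right hx.2
  rw [intervalIntegral.integral_eq_sub_of_hasDerivAt_of_le hx.1 (hf.mono hs)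
    (fun y hy => h y ⟨hy.1, hy.2.trans_le hx.2⟩)
    (intervalIntegrable_of_mem_Icc (intervalIntegrable_of_memLp hL (memLp_of_continuousOn hf')) hx)]
  ring

theorem hasDerivAt (hf : IsPrimitive L f f') (hL : 0 < L) (hf' : ContinuousOn f' (Icc 0 L)) {x : ℝ}
    (hx : x ∈ Ioo 0 L) : HasDerivAt f (f' x) x := by
  have hi := hf.intervalIntegrable hL
  have h1 := (intervalIntegral.integral_hasDerivAt_right
    (intervalIntegrable_of_mem_Icc hi (Ioo_subset_Icc_self hx))
    ((hf'.mono Ioo_subset_Icc_self).stronglyMeasurableAtFilter isOpen_Ioo x hx)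
    (hf'.continuousAt (Icc_mem_nhds hx.1 hx.2))).const_add (f 0)
  refine h1.congr_of_eventuallyEq ?_
  filter_upwards [Icc_mem_nhds hx.1 hx.2] with y hy using hf.eq y hy

theorem inv (hf : IsPrimitive L f f') (hL : 0 < L) (hf' : ContinuousOn f' (Icc 0 L))
    (h0 : ∀ x ∈ Icc 0 L, f x ≠ 0) : IsPrimitive L (fun x => (f x)⁻¹) fun x => -f' x / f x ^ 2 :=
  of_hasDerivAt hL ((hf.continuousOn hL).inv₀ h0)
    (hf'.neg.div ((hf.continuousOn hL).pow 2) fun x hx => pow_ne_zero 2 (h0 x hx))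
    fun _ hx => (hf.hasDerivAt hL hf' hx).inv (h0 _ (Ioo_subset_Icc_self hx))

end IsPrimitive

/-- The bridge from weak derivatives to calculus: subtracting the primitive of `g` leaves a function
with weak derivative zero, so the continuous representative is a constant plus that primitive. -/
theorem isPrimitive_pt {L : ℝ} (hL : 0 < L) {f g : L2 L} (h : IsWeakDeriv L f g) :
    IsPrimitive L (pt f) g ∧ f =ᵐ[vol L] pt f := by
  obtain ⟨F, hF, hfF⟩ := h.hasContRep hL
  have hg := intervalIntegrable_of_memLp hL (Lp.memLp g)
  have hw := h.add ((isWeakDeriv_primitive hL hg).smul (-1)) (L2.integrableOn f)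
    ((((continuousOn_primitive hL hg).integrableOn_compact isCompact_Icc).mono_set
      Ioo_subset_Icc_self).smul (-1 : ℂ)) (L2.integrableOn g)
    ((L2.integrableOn g).smul (-1 : ℂ))
  obtain ⟨c, hc⟩ := ae_eq_const_of_isWeakDeriv_zero hL
    ((L2.integrableOn f).add ((((continuousOn_primitive hL hg).integrableOn_compact
      isCompact_Icc).mono_set Ioo_subset_Icc_self).smul (-1 : ℂ)))
    (hw.congr (ae_eq_refl _) (ae_of_all _ fun x => by simp))
  have hp := isPrimitive_integral (Lp.memLp g) c
  have hae : f =ᵐ[vol L] fun x => c + ∫ t in (0)..x, g t := by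
    filter_upwards [hc] with x hx
    rw [← hx]
    simp
  have hpt : ∀ x ∈ Icc 0 L, pt f x = c + ∫ t in (0)..x, g t := fun x hx =>
    pt_eq hL (hp.continuousOn hL) hae hx
  refine ⟨hp.congr hL (fun x hx => (hpt x hx).symm) (ae_eq_refl _), hae.trans ?_⟩
  rw [Filter.EventuallyEq, ae_restrict_iff' measurableSet_Ioo]
  exact ae_of_all _ fun x hx => (hpt x (Ioo_subset_Icc_self hx)).symm

/-! ### Bounded operators on `L²(0, L)` -/

/-- The constant functions. -/
noncomputable def constL (L : ℝ) : ℂ →L[ℂ] L2 L := Lp.constL 2 (vol L) ℂ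

theorem coeFn_constL {L : ℝ} (c : ℂ) : constL L c =ᵐ[vol L] fun _ => c :=
  Lp.coeFn_const 2 (vol L) c

/-- Integration over `(0, L)`. -/
noncomputable def integralL (L : ℝ) : L2 L →L[ℂ] ℂ := innerSL ℂ (constL L 1)

theorem integralL_apply {L : ℝ} (f : L2 L) : integralL L f = ∫ x in Ioo 0 L, f x := by
  rw [integralL, innerSL_apply_apply, L2.inner_def]
  apply integral_congr_ae
  filter_upwards [coeFn_constL (L := L) 1] with x hx
  rw [hx]
  simp

theorem exists_mulL {L : ℝ} {f : ℝ → ℂ} (hf : ContinuousOn f (Icc 0 L)) :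
    ∃ T : L2 L →L[ℂ] L2 L, ∀ u, T u =ᵐ[vol L] fun x => f x * u x := by
  obtain ⟨C, hC⟩ := isCompact_Icc.exists_bound_of_continuousOn hf
  have hm : ∀ u : L2 L, MemLp (fun x => f x * u x) 2 (vol L) := fun u =>
    memLp_continuousOn_mul hf (Lp.memLp u)
  have hc : ∀ u, (hm u).toLp =ᵐ[vol L] fun x => f x * u x := fun u => (hm u).coeFn_toLp
  refine ⟨LinearMap.mkContinuous ⟨⟨fun u => (hm u).toLp, fun u v => ?_⟩, fun c u => ?_⟩ C
    fun u => ?_, hc⟩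
  · refine Lp.ext ?_
    filter_upwards [hc (u + v), hc u, hc v, Lp.coeFn_add u v,
      Lp.coeFn_add (hm u).toLp (hm v).toLp] with x h1 h2 h3 h4 h5
    rw [h1, h5, Pi.add_apply, h2, h3, h4, Pi.add_apply, mul_add]
  · refine Lp.ext ?_
    filter_upwards [hc (c • u), hc u, Lp.coeFn_smul c u, Lp.coeFn_smul c (hm u).toLp]
      with x h1 h2 h3 h4
    rw [h1, RingHom.id_apply, h4, Pi.smul_apply, h2, h3, Pi.smul_apply, smul_eq_mul, smul_eq_mul]
    ring
  · refine Lp.norm_le_mul_norm_of_ae_le_mul ?_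
    filter_upwards [hc u, ae_restrict_mem measurableSet_Ioo] with x h1 hx
    have h2 : ‖f x * u x‖ ≤ C * ‖u x‖ := by
      rw [norm_mul]
      gcongr
      exact hC x (Ioo_subset_Icc_self hx)
    rw [← h1] at h2
    exact h2

/-- Multiplication by a continuous function. -/
noncomputable def mulL {L : ℝ} {f : ℝ → ℂ} (hf : ContinuousOn f (Icc 0 L)) : L2 L →L[ℂ] L2 L :=
  (exists_mulL hf).choose

theorem coeFn_mulL {L : ℝ} {f : ℝ → ℂ} (hf : ContinuousOn f (Icc 0 L)) (u : L2 L) :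
    mulL hf u =ᵐ[vol L] fun x => f x * u x := (exists_mulL hf).choose_spec u

theorem exists_volterraL {L : ℝ} (hL : 0 < L) :
    ∃ T : L2 L →L[ℂ] L2 L, ∀ u : L2 L, T u =ᵐ[vol L] fun x => ∫ t in (0)..x, u t := by
  have hi : ∀ u : L2 L, IntervalIntegrable u volume 0 L := fun u =>
    intervalIntegrable_of_memLp hL (Lp.memLp u)
  have hm : ∀ u : L2 L, MemLp (fun x => ∫ t in (0)..x, u t) 2 (vol L) := fun u =>
    memLp_of_continuousOn (continuousOn_primitive hL (hi u))
  have hc : ∀ u : L2 L, (hm u).toLp =ᵐ[vol L] fun x => ∫ t in (0)..x, u t := fun u =>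
    (hm u).coeFn_toLp
  obtain ⟨B, hB⟩ : ∃ B : ℝ, B = (vol L).real univ ^ (1 / (2 : ℝ≥0∞).toReal) := ⟨_, rfl⟩
  have hB0 : 0 ≤ B := by rw [hB]; positivity
  -- The integral is the inner product with the indicator of `(0, x]`, so Cauchy–Schwarz applies;
  -- `B` is the `L²` norm of the constant `1`.
  have hb : ∀ (u : L2 L), ∀ x ∈ Ioo 0 L, ‖∫ t in (0)..x, u t‖ ≤ B * ‖u‖ := by
    intro u x hx
    have h1 := L2.inner_indicatorConstLp_one (𝕜 := ℂ) (μ := vol L) (measurableSet_Ioc (a := 0) (b := x))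
      (measure_ne_top _ _) u
    rw [Measure.restrict_restrict measurableSet_Ioc, inter_eq_left.mpr (show Ioc 0 x ⊆ Ioo 0 L from
      fun t ht => ⟨ht.1, ht.2.trans_lt hx.2⟩), ← intervalIntegral.integral_of_le hx.1.le] at h1
    rw [← h1]
    refine (norm_inner_le_norm _ _).trans ?_
    gcongr
    refine norm_indicatorConstLp_le.trans ?_
    rw [hB, norm_one, one_mul]
    gcongr
    · exact measure_ne_top _ _
    · exact subset_univ _
  refine ⟨LinearMap.mkContinuous ⟨⟨fun u => (hm u).toLp, fun u v => ?_⟩, fun c u => ?_⟩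
    (measureUnivNNReal (vol L) ^ (2 : ℝ≥0∞).toReal⁻¹ * B) fun u => ?_, hc⟩
  · refine Lp.ext ?_
    filter_upwards [hc (u + v), hc u, hc v, Lp.coeFn_add (hm u).toLp (hm v).toLp,
      ae_restrict_mem measurableSet_Ioo] with x h1 h2 h3 h5 hx
    rw [h1, h5, Pi.add_apply, h2, h3, ← intervalIntegral.integral_add
      (intervalIntegrable_of_mem_Icc (hi u) (Ioo_subset_Icc_self hx))
      (intervalIntegrable_of_mem_Icc (hi v) (Ioo_subset_Icc_self hx))]
    apply intervalIntegral.integral_congr_ae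
    filter_upwards [(ae_restrict_iff' measurableSet_Ioo).mp (Lp.coeFn_add u v)] with t ht hm
    rw [uIoc_of_le hx.1.le] at hm
    exact ht ⟨hm.1, hm.2.trans_lt hx.2⟩
  · refine Lp.ext ?_
    filter_upwards [hc (c • u), hc u, Lp.coeFn_smul c (hm u).toLp,
      ae_restrict_mem measurableSet_Ioo] with x h1 h2 h4 hx
    rw [h1, RingHom.id_apply, h4, Pi.smul_apply, h2, ← intervalIntegral.integral_smul]
    apply intervalIntegral.integral_congr_ae
    filter_upwards [(ae_restrict_iff' measurableSet_Ioo).mp (Lp.coeFn_smul c u)] with t ht hm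
    rw [uIoc_of_le hx.1.le] at hm
    exact ht ⟨hm.1, hm.2.trans_lt hx.2⟩
  · have := Lp.norm_le_of_ae_bound (f := (hm u).toLp) (C := B * ‖u‖) (by positivity) (by
      filter_upwards [hc u, ae_restrict_mem measurableSet_Ioo] with x h1 hx
      rw [h1]
      exact hb u x hx)
    exact this.trans_eq (mul_assoc _ _ _).symm

/-- The Volterra operator `u ↦ ∫₀ˣ u`. -/
noncomputable def volterraL {L : ℝ} (hL : 0 < L) : L2 L →L[ℂ] L2 L := (exists_volterraL hL).choose

theorem coeFn_volterraL {L : ℝ} (hL : 0 < L) (u : L2 L) :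
    volterraL hL u =ᵐ[vol L] fun x => ∫ t in (0)..x, u t := (exists_volterraL hL).choose_spec u

/-! ### Completeness -/

/-- For each test function both sides of the defining identity are continuous, so the set is an
intersection of closed sets. -/
theorem isClosed_isWeakDeriv {E : Type*} [TopologicalSpace E] {L : ℝ} {T S : E → L2 L}
    (hT : Continuous T) (hS : Continuous S) : IsClosed {u | IsWeakDeriv L (T u) (S u)} := by
  simp only [IsWeakDeriv, ofPred_forall]
  refine isClosed_iInter fun φ => isClosed_iInter fun hφ => ?_
  have key : ∀ φ : ℝ → ℝ, IsTestFunction L φ → ∀ {F : E → L2 L}, Continuous F →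
      Continuous fun u => ∫ x in Ioo 0 L, φ x • F u x := by
    intro φ hφ F hF
    have hc : ContinuousOn (fun x => (φ x : ℂ)) (Icc 0 L) :=
      (Complex.continuous_ofReal.comp hφ.contDiff.continuous).continuousOn
    refine ((integralL L).continuous.comp ((mulL hc).continuous.comp hF)).congr fun u => ?_
    rw [Function.comp_apply, integralL_apply]
    apply integral_congr_ae
    filter_upwards [coeFn_mulL hc (F u)] with x hx
    rw [Function.comp_apply, hx, Complex.real_smul]
  exact isClosed_eq (key _ hφ.deriv hT) (key _ hφ hS).neg

instance (n : ℕ) (L : ℝ) : CompleteSpace (Sobolev n L) := by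
  have : IsClosed (sobolevSubmodule n L : Set (PiLp 2 fun _ : Fin (n + 1) => L2 L)) := by
    have h : (sobolevSubmodule n L : Set (PiLp 2 fun _ : Fin (n + 1) => L2 L)) =
        ⋂ k : Fin n, {u | IsWeakDeriv L (u k.castSucc) (u k.succ)} := by
      ext u
      rw [mem_iInter]
      rfl
    rw [h]
    exact isClosed_iInter fun k => isClosed_isWeakDeriv
      (PiLp.continuous_apply 2 _ _) (PiLp.continuous_apply 2 _ _)
  exact this.completeSpace_coe

/-- `D k` as a bounded operator. -/
noncomputable def derivL {n : ℕ} (L : ℝ) (k : Fin (n + 1)) : Sobolev n L →L[ℂ] L2 L :=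
  ⟨D k, (PiLp.continuous_apply 2 _ k).comp continuous_subtype_val⟩

@[simp]
theorem derivL_apply {n : ℕ} {L : ℝ} (k : Fin (n + 1)) (u : Sobolev n L) : derivL L k u = D k u :=
  rfl

theorem Sobolev.norm_sq {n : ℕ} {L : ℝ} (u : Sobolev n L) : ‖u‖ ^ 2 = ∑ k, ‖D k u‖ ^ 2 :=
  PiLp.norm_sq_eq_of_L2 _ (u : sobolevSubmodule n L).1

theorem exists_sobolev {n : ℕ} {L : ℝ} (t : Fin (n + 1) → L2 L)
    (h : ∀ k : Fin n, IsWeakDeriv L (t k.castSucc) (t k.succ)) :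
    ∃ u : Sobolev n L, ∀ k, D k u = t k := ⟨⟨WithLp.toLp 2 t, h⟩, fun _ => rfl⟩

theorem exists_sobolevL {E : Type*} [NormedAddCommGroup E] [NormedSpace ℂ E] {n : ℕ} {L : ℝ}
    (t : Fin (n + 1) → E →L[ℂ] L2 L)
    (h : ∀ x, ∀ k : Fin n, IsWeakDeriv L (t k.castSucc x) (t k.succ x)) :
    ∃ T : E →L[ℂ] Sobolev n L, ∀ x k, D k (T x) = t k x :=
  ⟨(((PiLp.continuousLinearEquiv 2 ℂ fun _ : Fin (n + 1) => L2 L).symm.toContinuousLinearMap.comp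
    (ContinuousLinearMap.pi t)).codRestrict (sobolevSubmodule n L) h : E →L[ℂ] sobolevSubmodule n L),
    fun _ _ => rfl⟩

theorem Sobolev.isPrimitive {n : ℕ} {L : ℝ} (hL : 0 < L) (u : Sobolev n L) (k : Fin n) :
    IsPrimitive L (pt (D k.castSucc u)) (D k.succ u) := (isPrimitive_pt hL (isWeakDeriv_D u k)).1

theorem Sobolev.ae_eq_pt {n : ℕ} {L : ℝ} (hL : 0 < L) (u : Sobolev n L) (k : Fin n) :
    D k.castSucc u =ᵐ[vol L] pt (D k.castSucc u) := (isPrimitive_pt hL (isWeakDeriv_D u k)).2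

theorem D_eq_const_add_volterra {n : ℕ} {L : ℝ} (hL : 0 < L) (u : Sobolev n L) (k : Fin n) :
    D k.castSucc u = constL L (pt (D k.castSucc u) 0) + volterraL hL (D k.succ u) := by
  refine Lp.ext ?_
  filter_upwards [u.ae_eq_pt hL k, Lp.coeFn_add (constL L (pt (D k.castSucc u) 0))
    (volterraL hL (D k.succ u)), coeFn_constL (L := L) (pt (D k.castSucc u) 0),
    coeFn_volterraL hL (D k.succ u), ae_restrict_mem measurableSet_Ioo] with x h1 h2 h3 h4 hx
  rw [h1, h2, Pi.add_apply, h3, h4, (u.isPrimitive hL k).eq x (Ioo_subset_Icc_self hx)]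

theorem exists_evalL {n : ℕ} {L : ℝ} (hL : 0 < L) (k : Fin n) :
    ∃ T₀ T₁ : Sobolev n L →L[ℂ] ℂ, ∀ u, T₀ u = pt (D k.castSucc u) 0 ∧ T₁ u = pt (D k.castSucc u) L := by
  -- Averaging `f(x) = f(0) + ∫₀ˣ f'` over `(0, L)` expresses `f(0)` by bounded operators; `f(L)`
  -- then follows by adding `∫ f'`.
  let T₀ : Sobolev n L →L[ℂ] ℂ := ((L : ℂ)⁻¹) • ((integralL L).comp (derivL L k.castSucc) -
    (integralL L).comp ((volterraL hL).comp (derivL L k.succ)))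
  have hT₀ : ∀ u, T₀ u = pt (D k.castSucc u) 0 := by
    intro u
    have h2 : integralL L (constL L (pt (D k.castSucc u) 0)) = L * pt (D k.castSucc u) 0 := by
      rw [integralL_apply, integral_congr_ae (coeFn_constL (L := L) (pt (D k.castSucc u) 0))]
      simp [hL.le]
    have h3 : T₀ u = (L : ℂ)⁻¹ * (integralL L (D k.castSucc u) - integralL L (volterraL hL (D k.succ u))) :=
      rfl
    rw [h3]
    nth_rw 1 [D_eq_const_add_volterra hL u k]
    rw [map_add, h2]
    have : (L : ℂ) ≠ 0 := by exact_mod_cast hL.ne'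
    field_simp
    ring
  refine ⟨T₀, T₀ + (integralL L).comp (derivL L k.succ), fun u => ⟨hT₀ u, ?_⟩⟩
  have := (u.isPrimitive hL k).integral_eq hL
  rw [← integralL_apply] at this
  simp [hT₀, this]

/-- Evaluation at `0`. -/
noncomputable def evalZeroL {n : ℕ} {L : ℝ} (hL : 0 < L) (k : Fin n) : Sobolev n L →L[ℂ] ℂ :=
  (exists_evalL hL k).choose

/-- Evaluation at `L`. -/
noncomputable def evalRightL {n : ℕ} {L : ℝ} (hL : 0 < L) (k : Fin n) : Sobolev n L →L[ℂ] ℂ :=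
  (exists_evalL hL k).choose_spec.choose

theorem evalZeroL_apply {n : ℕ} {L : ℝ} (hL : 0 < L) (k : Fin n) (u : Sobolev n L) :
    evalZeroL hL k u = pt (D k.castSucc u) 0 := ((exists_evalL hL k).choose_spec.choose_spec u).1

theorem evalRightL_apply {n : ℕ} {L : ℝ} (hL : 0 < L) (k : Fin n) (u : Sobolev n L) :
    evalRightL hL k u = pt (D k.castSucc u) L := ((exists_evalL hL k).choose_spec.choose_spec u).2

/-! ### Components of states -/

/-- The component `w`, as a bounded operator. -/
noncomputable def ambientW (L : ℝ) : Ambient L →L[ℂ] Sobolev 2 L :=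
  WithLp.fstL 2 ℂ (Sobolev 2 L) (WithLp 2 (Sobolev 1 L × WithLp 2 (ℂ × ℂ)))

/-- The component `v`, as a bounded operator. -/
noncomputable def ambientV (L : ℝ) : Ambient L →L[ℂ] Sobolev 1 L :=
  (WithLp.fstL 2 ℂ (Sobolev 1 L) (WithLp 2 (ℂ × ℂ))).comp
    (WithLp.sndL 2 ℂ (Sobolev 2 L) (WithLp 2 (Sobolev 1 L × WithLp 2 (ℂ × ℂ))))

theorem Ambient.norm_sq {L : ℝ} (z : Ambient L) :
    ‖z‖ ^ 2 = ‖z.w‖ ^ 2 + (‖z.v‖ ^ 2 + (‖z.ξ‖ ^ 2 + ‖z.ψ‖ ^ 2)) := by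
  have h1 : ‖z‖ ^ 2 = _ := WithLp.prod_norm_sq_eq_of_L2
    (α := Sobolev 2 L) (β := WithLp 2 (Sobolev 1 L × WithLp 2 (ℂ × ℂ))) z
  have h2 := WithLp.prod_norm_sq_eq_of_L2
    (α := Sobolev 1 L) (β := WithLp 2 (ℂ × ℂ)) (WithLp.snd z)
  have h3 := WithLp.prod_norm_sq_eq_of_L2 (α := ℂ) (β := ℂ) (WithLp.snd (WithLp.snd z))
  rw [h1, h2, h3]
  rfl

section State

variable {L : ℝ} [hL : Fact (0 < L)]

variable (L) in
/-- The inclusion of the state space, as a bounded operator. -/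
noncomputable def toTupleL : StateSpace L →L[ℂ] Ambient L := (stateSubmodule L).subtypeL

theorem norm_toTuple (z : StateSpace L) : ‖toTuple z‖ = ‖z‖ := rfl

variable (L) in
/-- The component `w` of a state. -/
noncomputable def stateW : StateSpace L →L[ℂ] Sobolev 2 L := (ambientW L).comp (toTupleL L)

variable (L) in
/-- The component `v` of a state. -/
noncomputable def stateV : StateSpace L →L[ℂ] Sobolev 1 L := (ambientV L).comp (toTupleL L)

theorem stateW_apply (z : StateSpace L) : stateW L z = (toTuple z).w := rfl

theorem stateV_apply (z : StateSpace L) : stateV L z = (toTuple z).v := rfl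

theorem state_ξ (z : StateSpace L) : (toTuple z).ξ = pt (D 0 (toTuple z).v) L := z.2.1

theorem state_ψ (z : StateSpace L) : (toTuple z).ψ = pt (D 0 (toTuple z).v) 0 := z.2.2

theorem state_ext {y z : StateSpace L} (hw : (toTuple y).w = (toTuple z).w)
    (hv : (toTuple y).v = (toTuple z).v) : y = z := by
  apply toTuple_injective
  have h : ∀ z : StateSpace L, toTuple z = mk (toTuple z).w (toTuple z).v
    (pt (D 0 (toTuple z).v) L) (pt (D 0 (toTuple z).v) 0) := fun z => by
    rw [← state_ξ, ← state_ψ]; rfl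
  rw [h y, h z, hw, hv]

instance : CompleteSpace (StateSpace L) := by
  have hcomp : CompleteSpace (Ambient L) := inferInstanceAs
    (CompleteSpace (WithLp 2 (Sobolev 2 L × WithLp 2 (Sobolev 1 L × WithLp 2 (ℂ × ℂ)))))
  have : IsClosed (stateSubmodule L : Set (Ambient L)) := by
    have h : (stateSubmodule L : Set (Ambient L)) =
        {z | z.ξ = evalRightL hL.out (0 : Fin 1) z.v} ∩ {z | z.ψ = evalZeroL hL.out (0 : Fin 1) z.v} := by
      ext z
      simp only [evalRightL_apply, evalZeroL_apply]
      rfl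
    have hV : Continuous fun z : Ambient L => z.v := (ambientV L).continuous
    have hξ : Continuous fun z : Ambient L => z.ξ := ((WithLp.fstL 2 ℂ ℂ ℂ).comp
      ((WithLp.sndL 2 ℂ (Sobolev 1 L) (WithLp 2 (ℂ × ℂ))).comp
      (WithLp.sndL 2 ℂ (Sobolev 2 L) (WithLp 2 (Sobolev 1 L × WithLp 2 (ℂ × ℂ)))))).continuous
    have hψ : Continuous fun z : Ambient L => z.ψ := ((WithLp.sndL 2 ℂ ℂ ℂ).comp
      ((WithLp.sndL 2 ℂ (Sobolev 1 L) (WithLp 2 (ℂ × ℂ))).comp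
      (WithLp.sndL 2 ℂ (Sobolev 2 L) (WithLp 2 (Sobolev 1 L × WithLp 2 (ℂ × ℂ)))))).continuous
    rw [h]
    exact (isClosed_eq hξ ((evalRightL hL.out 0).continuous.comp hV)).inter
      (isClosed_eq hψ ((evalZeroL hL.out 0).continuous.comp hV))
  exact this.completeSpace_coe

theorem exists_stateL {E : Type*} [NormedAddCommGroup E] [NormedSpace ℂ E]
    (W : E →L[ℂ] Sobolev 2 L) (V : E →L[ℂ] Sobolev 1 L) :
    ∃ T : E →L[ℂ] StateSpace L, ∀ x, (toTuple (T x)).w = W x ∧ (toTuple (T x)).v = V x := by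
  let T : E →L[ℂ] Ambient L :=
    (WithLp.prodContinuousLinearEquiv 2 ℂ (Sobolev 2 L)
      (WithLp 2 (Sobolev 1 L × WithLp 2 (ℂ × ℂ)))).symm.toContinuousLinearMap.comp (W.prod
      ((WithLp.prodContinuousLinearEquiv 2 ℂ (Sobolev 1 L)
        (WithLp 2 (ℂ × ℂ))).symm.toContinuousLinearMap.comp (V.prod
        ((WithLp.prodContinuousLinearEquiv 2 ℂ ℂ ℂ).symm.toContinuousLinearMap.comp
          (((evalRightL hL.out 0).comp V).prod ((evalZeroL hL.out 0).comp V))))))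
  have hT : ∀ x, T x ∈ stateSubmodule L := fun x =>
    ⟨evalRightL_apply hL.out 0 (V x), evalZeroL_apply hL.out 0 (V x)⟩
  exact ⟨(T.codRestrict (stateSubmodule L) hT : E →L[ℂ] stateSubmodule L), fun x => ⟨rfl, rfl⟩⟩

end State

theorem IsPrimitive.pt_eq {L : ℝ} (hL : 0 < L) {u : L2 L} {f f' : ℝ → ℂ} (h : IsPrimitive L f f')
    (hu : u =ᵐ[vol L] f) {x : ℝ} (hx : x ∈ Icc 0 L) : pt u x = f x :=
  Crane.pt_eq hL (h.continuousOn hL) hu hx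

/-! ### The stiffness coefficient -/

/-- `P` is positive and twice weakly differentiable, with derivatives `P'` and `P''`. -/
structure IsStiffness (L : ℝ) (P : ℝ → ℝ) (P' P'' : ℝ → ℂ) : Prop where
  pos : ∀ x ∈ Icc 0 L, 0 < P x
  prim : IsPrimitive L (fun x => (P x : ℂ)) P'
  prim_deriv : IsPrimitive L P' P''

theorem exists_isStiffness {L : ℝ} (hL : 0 < L) {P : ℝ → ℝ} (hP : ContinuousOn P (Icc 0 L))
    (hPH2 : MemSobolev 2 L fun x => (P x : ℂ)) (hpos : ∃ P₀ : ℝ, 0 < P₀ ∧ ∀ x ∈ Icc 0 L, P₀ ≤ P x) :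
    ∃ P' P'' : ℝ → ℂ, IsStiffness L P P' P'' := by
  obtain ⟨u, hu⟩ := hPH2
  obtain ⟨P₀, h0, hP₀⟩ := hpos
  refine ⟨pt (D 1 u), D 2 u, fun x hx => h0.trans_le (hP₀ x hx), ?_, u.isPrimitive hL 1⟩
  refine (u.isPrimitive hL 0).congr hL (fun x hx => ?_) (u.ae_eq_pt hL 1)
  exact pt_eq hL (Complex.continuous_ofReal.comp_continuousOn hP) hu.symm hx

namespace IsStiffness

variable {L : ℝ} {P : ℝ → ℝ} {P' P'' : ℝ → ℂ}

theorem ne_zero (hP : IsStiffness L P P' P'') {x : ℝ} (hx : x ∈ Icc 0 L) : (P x : ℂ) ≠ 0 := by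
  exact_mod_cast (hP.pos x hx).ne'

theorem continuousOn (hP : IsStiffness L P P' P'') (hL : 0 < L) : ContinuousOn P (Icc 0 L) :=
  (Complex.continuous_re.comp_continuousOn (hP.prim.continuousOn hL)).congr fun x _ => by simp

theorem inv (hP : IsStiffness L P P' P'') (hL : 0 < L) :
    IsPrimitive L (fun x => (P x : ℂ)⁻¹) fun x => -1 * (P' x * ((P x : ℂ)⁻¹ * (P x : ℂ)⁻¹)) :=
  (hP.prim.inv hL (hP.prim_deriv.continuousOn hL) fun _ hx => hP.ne_zero hx).congr hL
    (fun _ _ => rfl) (ae_of_all _ fun x => by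
      simp only [neg_mul, one_mul, div_eq_mul_inv, pow_two, mul_inv])

/-- The derivative of `1 / P` is again a primitive, because `P` lies in `H²`. This regularity puts
the solution `w` of the inverse problem in `H³`. -/
theorem inv_deriv (hP : IsStiffness L P P' P'') (hL : 0 < L) :
    ∃ R, IsPrimitive L (fun x => -1 * (P' x * ((P x : ℂ)⁻¹ * (P x : ℂ)⁻¹))) R :=
  ⟨_, (hP.prim_deriv.mul ((hP.inv hL).mul (hP.inv hL) hL) hL).const_mul (-1)⟩

/-- The operator `w ↦ (P w')'`. -/
noncomputable def fluxL (hP : IsStiffness L P P' P'') (hL : 0 < L) : Sobolev 2 L →L[ℂ] L2 L :=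
  (mulL (hP.prim_deriv.continuousOn hL)).comp (derivL L 1) +
    (mulL (hP.prim.continuousOn hL)).comp (derivL L 2)

theorem fluxL_ae (hP : IsStiffness L P P' P'') (hL : 0 < L) (w : Sobolev 2 L) :
    hP.fluxL hL w =ᵐ[vol L] fun x => P' x * pt (D 1 w) x + P x * D 2 w x := by
  filter_upwards [Lp.coeFn_add (mulL (hP.prim_deriv.continuousOn hL) (D 1 w))
    (mulL (hP.prim.continuousOn hL) (D 2 w)), coeFn_mulL (hP.prim_deriv.continuousOn hL) (D 1 w),
    coeFn_mulL (hP.prim.continuousOn hL) (D 2 w), w.ae_eq_pt hL 1] with x h1 h2 h3 h4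
  change (mulL (hP.prim_deriv.continuousOn hL) (D 1 w)
    + mulL (hP.prim.continuousOn hL) (D 2 w) : L2 L) x = _
  change D 1 w x = pt (D 1 w) x at h4
  rw [h1, Pi.add_apply, h2, h3, h4]

theorem isPrimitive_flux (hP : IsStiffness L P P' P'') (hL : 0 < L) (w : Sobolev 2 L) :
    IsPrimitive L (fun x => P x * pt (D 1 w) x) (hP.fluxL hL w) :=
  (hP.prim.mul (w.isPrimitive hL 1) hL).congr hL (fun _ _ => rfl) (hP.fluxL_ae hL w).symm

theorem isFluxDeriv (hP : IsStiffness L P P' P'') (hL : 0 < L) (w : Sobolev 2 L) :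
    IsFluxDeriv P w (hP.fluxL hL w) :=
  ((hP.isPrimitive_flux hL w).isWeakDeriv hL).congr (by
    filter_upwards [w.ae_eq_pt hL 1] with x h
    change D 1 w x = pt (D 1 w) x at h
    rw [h]) (ae_eq_refl _)

theorem flux'_eq (hP : IsStiffness L P P' P'') (hL : 0 < L) (w : Sobolev 2 L) :
    flux' P w = hP.fluxL hL w := by
  have h : ∃ q : L2 L, IsFluxDeriv P w q := ⟨_, hP.isFluxDeriv hL w⟩
  rw [flux', dif_pos h]
  exact h.choose_spec.unique (hP.isFluxDeriv hL w)

end IsStiffness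

/-! ### The inverse of the closed-loop operator -/

section Inverse

variable {L : ℝ} [hL : Fact (0 < L)] {P : ℝ → ℝ} {P' P'' : ℝ → ℂ}

/-- Removes the chosen witnesses `velocity` and `fluxDeriv`: by uniqueness they can only be the
components `w` and `v` of the value. -/
theorem mem_graph_iff {hPc : ContinuousOn P (Icc 0 L)} {θ : Fin 4 → ℝ} {z y : StateSpace L} :
    (z, y) ∈ (craneOperator L P hPc θ).graph ↔
      (∃ w₃ : Sobolev 3 L, D 0 w₃ = D 0 (toTuple z).w) ∧
        BoundaryConditions P θ (toTuple z) (toTuple y).w (toTuple y).v := by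
  rw [LinearPMap.mem_graph_iff]
  constructor
  · rintro ⟨z', rfl, rfl⟩
    exact ⟨z'.2.1, boundaryConditions (hP := hPc) z'⟩
  · rintro ⟨hw, hb⟩
    let z' : craneDomain L P hPc θ := ⟨z, hw, _, _, hb⟩
    obtain ⟨h1, h2⟩ := (boundaryConditions z').unique hb
    exact ⟨z', rfl, state_ext h1 h2⟩

/-- If `A z = 0`, the flux `P w'` is constant and vanishes at `L`, so `w' = 0`. The feedback
condition then reduces to `θ₃ w(0) = 0`, with `θ 2` standing for `θ₃`. -/
theorem graph_injective (hP : IsStiffness L P P' P'') {hPc : ContinuousOn P (Icc 0 L)}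
    {θ : Fin 4 → ℝ} (hθ : θ 2 ≠ 0) {z : StateSpace L}
    (h : (z, 0) ∈ (craneOperator L P hPc θ).graph) : z = 0 := by
  obtain ⟨-, hb⟩ := mem_graph_iff.mp h
  have h0 : (toTuple (0 : StateSpace L)).v = 0 := rfl
  have h0w : (toTuple (0 : StateSpace L)).w = 0 := rfl
  obtain ⟨hv, hf, hr, hl⟩ := hb
  set w := (toTuple z).w with hw
  rw [h0] at hf hr hl
  rw [h0w] at hl hv
  rw [map_zero] at hf hr hl hv
  have hL0 := zero_mem_Icc hL.out
  have hLL := self_mem_Icc hL.out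
  have hflux := hf.unique (hP.isFluxDeriv hL.out w)
  have hp := hP.isPrimitive_flux hL.out w
  rw [← hflux] at hp
  have hp0 : ∀ x ∈ Icc 0 L, P x * pt (D 1 w) x = P 0 * pt (D 1 w) 0 := by
    intro x hx
    have h1 := (hp.congr hL.out (fun _ _ => rfl) (Lp.coeFn_zero ℂ 2 (vol L))).eq x hx
    simpa using h1
  rw [pt_zero hL.out hLL, eq_comm, neg_eq_zero] at hr
  have h1 : ∀ x ∈ Icc 0 L, pt (D 1 w) x = 0 := by
    intro x hx
    have e := (hp0 x hx).trans (hp0 L hLL).symm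
    rw [hr, mul_zero] at e
    exact (mul_eq_zero.mp e).resolve_left (hP.ne_zero hx)
  have hD1 : D 1 w = 0 := by
    refine Lp.ext ?_
    filter_upwards [w.ae_eq_pt hL.out 1, Lp.coeFn_zero ℂ 2 (vol L),
      ae_restrict_mem measurableSet_Ioo] with x h2 h3 hx
    change D 1 w x = pt (D 1 w) x at h2
    rw [h2, h3, h1 x (Ioo_subset_Icc_self hx)]
    rfl
  have hw0 : pt (D 0 w) 0 = 0 := by
    rw [pt_zero hL.out hL0] at hl
    simp only [feedback, map_zero, pt_zero hL.out hL0, h1 0 hL0] at hl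
    have : (θ 2 : ℂ) ≠ 0 := by exact_mod_cast hθ
    simpa [this] using hl.symm
  have hD0 : D 0 w = 0 := by
    have hp := w.isPrimitive hL.out 0
    change IsPrimitive L (pt (D 0 w)) (D 1 w) at hp
    rw [hD1] at hp
    have hp := hp.congr hL.out (fun _ _ => rfl) (Lp.coeFn_zero ℂ 2 (vol L))
    refine Lp.ext ?_
    filter_upwards [w.ae_eq_pt hL.out 0, Lp.coeFn_zero ℂ 2 (vol L),
      ae_restrict_mem measurableSet_Ioo] with x h2 h3 hx
    change D 0 w x = pt (D 0 w) x at h2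
    rw [h2, h3, hp.eq x (Ioo_subset_Icc_self hx), hw0]
    simp
  refine state_ext ?_ ?_
  · exact D_zero_injective (hD0.trans (map_zero _).symm)
  · exact D_zero_injective (hv.symm.trans (map_zero _).symm)

theorem exists_inverse (hP : IsStiffness L P P' P'') (hPc : ContinuousOn P (Icc 0 L))
    {θ : Fin 4 → ℝ} (hθ : θ 2 ≠ 0) :
    ∃ K : StateSpace L →L[ℂ] StateSpace L, ∀ y, (K y, y) ∈ (craneOperator L P hPc θ).graph := by
  have hR := hP.inv hL.out
  obtain ⟨R'', hR'⟩ := hP.inv_deriv hL.out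
  set R : ℝ → ℂ := fun x => (P x : ℂ)⁻¹ with hRdef
  set R' : ℝ → ℂ := fun x => -1 * (P' x * ((P x : ℂ)⁻¹ * (P x : ℂ)⁻¹))
  let G : StateSpace L →L[ℂ] L2 L := (derivL L 0).comp (stateV L)
  -- The flux at `0`, chosen so that `U = c + ∫₀ˣ G` equals `-P(L) v_y(L)` at `L`, which is `w'(L) =
  -- -v_y(L)`. Then `T₁ = U / P` is `w'` and `T₂` is `w''`.
  let c : StateSpace L →L[ℂ] ℂ :=
    -((P L : ℂ) • (evalRightL hL.out 0).comp (stateV L)) - (integralL L).comp G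
  let U : StateSpace L →L[ℂ] L2 L := (constL L).comp c + (volterraL hL.out).comp G
  let T₁ : StateSpace L →L[ℂ] L2 L := (mulL (hR.continuousOn hL.out)).comp U
  let T₂ : StateSpace L →L[ℂ] L2 L := (mulL (hR'.continuousOn hL.out)).comp U +
    (mulL (hR.continuousOn hL.out)).comp G
  -- The value `w(0)`, obtained by solving the feedback condition with `w'(0) = c / P(0)` and with
  -- `w_y` as the velocity.
  let w₀ : StateSpace L →L[ℂ] ℂ := (θ 2 : ℂ)⁻¹ • ((evalZeroL hL.out 0).comp (stateV L) -
    (θ 0 : ℂ) • (evalZeroL hL.out 0).comp (stateW L) -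
    (θ 1 : ℂ) • (evalZeroL hL.out 1).comp (stateW L) - ((θ 3 : ℂ) * (P 0 : ℂ)⁻¹) • c)
  let T₀ : StateSpace L →L[ℂ] L2 L := (constL L).comp w₀ + (volterraL hL.out).comp T₁
  have hUp : ∀ y, IsPrimitive L (fun x => c y + ∫ t in (0)..x, G y t) (G y) := fun y =>
    isPrimitive_integral (Lp.memLp _) _
  have hUae : ∀ y, U y =ᵐ[vol L] fun x => c y + ∫ t in (0)..x, G y t := by
    intro y
    filter_upwards [Lp.coeFn_add (constL L (c y)) (volterraL hL.out (G y)),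
      coeFn_constL (L := L) (c y), coeFn_volterraL hL.out (G y)] with x h1 h2 h3
    change (constL L (c y) + volterraL hL.out (G y) : L2 L) x = _
    rw [h1, Pi.add_apply, h2, h3]
  have hT₁ae : ∀ y, T₁ y =ᵐ[vol L] fun x => R x * (c y + ∫ t in (0)..x, G y t) := by
    intro y
    filter_upwards [coeFn_mulL (hR.continuousOn hL.out) (U y), hUae y] with x h1 h2
    rw [← h2]
    exact h1
  have hT₂ae : ∀ y, T₂ y =ᵐ[vol L]
      fun x => R' x * (c y + ∫ t in (0)..x, G y t) + R x * G y x := by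
    intro y
    filter_upwards [Lp.coeFn_add (mulL (hR'.continuousOn hL.out) (U y))
      (mulL (hR.continuousOn hL.out) (G y)), coeFn_mulL (hR'.continuousOn hL.out) (U y),
      coeFn_mulL (hR.continuousOn hL.out) (G y), hUae y] with x h1 h2 h3 h4
    change (mulL (hR'.continuousOn hL.out) (U y) + mulL (hR.continuousOn hL.out) (G y) : L2 L) x = _
    rw [h1, Pi.add_apply, h2, h3, h4]
  have hT₀ae : ∀ y, T₀ y =ᵐ[vol L] fun x => w₀ y + ∫ t in (0)..x, T₁ y t := by
    intro y
    filter_upwards [Lp.coeFn_add (constL L (w₀ y)) (volterraL hL.out (T₁ y)),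
      coeFn_constL (L := L) (w₀ y), coeFn_volterraL hL.out (T₁ y)] with x h1 h2 h3
    change (constL L (w₀ y) + volterraL hL.out (T₁ y) : L2 L) x = _
    rw [h1, Pi.add_apply, h2, h3]
  have hT₁p : ∀ y, IsPrimitive L (fun x => R x * (c y + ∫ t in (0)..x, G y t)) (T₂ y) := fun y =>
    (hR.mul (hUp y) hL.out).congr hL.out (fun _ _ => rfl) (hT₂ae y).symm
  have hT₀p : ∀ y, IsPrimitive L (fun x => w₀ y + ∫ t in (0)..x, T₁ y t) (T₁ y) := fun y =>
    isPrimitive_integral (Lp.memLp _) _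
  have hw₀₁ : ∀ y, IsWeakDeriv L (T₀ y) (T₁ y) := fun y =>
    ((hT₀p y).isWeakDeriv hL.out).congr (hT₀ae y).symm (ae_eq_refl _)
  have hw₁₂ : ∀ y, IsWeakDeriv L (T₁ y) (T₂ y) := fun y =>
    ((hT₁p y).isWeakDeriv hL.out).congr (hT₁ae y).symm (ae_eq_refl _)
  obtain ⟨W, hW⟩ := exists_sobolevL (n := 2) ![T₀, T₁, T₂] fun y k => by
    fin_cases k
    · exact hw₀₁ y
    · exact hw₁₂ y
  obtain ⟨V, hV⟩ := exists_sobolevL (n := 1)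
    ![(derivL L 0).comp (stateW L), (derivL L 1).comp (stateW L)] fun y k => by
      fin_cases k
      exact isWeakDeriv_D (stateW L y) 0
  obtain ⟨K, hK⟩ := exists_stateL W V
  have hW0 : ∀ y, D 0 (W y) = T₀ y := fun y => hW y 0
  have hW1 : ∀ y, D 1 (W y) = T₁ y := fun y => hW y 1
  have hV0 : ∀ y, D 0 (V y) = D 0 (toTuple y).w := fun y => hV y 0
  have hL0 := zero_mem_Icc hL.out
  have hLL := self_mem_Icc hL.out
  refine ⟨K, fun y => mem_graph_iff.mpr ⟨?_, ?_, ?_, ?_, ?_⟩⟩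
  · rw [(hK y).1, hW0]
    have hGp : IsPrimitive L (pt (D 0 (toTuple y).v)) (D 1 (toTuple y).v) :=
      (toTuple y).v.isPrimitive hL.out 0
    -- Product rule for `w'' = (1 / P)' U + G / P`, using that `G = v_y` is in `H¹`; this supplies
    -- the third derivative.
    have hp := (hR'.mul (hUp y) hL.out).add (hR.mul hGp hL.out) hL.out
    obtain ⟨u, hu⟩ := exists_sobolev (n := 3) ![T₀ y, T₁ y, T₂ y, hp.memLp.toLp] fun k => by
      fin_cases k
      · exact hw₀₁ y
      · exact hw₁₂ y
      · refine (hp.isWeakDeriv hL.out).congr ?_ hp.memLp.coeFn_toLp.symm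
        filter_upwards [hT₂ae y, (toTuple y).v.ae_eq_pt hL.out 0] with x h1 h2
        change G y x = _ at h2
        change _ = T₂ y x
        rw [h1, h2]
        rfl
    exact ⟨u, hu 0⟩
  · rw [(hK y).2, hV0]
  · rw [IsFluxDeriv, (hK y).1, hW1]
    refine ((hUp y).isWeakDeriv hL.out).congr ?_ (ae_eq_refl _)
    filter_upwards [hT₁ae y, ae_restrict_mem measurableSet_Ioo] with x h1 hx
    rw [h1, hRdef]
    field_simp [hP.ne_zero (Ioo_subset_Icc_self hx)]
  · rw [(hK y).1, hW1, (hT₁p y).pt_eq hL.out (hT₁ae y) hLL]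
    have h1 : ∫ t in (0)..L, G y t = integralL L (G y) := by
      rw [integralL_apply, intervalIntegral.integral_of_le hL.out.le, integral_Ioc_eq_integral_Ioo]
    have h2 : c y = -((P L : ℂ) * pt (D 0 (toTuple y).v) L) - integralL L (G y) := by
      change -((P L : ℂ) * evalRightL hL.out 0 (stateV L y)) - integralL L (G y) = _
      rw [evalRightL_apply]
      rfl
    rw [h1, h2, hRdef]
    field_simp [hP.ne_zero hLL]
    ring
  · have h1 : pt (D 1 (W y)) 0 = (P 0 : ℂ)⁻¹ * c y := by
      rw [hW1, (hT₁p y).pt_eq hL.out (hT₁ae y) hL0]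
      simp [hRdef]
    have h2 : pt (D 0 (W y)) 0 = w₀ y := by
      rw [hW0, (hT₀p y).pt_eq hL.out (hT₀ae y) hL0]
      simp
    have h3 : w₀ y = (θ 2 : ℂ)⁻¹ * (pt (D 0 (toTuple y).v) 0 - θ 0 * pt (D 0 (toTuple y).w) 0
        - θ 1 * pt (D 1 (toTuple y).w) 0 - θ 3 * (P 0 : ℂ)⁻¹ * c y) := by
      change (θ 2 : ℂ)⁻¹ * (evalZeroL hL.out 0 (stateV L y) - θ 0 * evalZeroL hL.out 0 (stateW L y)
        - θ 1 * evalZeroL hL.out 1 (stateW L y) - θ 3 * (P 0 : ℂ)⁻¹ * c y) = _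
      simp only [evalZeroL_apply]
      rfl
    rw [feedback, (hK y).1, h1, h2, h3]
    have : (θ 2 : ℂ) ≠ 0 := by exact_mod_cast hθ
    field_simp
    ring

end Inverse

/-! ### The energy as the square of a norm -/

theorem integrable_mul_conj {L : ℝ} (f g : L2 L) :
    Integrable (fun x => f x * starRingEnd ℂ (g x)) (vol L) :=
  (L2.integrable_inner (𝕜 := ℂ) g f).congr (ae_of_all _ fun x => by simp)

theorem integral_mul_conj {L : ℝ} (f g : L2 L) :
    ∫ x in Ioo 0 L, f x * starRingEnd ℂ (g x) = inner ℂ g f := by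
  rw [L2.inner_def]
  exact integral_congr_ae (ae_of_all _ fun x => by simp)

theorem IsPrimitive.integral_mul_conj_add {L : ℝ} {f f' g g' : ℝ → ℂ} (hL : 0 < L)
    (hf : IsPrimitive L f f') (hg : IsPrimitive L g g') :
    (∫ x in Ioo 0 L, f' x * starRingEnd ℂ (g x)) + ∫ x in Ioo 0 L, f x * starRingEnd ℂ (g' x) =
      f L * starRingEnd ℂ (g L) - f 0 * starRingEnd ℂ (g 0) := by
  rw [← (hf.mul hg.conj hL).integral_eq hL, integral_add]
  · have := (memLp_continuousOn_mul (hg.conj.continuousOn hL) hf.memLp).integrable (by norm_num)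
    simpa only [mul_comm] using this
  · exact (memLp_continuousOn_mul (hf.continuousOn hL) hg.conj.memLp).integrable (by norm_num)

/-- Any finite sum of squares of bounded operators into `L²` and bounded functionals is the pullback
of one Hilbert norm. The weight `P` in the energy is absorbed beforehand by multiplication with
`√P`. -/
theorem exists_productL {E : Type*} [NormedAddCommGroup E] [NormedSpace ℂ E] {L : ℝ} {m n : ℕ}
    (a : Fin m → E →L[ℂ] L2 L) (b : Fin n → E →L[ℂ] ℂ) :
    ∃ e : E →L[ℂ] WithLp 2 (PiLp 2 (fun _ : Fin m => L2 L) × EuclideanSpace ℂ (Fin n)),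
      ∀ x y, inner ℂ (e x) (e y) =
        ∑ i, inner ℂ (a i x) (a i y) + ∑ j, b j y * starRingEnd ℂ (b j x) := by
  refine ⟨(WithLp.prodContinuousLinearEquiv 2 ℂ (PiLp 2 (fun _ : Fin m => L2 L))
    (EuclideanSpace ℂ (Fin n))).symm.toContinuousLinearMap.comp
      (((PiLp.continuousLinearEquiv 2 ℂ fun _ : Fin m => L2 L).symm.toContinuousLinearMap.comp
        (ContinuousLinearMap.pi a)).prod
      ((PiLp.continuousLinearEquiv 2 ℂ fun _ : Fin n => ℂ).symm.toContinuousLinearMap.comp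
        (ContinuousLinearMap.pi b))), fun x y => ?_⟩
  rw [WithLp.prod_inner_apply, PiLp.inner_apply, PiLp.inner_apply]
  rfl

namespace IsStiffness

variable {L : ℝ} {P : ℝ → ℝ} {P' P'' : ℝ → ℂ}

theorem continuousOn_sqrt (hP : IsStiffness L P P' P'') (hL : 0 < L) :
    ContinuousOn (fun x => ((√(P x) : ℝ) : ℂ)) (Icc 0 L) :=
  Complex.continuous_ofReal.comp_continuousOn (hP.continuousOn hL).sqrt

/-- Multiplication by `√P`. -/
noncomputable def sqrtL (hP : IsStiffness L P P' P'') (hL : 0 < L) : L2 L →L[ℂ] L2 L :=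
  mulL (hP.continuousOn_sqrt hL)

theorem sqrtL_mul_conj_ae (hP : IsStiffness L P P' P'') (hL : 0 < L) (f g : L2 L) :
    (fun x => hP.sqrtL hL f x * starRingEnd ℂ (hP.sqrtL hL g x)) =ᵐ[vol L]
      fun x => P x * (f x * starRingEnd ℂ (g x)) := by
  filter_upwards [coeFn_mulL (hP.continuousOn_sqrt hL) f, coeFn_mulL (hP.continuousOn_sqrt hL) g,
    ae_restrict_mem measurableSet_Ioo] with x h1 h2 hx
  have h3 : ((√(P x) : ℝ) : ℂ) * ((√(P x) : ℝ) : ℂ) = P x := by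
    rw [← Complex.ofReal_mul, Real.mul_self_sqrt (hP.pos x (Ioo_subset_Icc_self hx)).le]
  rw [sqrtL, h1, h2, map_mul, Complex.conj_ofReal, ← h3]
  ring

theorem integral_weighted (hP : IsStiffness L P P' P'') (hL : 0 < L) (f g : L2 L) :
    ∫ x in Ioo 0 L, P x * (f x * starRingEnd ℂ (g x)) =
      inner ℂ (hP.sqrtL hL g) (hP.sqrtL hL f) := by
  rw [← integral_mul_conj, integral_congr_ae (hP.sqrtL_mul_conj_ae hL f g)]

theorem integrable_weighted (hP : IsStiffness L P P' P'') (hL : 0 < L) (f g : L2 L) :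
    Integrable (fun x => P x * (f x * starRingEnd ℂ (g x))) (vol L) :=
  (integrable_mul_conj _ _).congr (hP.sqrtL_mul_conj_ae hL f g)

theorem energyForm_eq (hP : IsStiffness L P P' P'') (hL : 0 < L) (α₁ α₂ γ : ℝ)
    (z₁ z₂ : Ambient L) : energyForm P α₁ α₂ γ z₁ z₂ =
    α₁ * (γ * inner ℂ (hP.fluxL hL z₂.w) (hP.fluxL hL z₁.w) +
        inner ℂ (hP.sqrtL hL (D 1 z₂.w)) (hP.sqrtL hL (D 1 z₁.w)))
      + α₁ * γ * P L * (pt (D 1 z₁.w) L * starRingEnd ℂ (pt (D 1 z₂.w) L))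
      + α₂ * (pt (D 0 z₁.w) 0 * starRingEnd ℂ (pt (D 0 z₂.w) 0))
      + α₁ * (γ * inner ℂ (hP.sqrtL hL (D 1 z₂.v)) (hP.sqrtL hL (D 1 z₁.v)) +
        inner ℂ (D 0 z₂.v) (D 0 z₁.v))
      + α₁ * P L * (z₁.ξ * starRingEnd ℂ z₂.ξ)
      + α₂ * γ * (z₁.ψ * starRingEnd ℂ z₂.ψ)
      + 1 / 2 * (cartTerm P α₁ α₂ z₁ * starRingEnd ℂ (cartTerm P α₁ α₂ z₂)) := by
  rw [energyForm, hP.flux'_eq hL, hP.flux'_eq hL,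
    integral_add ((integrable_mul_conj _ _).const_mul _) (hP.integrable_weighted hL _ _),
    integral_const_mul, integral_mul_conj, hP.integral_weighted hL]
  simp only [mul_assoc (γ : ℂ)]
  rw [integral_add ((hP.integrable_weighted hL _ _).const_mul _) (integrable_mul_conj _ _),
    integral_const_mul, integral_mul_conj, hP.integral_weighted hL]

end IsStiffness

/-! ### Coercivity of the energy. -/

section Energy

variable {L : ℝ} [hL : Fact (0 < L)] {P : ℝ → ℝ} {P' P'' : ℝ → ℂ}

/-- The functional `cartTerm` is bounded on the state space. -/
theorem exists_cartTermL (P : ℝ → ℝ) (α₁ α₂ : ℝ) :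
    ∃ T : StateSpace L →L[ℂ] ℂ, ∀ z, T z = cartTerm P α₁ α₂ (toTuple z) := by
  refine ⟨(evalZeroL hL.out 0).comp (stateV L)
    - (2 * α₁ * P 0 : ℂ) • (evalZeroL hL.out 1).comp (stateW L)
    + (2 * α₂ : ℂ) • (evalZeroL hL.out 0).comp (stateW L), fun z => ?_⟩
  rw [cartTerm, state_ψ]
  change evalZeroL hL.out 0 (stateV L z) - (2 * α₁ * P 0 : ℂ) * evalZeroL hL.out 1 (stateW L z)
    + (2 * α₂ : ℂ) * evalZeroL hL.out 0 (stateW L z) = _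
  simp only [evalZeroL_apply]
  rfl

/-- The target of the energy map. -/
abbrev EnergySpace (L : ℝ) : Type :=
  WithLp 2 (PiLp 2 (fun _ : Fin 4 => L2 L) × EuclideanSpace ℂ (Fin 5))

theorem inner_ofReal_smul_smul {E : Type*} [NormedAddCommGroup E] [InnerProductSpace ℂ E] {c : ℝ}
    (hc : 0 ≤ c) (x y : E) :
    inner ℂ (((√c : ℝ) : ℂ) • x) (((√c : ℝ) : ℂ) • y) = c * inner ℂ x y := by
  rw [inner_smul_left, inner_smul_right, Complex.conj_ofReal, ← mul_assoc, ← Complex.ofReal_mul,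
    Real.mul_self_sqrt hc]

theorem ofReal_mul_conj_mul {c : ℝ} (hc : 0 ≤ c) (x y : ℂ) :
    ((√c : ℝ) : ℂ) * x * starRingEnd ℂ (((√c : ℝ) : ℂ) * y) = c * (x * starRingEnd ℂ y) := by
  have h : ((√c : ℝ) : ℂ) * ((√c : ℝ) : ℂ) = c := by
    rw [← Complex.ofReal_mul, Real.mul_self_sqrt hc]
  rw [map_mul, Complex.conj_ofReal, ← h]
  ring

/-- This and the next lemmas propagate bounds by a common quantity `N`, later `‖e x‖`, without
tracking constants. -/
theorem exists_bound_of_exists_bound {E F : Type*} [NormedAddCommGroup E] [NormedSpace ℂ E]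
    [NormedAddCommGroup F] [NormedSpace ℂ F] {α : Type*} {N : α → ℝ} {T : α → E} (S : E →L[ℂ] F)
    (h : ∃ C, ∀ x, ‖T x‖ ≤ C * N x) : ∃ C, ∀ x, ‖S (T x)‖ ≤ C * N x := by
  obtain ⟨C, hC⟩ := h
  refine ⟨‖S‖ * C, fun x => (S.le_opNorm _).trans ?_⟩
  rw [mul_assoc]
  gcongr
  exact hC x

theorem exists_bound_add {E : Type*} [NormedAddCommGroup E] {α : Type*} {N : α → ℝ} {T S : α → E}
    (h : ∃ C, ∀ x, ‖T x‖ ≤ C * N x) (h' : ∃ C, ∀ x, ‖S x‖ ≤ C * N x) :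
    ∃ C, ∀ x, ‖T x + S x‖ ≤ C * N x := by
  obtain ⟨C, hC⟩ := h
  obtain ⟨C', hC'⟩ := h'
  exact ⟨C + C', fun x => (norm_add_le _ _).trans (by linarith [hC x, hC' x])⟩

theorem exists_bound_of_smul {E : Type*} [NormedAddCommGroup E] [NormedSpace ℂ E] {α : Type*}
    {N : α → ℝ} {T : α → E} {c : ℝ} (hc : 0 < c)
    (h : ∃ C, ∀ x, ‖((√c : ℝ) : ℂ) • T x‖ ≤ C * N x) : ∃ C, ∀ x, ‖T x‖ ≤ C * N x := by
  obtain ⟨C, hC⟩ := h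
  have hc' : 0 < √c := Real.sqrt_pos.mpr hc
  refine ⟨C / √c, fun x => ?_⟩
  have := hC x
  rw [norm_ofReal_smul hc'.le] at this
  rw [div_mul_eq_mul_div, le_div_iff₀ hc']
  linarith

theorem exists_bound_of_weighted (hP : IsStiffness L P P' P'') {α : Type*} {N : α → ℝ}
    {T : α → L2 L} (h : ∃ C, ∀ x, ‖hP.sqrtL hL.out (T x)‖ ≤ C * N x) :
    ∃ C, ∀ x, ‖T x‖ ≤ C * N x := by
  have hc : ContinuousOn (fun x => ((√(P x) : ℝ) : ℂ)⁻¹) (Icc 0 L) :=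
    (hP.continuousOn_sqrt hL.out).inv₀ fun x hx => by
      exact_mod_cast (Real.sqrt_pos.mpr (hP.pos x hx)).ne'
  have e : ∀ f, mulL hc (hP.sqrtL hL.out f) = f := by
    intro f
    refine Lp.ext ?_
    filter_upwards [coeFn_mulL hc (hP.sqrtL hL.out f), coeFn_mulL (hP.continuousOn_sqrt hL.out) f,
      ae_restrict_mem measurableSet_Ioo] with x h1 h2 hx
    rw [h1, IsStiffness.sqrtL, h2, inv_mul_cancel_left₀]
    exact_mod_cast (Real.sqrt_pos.mpr (hP.pos x (Ioo_subset_Icc_self hx))).ne'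
  have := exists_bound_of_exists_bound (mulL hc) h
  simpa only [e] using this

/-- The components of `e` are the summands of the form, scaled by square roots of their
coefficients. For the lower bound, `w` is recovered from `w(0)` and `w'`, and `w''` as `((P w')' -
P' w') / P`. The other parts of the norm are themselves components, up to the weight `√P` and
constants. -/
theorem exists_energyL (hP : IsStiffness L P P' P'') {α₁ α₂ γ : ℝ} (hα₁ : 0 < α₁) (hα₂ : 0 < α₂)
    (hγ : 0 < γ) :
    ∃ e : StateSpace L →L[ℂ] EnergySpace L,
      (∀ x y, energyForm P α₁ α₂ γ (toTuple x) (toTuple y) = inner ℂ (e y) (e x)) ∧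
      ∃ c, AntilipschitzWith c e := by
  obtain ⟨cart, hcart⟩ := exists_cartTermL (L := L) P α₁ α₂
  have hLL := self_mem_Icc hL.out
  have hPL := hP.pos L hLL
  let a : Fin 4 → StateSpace L →L[ℂ] L2 L :=
    ![((√(α₁ * γ) : ℝ) : ℂ) • (hP.fluxL hL.out).comp (stateW L),
      ((√α₁ : ℝ) : ℂ) • (hP.sqrtL hL.out).comp ((derivL L 1).comp (stateW L)),
      ((√(α₁ * γ) : ℝ) : ℂ) • (hP.sqrtL hL.out).comp ((derivL L 1).comp (stateV L)),
      ((√α₁ : ℝ) : ℂ) • (derivL L 0).comp (stateV L)]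
  let b : Fin 5 → StateSpace L →L[ℂ] ℂ :=
    ![((√(α₁ * γ * P L) : ℝ) : ℂ) • (evalRightL hL.out 1).comp (stateW L),
      ((√α₂ : ℝ) : ℂ) • (evalZeroL hL.out 0).comp (stateW L),
      ((√(α₁ * P L) : ℝ) : ℂ) • (evalRightL hL.out 0).comp (stateV L),
      ((√(α₂ * γ) : ℝ) : ℂ) • (evalZeroL hL.out 0).comp (stateV L),
      ((√(1 / 2) : ℝ) : ℂ) • cart]
  obtain ⟨e, he⟩ := exists_productL a b
  refine ⟨e, fun x y => ?_, ?_⟩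
  · rw [he, hP.energyForm_eq hL.out, Fin.sum_univ_four, Fin.sum_univ_five]
    simp only [a, b, Matrix.cons_val_zero, Matrix.cons_val_one, Matrix.cons_val,
      smul_apply, ContinuousLinearMap.comp_apply, derivL_apply,
      evalZeroL_apply, evalRightL_apply, smul_eq_mul, hcart, stateW_apply, stateV_apply]
    rw [inner_ofReal_smul_smul (by positivity), inner_ofReal_smul_smul (by positivity),
      inner_ofReal_smul_smul (by positivity), inner_ofReal_smul_smul (by positivity),
      ofReal_mul_conj_mul (by positivity), ofReal_mul_conj_mul (by positivity),
      ofReal_mul_conj_mul (by positivity), ofReal_mul_conj_mul (by positivity),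
      ofReal_mul_conj_mul (by positivity), state_ξ, state_ψ, state_ξ, state_ψ]
    push_cast
    change _ = _ + (_ * _ * _ * (pt (D 1 (toTuple x).w) L * starRingEnd ℂ (pt (D 1 (toTuple y).w) L))
      + _ + _ + _ + _)
    ring
  · have hsq : ∀ x, ‖e x‖ ^ 2 = ∑ i, ‖a i x‖ ^ 2 + ∑ j, ‖b j x‖ ^ 2 := by
      intro x
      have h := he x x
      simp only [inner_self_eq_norm_sq_to_K, Complex.mul_conj, Complex.normSq_eq_norm_sq,
        Complex.coe_algebraMap] at h
      exact_mod_cast h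
    have ha : ∀ i, ∃ C, ∀ x, ‖a i x‖ ≤ C * ‖e x‖ := fun i => ⟨1, fun x => by
      rw [one_mul]
      refine le_of_sq_le_sq ?_ (norm_nonneg _)
      rw [hsq]
      have h1 := Finset.single_le_sum (f := fun i => ‖a i x‖ ^ 2) (fun _ _ => sq_nonneg _)
        (Finset.mem_univ i)
      have h2 : 0 ≤ ∑ j, ‖b j x‖ ^ 2 := by positivity
      exact h1.trans (by linarith)⟩
    have hb : ∀ j, ∃ C, ∀ x, ‖b j x‖ ≤ C * ‖e x‖ := fun j => ⟨1, fun x => by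
      rw [one_mul]
      refine le_of_sq_le_sq ?_ (norm_nonneg _)
      rw [hsq]
      have h1 := Finset.single_le_sum (f := fun j => ‖b j x‖ ^ 2) (fun _ _ => sq_nonneg _)
        (Finset.mem_univ j)
      have h2 : 0 ≤ ∑ i, ‖a i x‖ ^ 2 := by positivity
      exact h1.trans (by linarith)⟩
    have hflux : ∃ C, ∀ x, ‖hP.fluxL hL.out (stateW L x)‖ ≤ C * ‖e x‖ :=
      exists_bound_of_smul (mul_pos hα₁ hγ) (ha 0)
    have hw1 : ∃ C, ∀ x, ‖derivL L 1 (stateW L x)‖ ≤ C * ‖e x‖ :=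
      exists_bound_of_weighted hP (exists_bound_of_smul hα₁ (ha 1))
    have hv1 : ∃ C, ∀ x, ‖derivL L 1 (stateV L x)‖ ≤ C * ‖e x‖ :=
      exists_bound_of_weighted hP (exists_bound_of_smul (mul_pos hα₁ hγ) (ha 2))
    have hv0 : ∃ C, ∀ x, ‖derivL L 0 (stateV L x)‖ ≤ C * ‖e x‖ := exists_bound_of_smul hα₁ (ha 3)
    have hw00 : ∃ C, ∀ x, ‖evalZeroL hL.out 0 (stateW L x)‖ ≤ C * ‖e x‖ :=
      exists_bound_of_smul hα₂ (hb 1)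
    have hξ : ∃ C, ∀ x, ‖evalRightL hL.out 0 (stateV L x)‖ ≤ C * ‖e x‖ :=
      exists_bound_of_smul (mul_pos hα₁ hPL) (hb 2)
    have hψ : ∃ C, ∀ x, ‖evalZeroL hL.out 0 (stateV L x)‖ ≤ C * ‖e x‖ :=
      exists_bound_of_smul (mul_pos hα₂ hγ) (hb 3)
    have hw0 : ∃ C, ∀ x, ‖derivL L 0 (stateW L x)‖ ≤ C * ‖e x‖ := by
      have h := exists_bound_add (exists_bound_of_exists_bound (constL L) hw00)
        (exists_bound_of_exists_bound (volterraL hL.out) hw1)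
      refine h.imp fun C hC x => le_of_eq_of_le (congrArg _ ?_) (hC x)
      rw [evalZeroL_apply]
      exact D_eq_const_add_volterra hL.out (stateW L x) 0
    have hw2 : ∃ C, ∀ x, ‖derivL L 2 (stateW L x)‖ ≤ C * ‖e x‖ := by
      have h := exists_bound_of_exists_bound (mulL ((hP.inv hL.out).continuousOn hL.out))
        (exists_bound_add hflux (exists_bound_of_exists_bound
          (-mulL (hP.prim_deriv.continuousOn hL.out)) hw1))
      refine h.imp fun C hC x => le_of_eq_of_le (congrArg _ ?_) (hC x)
      set w := stateW L x
      have h1 : hP.fluxL hL.out w + (-mulL (hP.prim_deriv.continuousOn hL.out)) (derivL L 1 w) =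
          mulL (hP.prim.continuousOn hL.out) (D 2 w) := by
        change mulL (hP.prim_deriv.continuousOn hL.out) (D 1 w)
          + mulL (hP.prim.continuousOn hL.out) (D 2 w)
          + -mulL (hP.prim_deriv.continuousOn hL.out) (D 1 w) = _
        abel
      rw [h1]
      refine Lp.ext ?_
      filter_upwards [coeFn_mulL ((hP.inv hL.out).continuousOn hL.out)
        (mulL (hP.prim.continuousOn hL.out) (D 2 w)), coeFn_mulL (hP.prim.continuousOn hL.out) (D 2 w),
        ae_restrict_mem measurableSet_Ioo] with x h2 h3 hx
      rw [h2, h3, inv_mul_cancel_left₀ (hP.ne_zero (Ioo_subset_Icc_self hx))]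
      rfl
    obtain ⟨C₁, h₁⟩ := hw0
    obtain ⟨C₂, h₂⟩ := hw1
    obtain ⟨C₃, h₃⟩ := hw2
    obtain ⟨C₄, h₄⟩ := hv0
    obtain ⟨C₅, h₅⟩ := hv1
    obtain ⟨C₆, h₆⟩ := hξ
    obtain ⟨C₇, h₇⟩ := hψ
    obtain ⟨B, hB⟩ : ∃ B, B = C₁ ^ 2 + C₂ ^ 2 + C₃ ^ 2 + C₄ ^ 2 + C₅ ^ 2 + C₆ ^ 2 + C₇ ^ 2 := ⟨_, rfl⟩
    refine ⟨(√B).toNNReal, e.antilipschitz_of_bound fun x => ?_⟩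
    rw [Real.coe_toNNReal _ (Real.sqrt_nonneg _)]
    refine le_of_sq_le_sq ?_ (by positivity)
    rw [mul_pow, Real.sq_sqrt (by rw [hB]; positivity), ← norm_toTuple, Ambient.norm_sq,
      Sobolev.norm_sq, Sobolev.norm_sq, Fin.sum_univ_three, Fin.sum_univ_two, state_ξ, state_ψ, hB]
    have sq : ∀ {r C : ℝ}, 0 ≤ r → r ≤ C * ‖e x‖ → r ^ 2 ≤ C ^ 2 * ‖e x‖ ^ 2 := fun h0 h => by
      rw [← mul_pow]
      gcongr
    have k₁ := sq (norm_nonneg _) (h₁ x)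
    have k₂ := sq (norm_nonneg _) (h₂ x)
    have k₃ := sq (norm_nonneg _) (h₃ x)
    have k₄ := sq (norm_nonneg _) (h₄ x)
    have k₅ := sq (norm_nonneg _) (h₅ x)
    have k₆ := sq (norm_nonneg _) (h₆ x)
    have k₇ := sq (norm_nonneg _) (h₇ x)
    rw [evalRightL_apply] at k₆
    rw [evalZeroL_apply] at k₇
    simp only [derivL_apply, stateW_apply, stateV_apply, Fin.castSucc_zero] at k₁ k₂ k₃ k₄ k₅ k₆ k₇
    linarith

end Energy

/-! ### Dissipativity -/

/-- The constant `δ` is determinant over trace of the form on the right, a lower bound for its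
smaller eigenvalue. The hypothesis on `γ` says `γ (k² + b²) / 2 ≤ δ`. -/
theorem quadratic_form_le {k b γ p x : ℝ} (hb : 0 < b) (hm : 0 < 4 * b - (k + 1) ^ 2)
    (hγ0 : 0 ≤ γ) (hγ : γ * (k ^ 2 + b ^ 2) ≤ (4 * b - (k + 1) ^ 2) / (2 * (1 + b))) :
    γ / 2 * (k ^ 2 * p ^ 2 + b ^ 2 * x ^ 2) ≤ p ^ 2 - (k + 1) * (p * x) + b * x ^ 2 := by
  set δ := (4 * b - (k + 1) ^ 2) / (4 * (1 + b)) with hδ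
  have hδ0 : 0 < δ := by positivity
  have hδm : δ * (4 * (1 + b)) = 4 * b - (k + 1) ^ 2 := by
    rw [hδ]; field_simp
  have hδ1 : 0 < 1 - δ := by nlinarith [sq_nonneg (k + 1)]
  have h1 : γ * (k ^ 2 + b ^ 2) ≤ 2 * δ := by
    refine hγ.trans_eq ?_
    rw [hδ]; field_simp; ring
  have h2 : γ / 2 * (k ^ 2 * p ^ 2 + b ^ 2 * x ^ 2) ≤ δ * (p ^ 2 + x ^ 2) := by
    have h3 : k ^ 2 * p ^ 2 + b ^ 2 * x ^ 2 ≤ (k ^ 2 + b ^ 2) * (p ^ 2 + x ^ 2) := by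
      nlinarith [mul_nonneg (sq_nonneg k) (sq_nonneg x), mul_nonneg (sq_nonneg b) (sq_nonneg p)]
    calc _ ≤ γ / 2 * ((k ^ 2 + b ^ 2) * (p ^ 2 + x ^ 2)) := by gcongr
      _ = γ * (k ^ 2 + b ^ 2) / 2 * (p ^ 2 + x ^ 2) := by ring
      _ ≤ 2 * δ / 2 * (p ^ 2 + x ^ 2) := by gcongr
      _ = _ := by ring
  -- Completing the square in the form minus `δ (p² + x²)`; by the choice of `δ` the remainder is
  -- exactly `δ² x²`.
  have h4 : 0 ≤ (1 - δ) * ((1 - δ) * p ^ 2 - (k + 1) * (p * x) + (b - δ) * x ^ 2) := by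
    have : (1 - δ) * ((1 - δ) * p ^ 2 - (k + 1) * (p * x) + (b - δ) * x ^ 2) =
        ((1 - δ) * p - (k + 1) / 2 * x) ^ 2 + δ ^ 2 * x ^ 2 := by
      linear_combination (-(x ^ 2) / 4) * hδm
    rw [this]
    positivity
  have h5 := nonneg_of_mul_nonneg_right h4 hδ1
  linarith

/-- Young's inequality eliminates `F`, leaving at most `(k p - b x)² / 4` in the bracket. -/
theorem boundary_form_nonpos {k b γ : ℝ} (hb : 0 < b) (hm : 0 < 4 * b - (k + 1) ^ 2)
    (hγ0 : 0 ≤ γ) (hγ : γ * (k ^ 2 + b ^ 2) ≤ (4 * b - (k + 1) ^ 2) / (2 * (1 + b))) (p x F : ℝ) :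
    -p ^ 2 + (k + 1) * (p * x) - b * x ^ 2 + γ * (-F ^ 2 + F * (k * p - b * x)) ≤ 0 := by
  have h1 := quadratic_form_le (p := p) (x := x) hb hm hγ0 hγ
  have h2 : -F ^ 2 + F * (k * p - b * x) ≤ 1 / 2 * (k ^ 2 * p ^ 2 + b ^ 2 * x ^ 2) := by
    nlinarith [sq_nonneg (F - (k * p - b * x) / 2), sq_nonneg (k * p + b * x)]
  have h3 := mul_le_mul_of_nonneg_left h2 hγ0
  linarith

open ComplexConjugate in
/-- The boundary terms that remain after integration by parts. -/
theorem re_energy_nonpos {α₁ α₂ γ a b t P₀ P₁ : ℝ} (hα : α₁ * P₀ = t / 2) (hb : 0 < b)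
    (hm : 0 < 4 * b - (b - a + 1) ^ 2) (hγ0 : 0 ≤ γ)
    (hγ : γ * ((b - a) ^ 2 + b ^ 2) ≤ (4 * b - (b - a + 1) ^ 2) / (2 * (1 + b)))
    {A B C E s₁ g₁ f₁ p s F w₀ w₁ : ℂ}
    (hF : F = (-2 * α₂ - a) * p + t * s - 2 * b * α₂ * w₀ + b * t * w₁)
    (hAB : A + conj B = P₁ * s₁ * conj g₁ - P₀ * s * conj F)
    (hCE : C + conj E = P₁ * -g₁ * conj f₁ - P₀ * w₁ * conj p) :
    (α₁ * (γ * A + E) + α₁ * γ * P₁ * (s₁ * conj (-g₁)) + α₂ * (p * conj w₀)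
      + α₁ * (γ * B + C) + α₁ * P₁ * (g₁ * conj f₁) + α₂ * γ * (F * conj p)
      + 1 / 2 * ((F - 2 * α₁ * P₀ * s + 2 * α₂ * p) *
        conj (p - 2 * α₁ * P₀ * w₁ + 2 * α₂ * w₀))).re ≤ 0 := by
  have hα' : (2 * α₁ * P₀ : ℂ) = t := by
    have : 2 * α₁ * P₀ = t := by linarith
    exact_mod_cast this
  rw [hα']
  set x := p - t * w₁ + 2 * α₂ * w₀ with hx
  -- The choice of gains at work: the cart functional of `A z` depends only on `p = v(0)` and on the
  -- cart functional `x` of `z`.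
  have hY : F - t * s + 2 * α₂ * p = (b - a) * p - b * x := by rw [hF, hx]; ring
  rw [hY]
  have e1 := congrArg Complex.re hAB
  have e2 := congrArg Complex.re hCE
  -- The remaining Hermitian form has real coefficients, so its real part splits into the same real
  -- form evaluated at real and at imaginary parts.
  have r := boundary_form_nonpos hb hm hγ0 hγ p.re x.re F.re
  have i := boundary_form_nonpos hb hm hγ0 hγ p.im x.im F.im
  have y1 := congrArg Complex.re hY
  have y2 := congrArg Complex.im hY
  have x1 := congrArg Complex.re hx
  have x2 := congrArg Complex.im hx
  simp only [Complex.add_re, Complex.sub_re, Complex.neg_re, Complex.mul_re, Complex.conj_re,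
    Complex.conj_im, Complex.ofReal_re, Complex.ofReal_im, Complex.add_im, Complex.sub_im,
    Complex.neg_im, Complex.mul_im, Complex.re_ofNat, Complex.im_ofNat, Complex.one_re,
    Complex.one_im, Complex.div_re, Complex.div_im, Complex.normSq_ofNat, zero_mul, mul_zero,
    add_zero, sub_zero] at e1 e2 y1 y2 x1 x2 ⊢
  linear_combination (1 / 2) * r + (1 / 2) * i + α₁ * γ * e1 + α₁ * e2
    - (γ * (s.re * F.re + s.im * F.im) + (w₁.re * p.re + w₁.im * p.im)) * hα
    + γ / 2 * F.re * y1 + γ / 2 * F.im * y2 - p.re / 2 * x1 - p.im / 2 * x2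

section Main

variable {L : ℝ} [hL : Fact (0 < L)] {P : ℝ → ℝ} {P' P'' : ℝ → ℂ}

/-- Two integrations by parts pair the integrals: `(P w_y')'` against `v_y`, and `(P w_z')' = v_y`
against `w_y = v_z`. What remains is handled by `re_energy_nonpos`. -/
theorem re_energyForm_nonpos (hP : IsStiffness L P P' P'') {hPc : ContinuousOn P (Icc 0 L)}
    {θ : Fin 4 → ℝ} {α₁ α₂ γ a b : ℝ} (hα : α₁ * P 0 = θ 1 / 2) (hθ₀ : θ 0 = -2 * α₂ - a)
    (hθ₂ : θ 2 = -2 * b * α₂) (hθ₃ : θ 3 = b * θ 1) (hb : 0 < b)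
    (hm : 0 < 4 * b - (b - a + 1) ^ 2) (hγ0 : 0 ≤ γ)
    (hγ : γ * ((b - a) ^ 2 + b ^ 2) ≤ (4 * b - (b - a + 1) ^ 2) / (2 * (1 + b)))
    {y z : StateSpace L} (h : (z, y) ∈ (craneOperator L P hPc θ).graph) :
    (energyForm P α₁ α₂ γ (toTuple y) (toTuple z)).re ≤ 0 := by
  obtain ⟨-, hv, hf, hr, hl⟩ := mem_graph_iff.mp h
  have hflux : hP.fluxL hL.out (toTuple z).w = D 0 (toTuple y).v :=
    (hP.isFluxDeriv hL.out _).unique hf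
  have hv1 : D 1 (toTuple z).v = D 1 (toTuple y).w := by
    have h1 := isWeakDeriv_D (toTuple z).v 0
    have h2 := isWeakDeriv_D (toTuple y).w 0
    change IsWeakDeriv L (D 0 (toTuple z).v) (D 1 (toTuple z).v) at h1
    change IsWeakDeriv L (D 0 (toTuple y).w) (D 1 (toTuple y).w) at h2
    rw [← hv] at h1
    exact h1.unique h2
  have hslope : pt (D 1 (toTuple z).w) L = -pt (D 0 (toTuple y).v) L := by rw [hr, neg_neg]
  have ae1 : ∀ w : Sobolev 2 L, D 1 w =ᵐ[vol L] pt (D 1 w) := fun w => w.ae_eq_pt hL.out 1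
  have ae0 : D 0 (toTuple y).w =ᵐ[vol L] pt (D 0 (toTuple y).w) := (toTuple y).w.ae_eq_pt hL.out 0
  have ae0' : D 0 (toTuple y).v =ᵐ[vol L] pt (D 0 (toTuple y).v) :=
    (toTuple y).v.ae_eq_pt hL.out 0
  have hAB := (hP.isPrimitive_flux hL.out (toTuple y).w).integral_mul_conj_add hL.out
    ((toTuple y).v.isPrimitive hL.out 0)
  have hCE := (hP.isPrimitive_flux hL.out (toTuple z).w).integral_mul_conj_add hL.out
    ((toTuple y).w.isPrimitive hL.out 0)
  have eA : ∫ x in Ioo 0 L, hP.fluxL hL.out (toTuple y).w x *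
      starRingEnd ℂ (pt (D 0 (toTuple y).v) x) =
      inner ℂ (D 0 (toTuple y).v) (hP.fluxL hL.out (toTuple y).w) := by
    rw [← integral_mul_conj]
    exact integral_congr_ae (by filter_upwards [ae0'] with x hx; rw [hx])
  have eC : ∫ x in Ioo 0 L, D 0 (toTuple y).v x * starRingEnd ℂ (pt (D 0 (toTuple y).w) x) =
      inner ℂ (D 0 (toTuple y).w) (D 0 (toTuple y).v) := by
    rw [← integral_mul_conj]
    exact integral_congr_ae (by filter_upwards [ae0] with x hx; rw [hx])
  have eW : ∀ (w : Sobolev 2 L) (g : L2 L),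
      ∫ x in Ioo 0 L, P x * pt (D 1 w) x * starRingEnd ℂ (g x) =
      starRingEnd ℂ (inner ℂ (hP.sqrtL hL.out (D 1 w)) (hP.sqrtL hL.out g)) := by
    intro w g
    rw [inner_conj_symm, ← hP.integral_weighted hL.out]
    exact integral_congr_ae (by filter_upwards [ae1 w] with x hx; rw [hx, mul_assoc])
  rw [hflux] at hCE
  change _ = (P L * pt (D 1 (toTuple y).w) L) * starRingEnd ℂ (pt (D 0 (toTuple y).v) L)
    - (P 0 * pt (D 1 (toTuple y).w) 0) * starRingEnd ℂ (pt (D 0 (toTuple y).v) 0) at hAB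
  change _ = (P L * pt (D 1 (toTuple z).w) L) * starRingEnd ℂ (pt (D 0 (toTuple y).w) L)
    - (P 0 * pt (D 1 (toTuple z).w) 0) * starRingEnd ℂ (pt (D 0 (toTuple y).w) 0) at hCE
  rw [eW, hslope] at hCE
  rw [eW] at hAB
  have hF : pt (D 0 (toTuple y).v) 0 = (-2 * α₂ - a) * pt (D 0 (toTuple y).w) 0
      + θ 1 * pt (D 1 (toTuple y).w) 0 - 2 * b * α₂ * pt (D 0 (toTuple z).w) 0
      + b * θ 1 * pt (D 1 (toTuple z).w) 0 := by
    rw [hl, feedback, hθ₀, hθ₂, hθ₃]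
    push_cast
    ring
  have key := re_energy_nonpos hα hb hm hγ0 hγ hF
    ((congrArg₂ (· + ·) eA.symm rfl).trans hAB)
    ((congrArg₂ (· + ·) eC.symm rfl).trans hCE)
  rw [hP.energyForm_eq hL.out, hflux, ← hv, hv1, hslope, cartTerm, cartTerm, state_ξ, state_ψ,
    state_ξ, state_ψ, ← hv]
  exact key

theorem isEquivalentInnerProduct_of_antilipschitz {X H : Type*} [NormedAddCommGroup X]
    [NormedSpace ℂ X] [NormedAddCommGroup H] [InnerProductSpace ℂ H] {e : X →L[ℂ] H} {c : ℝ≥0}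
    (hc : AntilipschitzWith c e) {B : X → X → ℂ} (hB : ∀ x y, B x y = inner ℂ (e y) (e x)) :
    IsEquivalentInnerProduct B := by
  have hnorm : ∀ x, √(B x x).re = ‖e x‖ := fun x => by
    rw [hB, inner_self_eq_norm_sq_to_K]
    have : (((‖e x‖ : ℝ) : ℂ) ^ 2).re = ‖e x‖ ^ 2 := by norm_cast
    simp only [Complex.coe_algebraMap]
    rw [this, Real.sqrt_sq (norm_nonneg _)]
  refine ⟨⟨{
    inner := fun x y => inner ℂ (e x) (e y)
    conj_inner_symm := fun x y => inner_conj_symm _ _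
    re_inner_nonneg := fun x => inner_self_nonneg
    add_left := fun x y z => by rw [map_add, inner_add_left]
    smul_left := fun x y r => by rw [map_smul, inner_smul_left]
    definite := fun x hx => eq_zero_of_antilipschitz hc (inner_self_eq_zero.mp hx) },
    fun x y => (hB y x).symm⟩, ((c : ℝ) + 1)⁻¹, ‖e‖ + 1, by positivity, by positivity, fun x => ?_⟩
  rw [hnorm]
  constructor
  · rw [inv_mul_le_iff₀ (by positivity)]
    have := hc.le_mul_norm (map_zero e) x
    linarith [norm_nonneg (e x)]
  · have := e.le_opNorm x
    linarith [norm_nonneg x]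

end Main

end Crane

/-! ### The main theorem. -/

theorem theorem2p2 (L : ℝ) [Fact (0 < L)]
    (P : ℝ → ℝ) (hPcont : ContinuousOn P (Icc 0 L))
    (hPH2 : Crane.MemSobolev 2 L (fun x => (P x : ℂ)))
    (hPpos : ∃ P₀ : ℝ, 0 < P₀ ∧ ∀ x ∈ Icc 0 L, P₀ ≤ P x)
    (θ₁ θ₂ θ₃ θ₄ a b : ℝ) (ha : 0 < a) (hb : 0 < b) (hab : (a + b - 1) ^ 2 < 4 * a * b)
    (hθ₁ : θ₁ = θ₃ / b - a) (hθ₂ : θ₂ = θ₄ / b)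
    (hθ₁neg : θ₁ < 0) (hθ₃neg : θ₃ < 0) (hθ₂pos : 0 < θ₂) (hθ₄pos : 0 < θ₄) :
    ∃ S : Crane.C0Semigroup (Crane.StateSpace L),
      Crane.IsGenerator (Crane.craneOperator L P hPcont ![θ₁, θ₂, θ₃, θ₄]) S ∧
      (∃ M : ℝ, ∀ t, ‖S.T t‖ ≤ M) ∧
      ∃ γ₀ : ℝ, 0 < γ₀ ∧ ∀ γ : ℝ, 0 < γ → γ < γ₀ →
        Crane.IsEquivalentInnerProduct (fun z₁ z₂ : Crane.StateSpace L =>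
          Crane.energyForm P (θ₂ / (2 * P 0)) (-(θ₂ * θ₃) / (2 * θ₄)) γ (Crane.toTuple z₁) (Crane.toTuple z₂)) ∧
        ∀ (t : ℝ≥0) (z : Crane.StateSpace L),
          (Crane.energyForm P (θ₂ / (2 * P 0)) (-(θ₂ * θ₃) / (2 * θ₄)) γ
              (Crane.toTuple (S.T t z)) (Crane.toTuple (S.T t z))).re ≤
            (Crane.energyForm P (θ₂ / (2 * P 0)) (-(θ₂ * θ₃) / (2 * θ₄)) γ
              (Crane.toTuple z) (Crane.toTuple z)).re := by
  have hL : 0 < L := Fact.out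
  obtain ⟨P', P'', hP⟩ := Crane.exists_isStiffness hL hPcont hPH2 hPpos
  have hP0 := hP.pos 0 (left_mem_Icc.mpr hL.le)
  obtain ⟨α₁, hα₁⟩ : ∃ α₁, α₁ = θ₂ / (2 * P 0) := ⟨_, rfl⟩
  obtain ⟨α₂, hα₂⟩ : ∃ α₂, α₂ = -(θ₂ * θ₃) / (2 * θ₄) := ⟨_, rfl⟩
  rw [← hα₁, ← hα₂]
  have hα₁pos : 0 < α₁ := by rw [hα₁]; positivity
  have hα₂pos : 0 < α₂ := by
    rw [hα₂]
    exact div_pos (neg_pos.mpr (mul_neg_of_pos_of_neg hθ₂pos hθ₃neg)) (by positivity)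
  have hθ₄' : θ₄ = b * θ₂ := by rw [hθ₂]; field_simp
  have hθ₃' : θ₃ = -2 * b * α₂ := by
    rw [hα₂, hθ₄']
    field_simp
  have hθ₁' : θ₁ = -2 * α₂ - a := by
    rw [hθ₁, hθ₃']
    field_simp
  have hα : α₁ * P 0 = θ₂ / 2 := by rw [hα₁]; field_simp
  -- Both `(a + b - 1)² - 4 a b` and `(b - a + 1)² - 4 b` expand to the same polynomial.
  have hm : 0 < 4 * b - (b - a + 1) ^ 2 := by nlinarith
  have hk : 0 < (b - a) ^ 2 + b ^ 2 := by positivity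
  obtain ⟨K, hK⟩ := Crane.exists_inverse hP hPcont (θ := ![θ₁, θ₂, θ₃, θ₄]) hθ₃neg.ne
  have hgraph : ∀ x y, (x, y) ∈ (Crane.craneOperator L P hPcont ![θ₁, θ₂, θ₃, θ₄]).graph ↔
      x = K y := by
    refine fun x y => ⟨fun h => ?_, fun h => h ▸ hK y⟩
    have h1 := Submodule.sub_mem _ h (hK y)
    rw [Prod.mk_sub_mk, sub_self] at h1
    exact sub_eq_zero.mp (Crane.graph_injective hP hθ₃neg.ne h1)
  have hinj : Function.Injective K := by
    refine (injective_iff_map_eq_zero K).mpr fun y hy => ?_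
    have h1 := hK y
    rw [hy] at h1
    exact LinearPMap.graph_fst_eq_zero_snd _ h1 rfl
  obtain ⟨γ₀, hγ₀⟩ : ∃ γ₀, γ₀ = (4 * b - (b - a + 1) ^ 2) / (2 * (1 + b)) / ((b - a) ^ 2 + b ^ 2) :=
    ⟨_, rfl⟩
  have hγ₀pos : 0 < γ₀ := by rw [hγ₀]; positivity
  have hdiss : ∀ γ, 0 < γ → γ < γ₀ → ∃ e : Crane.StateSpace L →L[ℂ] Crane.EnergySpace L,
      (∀ x y, Crane.energyForm P α₁ α₂ γ (Crane.toTuple x) (Crane.toTuple y) = inner ℂ (e y) (e x)) ∧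
      (∃ c, AntilipschitzWith c e) ∧ Crane.IsDissipativeFor e K := by
    intro γ hγ hγ'
    obtain ⟨e, he, hc⟩ := Crane.exists_energyL hP hα₁pos hα₂pos hγ
    refine ⟨e, he, hc, fun x => ?_⟩
    rw [← he]
    exact Crane.re_energyForm_nonpos hP (θ := ![θ₁, θ₂, θ₃, θ₄]) hα hθ₁' hθ₃' hθ₄' hb hm hγ.le
      ((le_div_iff₀ hk).mp (hγ'.le.trans_eq hγ₀)) (hK x)
  -- Any admissible `γ` serves to construct the semigroup; `hcontr` then gives contractivity for all
  -- the others.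
  obtain ⟨e, -, ⟨c, hc⟩, hd⟩ := hdiss (γ₀ / 2) (by positivity) (by linarith)
  obtain ⟨S, hgen, hbound, hcontr⟩ := Crane.exists_C0Semigroup hc hd hinj
  refine ⟨S, fun x y => (hgraph x y).trans (hgen x y), hbound, γ₀, hγ₀pos, fun γ hγ hγ' => ?_⟩
  obtain ⟨e', he', ⟨c', hc'⟩, hd'⟩ := hdiss γ hγ hγ'
  refine ⟨Crane.isEquivalentInnerProduct_of_antilipschitz hc' he', fun t z => ?_⟩
  have h1 := hcontr e' hd' t z
  rw [he', he', inner_self_eq_norm_sq_to_K, inner_self_eq_norm_sq_to_K]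
  simp only [Complex.coe_algebraMap]
  norm_cast
  gcongr
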